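/- **Conventions.** Let $k$ be a field of characteristic $0$. Vector spaces are graded by an abelian group $\Gamma$ equipped with a parity homomorphism $\Gamma\to\mathbb Z/2$ and an odd element $e$, the degree of differentials (for example $\Gamma=\mathbb Z$ or $\Gamma=\mathbb Z/2$ with $e=1$); all signs follow the Koszul rule. For a graded vector space $A$ let $T_A=\bigoplus_{n\ge0}A^{\otimes n}$ with $\Delta(a_1\otimes\cdots\otimes a_n)=\sum_{j=0}^n(a_1\otimes\cdots\otimes a_j)\otimes(a_{j+1}\otimes\cdots\otimes a_n)$, let $\pi_A:T_A\to A$ be the projection, and write $f_n=\pi_A f|_{B^{\otimes n}}$ for the components of $f:T_B\to T_A$. $\mathrm{Coder}(T_A)$ is the graded Lie algebra of homogeneous $D$ with $\Delta D=(D\otimes1+1\otimes D)\Delta$, under the graded commutator. An $A_\infty$-algebra $(A,\partial)$ (with $A$ carrying the suspended degrees) is a coderivation $\partial$ of $T_A$ of degree $e$ with $\partial^2=0$ and $r_0=0$, where $r_n=\partial_n$; it is minimal if $r_1=0$. An $A_\infty$-morphism $F$ is a degree $0$ coalgebra morphism with $F_0=0$ commuting with the differentials, and a quasi-isomorphism if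 $F_1$ is an isomorphism on cohomology of $r_1$. **Theorem.** Let $(A,\partial)$ be an $A_\infty$-algebra and $(H,\widetilde\partial)$ a minimal model of it, i.e. a minimal $A_\infty$-algebra with an $A_\infty$-quasi-isomorphism $F:(H,\widetilde\partial)\to(A,\partial)$. Then there is a decomposition $A=F_1(H)\oplus\operatorname{Im}r_1\oplus L$ into graded subspaces with $F_1$ injective and $F_1(H)\oplus \operatorname{Im}r_1=\operatorname{Ker} r_1$. For every such decomposition let $\pi_H:A\to H$ be the projection (so $\pi_HF_1=1$) and $G=(r_1|_L)^{-1}\pi_{\operatorname{Im}r_1}:A\to A$. Then: 1. There are unique linear maps $\bar F:T_A\to T_H$ and $U:T_A\to T_A$ with $$\Delta\bar F=(\bar F\otimes\bar F)\Delta,\quad \bar F(1)=1,\qquad \Delta U=(U\otimes F\bar F+1\otimes U)\Delta,\quad U(1)=0,$$ whose components are given recursively by $\bar F_1=\pi_H$, $U_1=G$ and, for $n\ge2$, $$U_n=-G\,Z_n,\qquad \bar F_n=-\pi_H Z_n,\qquad Z_n=\sum_{m=2}^n r_m\,U|_{A^{\otimes n}\to A^{\otimes m}}+\sum_{m=2}^nF_m\,\bar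 F|_{A^{\otimes n}\to H^{\otimes m}} .$$ (If $GF_m=0$ and $\pi_HF_m=0$ for $m\ge2$, as for the usual minimal model morphism, the second sum does not contribute; if moreover $r_m=0$ for $m\ge3$, then $U_n=-G\,r_2\sum_{i=1}^{n-1}\big(U_i\otimes(F\bar F)_{n-i}+(1_{T_A})_{n-i}\otimes U_i\big)$, and similarly for $\bar F_n$.) 2. $(F,\bar F,U)$ is a deformation retraction: $F$ and $\bar F$ are morphisms of complexes of degree $0$, $U$ has degree $-e$, $\bar FF=1$ and $1-F\bar F=\partial U+U\partial$. 3. There is an $L_\infty$-morphism of DG Lie algebras $$L:(\mathrm{Coder}(T_A),[\partial,\cdot],[\cdot,\cdot])\longrightarrow(\mathrm{Coder}(T_H),[\widetilde\partial,\cdot],[\cdot,\cdot])$$ whose components are, for $n\ge0$ and homogeneous $x_0,\dots,x_n$, $$L_{n+1}(x_0,\dots,x_n)=(-1)^n\sum_{\sigma\in S_{n+1}}\epsilon(\sigma)\,\bar F\,x_{\sigma(0)}\,U\,x_{\sigma(1)}\,U\cdots U\,x_{\sigma(n)}\,F ,$$ where $\epsilon(\sigma)$ is the Koszul sign for the suspended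 degrees $|x_i|-e$; in particular these expressions are coderivations of $T_H$. 4. For a coderivation $\delta$ of degree $e$ and $n\ge 0$ one has $\frac1{(n+1)!}L_{n+1}(\delta,\dots,\delta)=(-1)^n\bar F(\delta U)^n\delta F$. For every formal power series $\delta=\sum_{m\ge1}t^m\delta_m$ of coderivations of degree $e$ with $[\partial,\delta]+\frac12[\delta,\delta]=0$, the series $$\widetilde\delta=\sum_{n\ge1}\frac1{n!}L_n(\delta,\dots,\delta)=\sum_{n\ge0}(-1)^n\,\bar F(\delta U)^n\delta F$$ has coderivations of $T_H$ of degree $e$ as coefficients and satisfies $[\widetilde\partial,\widetilde\delta]+\frac12[\widetilde\delta,\widetilde\delta]=0$. -/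

import Mathlib

open scoped TensorProduct

noncomputable section

namespace AInf

/-! ### Gradings and signs

Gradings are by an abelian group `Γ` together with a parity homomorphism `Γ → ℤ/2` and a
distinguished odd element `e`, the degree of differentials. Examples are `Γ = ℤ` with `e = 1`
and `Γ = ℤ/2` with `e = 1`. -/

/-- The data on a grading group that are needed for the Koszul sign rule. -/
structure SignGrading (Γ : Type*) [AddCommGroup Γ] where
  /-- the parity of a degree -/
  par : Γ →+ ZMod 2
  /-- the degree of differentials -/
  e : Γ
  par_e : par e = 1

/-- The sign `(-1)^a`, as an element of `k`. -/
def ksign (k : Type*) [Ring k] (a : ZMod 2) : k := if a = 0 then 1 else -1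

/-! ### Differential graded Lie algebras and `L∞`-morphisms between them -/

/-- A DG Lie algebra graded by `Γ`, whose homogeneous components `gr a` are realised as subspaces
of a common vector space `E`. The bracket has degree `0` and the differential has degree `e`. -/
structure DGLie (k : Type*) [Field k] {Γ : Type*} [AddCommGroup Γ] (g : SignGrading Γ)
    (E : Type*) [AddCommGroup E] [Module k E] where
  gr : Γ → Submodule k E
  d : ∀ a, gr a →ₗ[k] gr (g.e + a)
  br : ∀ a b, gr a →ₗ[k] gr b →ₗ[k] gr (a + b)
  d_d : ∀ a (x : gr a), d _ (d a x) = 0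
  br_symm : ∀ a b (x : gr a) (y : gr b),
    (br a b x y : E) = -(ksign k (g.par a * g.par b) • (br b a y x : E))
  jacobi : ∀ a b c (x : gr a) (y : gr b) (z : gr c),
    (br a (b + c) x (br b c y z) : E) =
      br (a + b) c (br a b x y) z
        + ksign k (g.par a * g.par b) • (br b (a + c) y (br a c x z) : E)
  leibniz : ∀ a b (x : gr a) (y : gr b),
    (d (a + b) (br a b x y) : E) =
      br (g.e + a) b (d a x) y + ksign k (g.par a) • (br a (g.e + b) x (d b y) : E)

section LInfinity

variable {k : Type*} [Field k] {Γ : Type*} [AddCommGroup Γ] {g : SignGrading Γ}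
  {E E' : Type*} [AddCommGroup E] [Module k E] [AddCommGroup E'] [Module k E']

/-- Homogeneous elements, each with its degree. -/
abbrev DGLie.Hom (V : DGLie k g E) := Σ a, V.gr a

/-- The parity of a homogeneous element in the suspension `V[1]`. -/
def DGLie.spar (V : DGLie k g E) (x : V.Hom) : ZMod 2 := g.par x.1 + 1

/-- The differential, on homogeneous elements. -/
def DGLie.Q₁ (V : DGLie k g E) (x : V.Hom) : V.Hom := ⟨g.e + x.1, V.d x.1 x.2⟩

/-- The bracket transported to the suspension, where it is graded symmetric:
`Q₂(x, y) = (-1)^(|x| + 1) [x, y]`. -/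
def DGLie.Q₂ (V : DGLie k g E) (x y : V.Hom) : V.Hom :=
  ⟨x.1 + y.1, ksign k (V.spar x) • V.br x.1 y.1 x.2 y.2⟩

/-- The Koszul sign, for the suspended degrees, of the permutation that turns `x₀, x₁, …` into
`x_{σ 0}, x_{σ 1}, …`. -/
def koszul {V : DGLie k g E} {n : ℕ} (σ : Equiv.Perm (Fin n)) (x : Fin n → V.Hom) : k :=
  ∏ q : Fin n × Fin n,
    if q.1 < q.2 ∧ σ q.2 < σ q.1 then ksign k (V.spar (x (σ q.1)) * V.spar (x (σ q.2))) else 1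

/-- The Koszul sign, for the suspended degrees, of the unshuffle that moves the `x_j` with
`j ∈ S` in front of the others, both groups keeping their order. -/
def koszulFront {V : DGLie k g E} {n : ℕ} (S : Finset (Fin n)) (x : Fin n → V.Hom) : k :=
  ∏ q : Fin n × Fin n,
    if q.1 < q.2 ∧ q.1 ∉ S ∧ q.2 ∈ S then ksign k (V.spar (x q.1) * V.spar (x q.2)) else 1

/-- The subsequence of the `x_j` with `j ∈ S`. -/
def sub {V : DGLie k g E} {n : ℕ} (S : Finset (Fin n)) (x : Fin n → V.Hom) :
    Fin S.card → V.Hom :=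
  fun a => x (S.orderEmbOfFin rfl a)

/-- An `L∞`-morphism between DG Lie algebras. The components are given on the suspension, where
they are graded symmetric and preserve degrees, so that the `n`-th one has degree `(1 - n) e` for
the unsuspended degrees. The field `relation` says that the induced morphism between the
symmetric coalgebras of `V[1]` and `V'[1]` is compatible with the codifferentials `Q₁ + Q₂`. -/
structure LInftyMorphism (V : DGLie k g E) (V' : DGLie k g E') where
  comp : ∀ (n : ℕ) (a : Fin n → Γ),
    MultilinearMap k (fun i => V.gr (a i)) (V'.gr (g.e + ∑ i, (a i - g.e)))
  comp_zero : ∀ a, comp 0 a = 0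
  symm : ∀ (n : ℕ) (x : Fin n → V.Hom) (σ : Equiv.Perm (Fin n)),
    (comp n (fun i => (x (σ i)).1) (fun i => (x (σ i)).2) : E') =
      koszul σ x • (comp n (fun i => (x i).1) (fun i => (x i).2) : E')
  relation : ∀ (n : ℕ) (x : Fin n → V.Hom),
    let L : ∀ {m : ℕ}, (Fin m → V.Hom) → V'.Hom := fun {m} y =>
      ⟨_, comp m (fun i => (y i).1) (fun i => (y i).2)⟩
    ((V'.Q₁ (L x)).2 : E')
        + (1 / 2 : k) • ∑ S : Finset (Fin n) with S.Nonempty ∧ Sᶜ.Nonempty,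
            koszulFront S x • ((V'.Q₂ (L (sub S x)) (L (sub Sᶜ x))).2 : E') =
      (∑ i : Fin n, koszulFront {i} x •
          ((L (Fin.cons (V.Q₁ (x i)) (sub {i}ᶜ x) : Fin (_ + 1) → V.Hom)).2 : E'))
        + ∑ q : Fin n × Fin n with q.1 < q.2, koszulFront {q.1, q.2} x •
            ((L (Fin.cons (V.Q₂ (x q.1) (x q.2)) (sub {q.1, q.2}ᶜ x) :
              Fin (_ + 1) → V.Hom)).2 : E')

/-- The value of the `n`-th component of an `L∞`-morphism on homogeneous elements. -/
def LInftyMorphism.app {V : DGLie k g E} {V' : DGLie k g E'} (L : LInftyMorphism V V') {n : ℕ}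
    (x : Fin n → V.Hom) : E' :=
  L.comp n (fun i => (x i).1) (fun i => (x i).2)

/-- Formal power series solutions `∑_{m ≥ 1} t^m δ_m` of the Maurer–Cartan equation
`d δ + ½ [δ, δ] = 0`. -/
def DGLie.IsFormalMC (V : DGLie k g E) (δ : ℕ → V.gr g.e) : Prop :=
  δ 0 = 0 ∧ ∀ m : ℕ, V.d g.e (δ m)
    + (1 / 2 : k) • ∑ q ∈ Finset.HasAntidiagonal.antidiagonal m, V.br g.e g.e (δ q.1) (δ q.2) = 0

end LInfinity

/-! ### The tensor coalgebra

The underlying space of `T_A = ⨁_{n ≥ 0} A^{⊗ n}` is Mathlib's `TensorAlgebra k A`. -/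

section Coalgebra

variable {k : Type*} [Field k]

section Deconc

variable (k) (A : Type*) [AddCommGroup A] [Module k A]

/-- Auxiliary: the action `a ↦ ((z, x) ↦ ((a ⊗ 1) z + 1 ⊗ (a x), a x))`. -/
def deconcStep : A →ₗ[k] Module.End k
    ((TensorAlgebra k A ⊗[k] TensorAlgebra k A) × TensorAlgebra k A) where
  toFun a :=
    (((LinearMap.mulLeft k (TensorAlgebra.ι k a)).rTensor (TensorAlgebra k A)
        ∘ₗ LinearMap.fst k _ _)
      + (TensorProduct.mk k (TensorAlgebra k A) (TensorAlgebra k A) 1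
        ∘ₗ LinearMap.mulLeft k (TensorAlgebra.ι k a) ∘ₗ LinearMap.snd k _ _)).prod
      (LinearMap.mulLeft k (TensorAlgebra.ι k a) ∘ₗ LinearMap.snd k _ _)
  map_add' a b := by
    have h : LinearMap.mulLeft k (TensorAlgebra.ι k a + TensorAlgebra.ι k b) =
      LinearMap.mulLeft k (TensorAlgebra.ι k a) + LinearMap.mulLeft k (TensorAlgebra.ι k b) := by
      ext; simp [add_mul]
    refine LinearMap.ext fun x => Prod.ext ?_ ?_
    · simp [h, LinearMap.rTensor_add, TensorProduct.tmul_add]; abel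
    · simp [add_mul]
  map_smul' c a := by
    have h : LinearMap.mulLeft k (c • TensorAlgebra.ι k a) =
      c • LinearMap.mulLeft k (TensorAlgebra.ι k a) := by
      ext; simp
    refine LinearMap.ext fun x => Prod.ext ?_ ?_
    · simp [h, LinearMap.rTensor_smul]
    · simp

/-- The comultiplication of `T_A`, determined by `Δ 1 = 1 ⊗ 1` and
`Δ (a x) = (a ⊗ 1) Δ x + 1 ⊗ (a x)` for `a ∈ A`. By `deconc_prod` below it is
`Δ (a₁ ⋯ aₙ) = ∑_{j=0}^n (a₁ ⋯ a_j) ⊗ (a_{j+1} ⋯ aₙ)`. -/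
def deconc : TensorAlgebra k A →ₗ[k] TensorAlgebra k A ⊗[k] TensorAlgebra k A :=
  LinearMap.fst k _ _ ∘ₗ LinearMap.applyₗ (1 ⊗ₜ[k] 1, 1)
    ∘ₗ (TensorAlgebra.lift k (deconcStep k A)).toLinearMap

variable {k A}

theorem deconc_one : deconc k A 1 = 1 ⊗ₜ 1 := by simp [deconc]

theorem deconc_snd (x : TensorAlgebra k A) :
    (TensorAlgebra.lift k (deconcStep k A) x (1 ⊗ₜ[k] 1, 1)).2 = x := by
  suffices h : ∀ z, (TensorAlgebra.lift k (deconcStep k A) x z).2 = x * z.2 by simp [h]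
  induction x using TensorAlgebra.induction with
  | algebraMap r => intro z; simp [Algebra.algebraMap_eq_smul_one]
  | ι a => intro z; simp [deconcStep]
  | mul a b ha hb => intro z; simp [ha, hb, mul_assoc]
  | add a b ha hb => intro z; simp [ha, hb, add_mul]

theorem deconc_ι_mul (a : A) (x : TensorAlgebra k A) :
    deconc k A (TensorAlgebra.ι k a * x) =
      (LinearMap.mulLeft k (TensorAlgebra.ι k a)).rTensor _ (deconc k A x)
        + 1 ⊗ₜ (TensorAlgebra.ι k a * x) := by
  have := deconc_snd x
  simp [deconc, deconcStep] at this ⊢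
  rw [this]

theorem deconc_prod (l : List A) :
    deconc k A (l.map (TensorAlgebra.ι k)).prod =
      ∑ j ∈ Finset.range (l.length + 1),
        ((l.take j).map (TensorAlgebra.ι k)).prod ⊗ₜ ((l.drop j).map (TensorAlgebra.ι k)).prod := by
  induction l with
  | nil => simp [deconc_one]
  | cons a l ih =>
    rw [List.map_cons, List.prod_cons, deconc_ι_mul, ih, List.length_cons,
      Finset.sum_range_succ' _ (l.length + 1)]
    simp

end Deconc

variable {Γ : Type*} [AddCommGroup Γ] [DecidableEq Γ]
  {A : Type*} [AddCommGroup A] [Module k A] (𝒜 : Γ → Submodule k A)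
  {B : Type*} [AddCommGroup B] [Module k B] (ℬ : Γ → Submodule k B)

/-- The component of degree `c` of `T_A`, spanned by the products `a₁ ⋯ aₙ` of homogeneous
elements whose degrees add up to `c`. -/
def tdeg (c : Γ) : Submodule k (TensorAlgebra k A) :=
  Submodule.span k {x | ∃ l : List (Γ × A), (∀ q ∈ l, q.2 ∈ 𝒜 q.1) ∧
    (l.map Prod.fst).sum = c ∧ x = (l.map fun q => TensorAlgebra.ι k q.2).prod}

/-- A linear map `T_A → T_B` that is homogeneous of degree `c`. -/
def IsHomog (c : Γ) (f : TensorAlgebra k A →ₗ[k] TensorAlgebra k B) : Prop :=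
  ∀ b, ∀ x ∈ tdeg 𝒜 b, f x ∈ tdeg ℬ (c + b)

variable (g : SignGrading Γ) [DirectSum.Decomposition 𝒜] [DirectSum.Decomposition ℬ]

/-- The parity involution `a ↦ (-1)^{|a|} a` of `A`. -/
def parityA : A →ₗ[k] A :=
  DirectSum.toModule k Γ A (fun c => ksign k (g.par c) • (𝒜 c).subtype)
    ∘ₗ (DirectSum.decomposeLinearEquiv 𝒜).toLinearMap

/-- The parity involution `x ↦ (-1)^{|x|} x` of `T_A`. -/
def parityT : TensorAlgebra k A →ₗ[k] TensorAlgebra k A :=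
  (TensorAlgebra.lift k (TensorAlgebra.ι k ∘ₗ parityA 𝒜 g)).toLinearMap

/-- The map `x ↦ (-1)^{p |x|} x` of `T_A`. By the Koszul sign rule `1 ⊗ f`, for `f` of parity `p`,
is the map `x ⊗ y ↦ (-1)^{p |x|} x ⊗ f y`. -/
def parPow (p : ZMod 2) : TensorAlgebra k A →ₗ[k] TensorAlgebra k A :=
  if p = 0 then LinearMap.id else parityT 𝒜 g

/-- The coderivations of `T_A` of degree `c`: the maps `D` of degree `c` with
`Δ D = (D ⊗ 1 + 1 ⊗ D) Δ`, where `1 ⊗ D` obeys the Koszul sign rule. -/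
def Coder (c : Γ) : Submodule k (Module.End k (TensorAlgebra k A)) where
  carrier := {D | IsHomog 𝒜 𝒜 c D ∧ deconc k A ∘ₗ D =
    (TensorProduct.map D LinearMap.id + TensorProduct.map (parPow 𝒜 g (g.par c)) D)
      ∘ₗ deconc k A}
  add_mem' := by
    rintro D D' ⟨h, h1⟩ ⟨h', h1'⟩
    refine ⟨fun b x hx => Submodule.add_mem _ (h b x hx) (h' b x hx), ?_⟩
    rw [LinearMap.comp_add, h1, h1', TensorProduct.map_add_left, TensorProduct.map_add_right,
      ← LinearMap.add_comp]
    congr 1; abel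
  zero_mem' := ⟨fun b x hx => Submodule.zero_mem _, by simp⟩
  smul_mem' := by
    rintro c D ⟨h, h1⟩
    refine ⟨fun b x hx => Submodule.smul_mem _ _ (h b x hx), ?_⟩
    rw [LinearMap.comp_smul, h1, TensorProduct.map_smul_left, TensorProduct.map_smul_right,
      ← smul_add, LinearMap.smul_comp]

/-! #### Closure of coderivations under the graded commutator -/

variable {𝒜 ℬ g}

theorem zmod2_cases (p : ZMod 2) : p = 0 ∨ p = 1 := by revert p; decide

theorem ksign_zero : ksign k 0 = 1 := by simp [ksign]

theorem ksign_one : ksign k 1 = -1 := by simp [ksign]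

theorem zmod2_one_add_one : (1 + 1 : ZMod 2) = 0 := by decide

section Commutator

variable {R : Type*} [Ring R] [Algebra k R]

theorem gcomm_symm (p q : ZMod 2) (x y : R) :
    x * y - ksign k (p * q) • (y * x) =
      -(ksign k (p * q) • (y * x - ksign k (q * p) • (x * y))) := by
  rcases zmod2_cases p with rfl | rfl <;> rcases zmod2_cases q with rfl | rfl <;>
    simp [ksign_zero, ksign_one, add_comm]

theorem gcomm_jacobi (p q r : ZMod 2) (x y z : R) :
    x * (y * z - ksign k (q * r) • (z * y))
        - ksign k (p * (q + r)) • ((y * z - ksign k (q * r) • (z * y)) * x) =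
      (x * y - ksign k (p * q) • (y * x)) * z
        - ksign k ((p + q) * r) • (z * (x * y - ksign k (p * q) • (y * x)))
      + ksign k (p * q) • (y * (x * z - ksign k (p * r) • (z * x))
        - ksign k (q * (p + r)) • ((x * z - ksign k (p * r) • (z * x)) * y)) := by
  rcases zmod2_cases p with rfl | rfl <;> rcases zmod2_cases q with rfl | rfl <;>
    rcases zmod2_cases r with rfl | rfl <;>
    simp only [ksign_zero, ksign_one, zmod2_one_add_one, mul_zero, mul_one, add_zero,
      zero_add, one_smul, neg_smul] <;> noncomm_ring

theorem gcomm_sq (p : ZMod 2) (d x : R) (h : d * d = 0) :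
    d * (d * x - ksign k (1 * p) • (x * d))
      - ksign k (1 * (1 + p)) • ((d * x - ksign k (1 * p) • (x * d)) * d) = 0 := by
  have h' : ∀ y, d * (d * y) = 0 := fun y => by rw [← mul_assoc, h, zero_mul]
  rcases zmod2_cases p with rfl | rfl <;>
    simp [ksign_zero, ksign_one, zmod2_one_add_one, mul_sub, sub_mul, mul_add, add_mul, mul_assoc,
      h, h']

end Commutator

theorem ksign_add (a b : ZMod 2) : ksign k (a + b) = ksign k a * ksign k b := by
  rcases zmod2_cases a with rfl | rfl <;> rcases zmod2_cases b with rfl | rfl <;>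
    simp [ksign, zmod2_one_add_one]

theorem parityA_apply {c : Γ} {a : A} (h : a ∈ 𝒜 c) :
    parityA 𝒜 g a = ksign k (g.par c) • a := by
  have h1 := DirectSum.decompose_of_mem 𝒜 h
  simp only [parityA, LinearMap.comp_apply, LinearEquiv.coe_coe,
    DirectSum.decomposeLinearEquiv_apply, h1]
  exact DirectSum.toModule_lof (M := fun i => 𝒜 i) k c ⟨a, h⟩

theorem parityT_one : parityT 𝒜 g 1 = 1 := by simp [parityT]

theorem parityT_mul (x y : TensorAlgebra k A) :
    parityT 𝒜 g (x * y) = parityT 𝒜 g x * parityT 𝒜 g y := by simp [parityT]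

theorem parityT_prod (l : List (Γ × A)) (h : ∀ q ∈ l, q.2 ∈ 𝒜 q.1) :
    parityT 𝒜 g (l.map fun q => TensorAlgebra.ι k q.2).prod =
      ksign k (g.par (l.map Prod.fst).sum) • (l.map fun q => TensorAlgebra.ι k q.2).prod := by
  induction l with
  | nil => simp [parityT_one, ksign]
  | cons q l ih =>
    have h1 : parityT 𝒜 g (TensorAlgebra.ι k q.2) =
        ksign k (g.par q.1) • TensorAlgebra.ι k q.2 := by
      simp [parityT, parityA_apply (h q (by simp))]
    rw [List.map_cons, List.prod_cons, parityT_mul, h1,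
      ih fun r hr => h r (List.mem_cons_of_mem _ hr), List.map_cons, List.sum_cons, map_add,
      ksign_add, smul_mul_smul_comm]

theorem parityT_apply {c : Γ} {x : TensorAlgebra k A} (h : x ∈ tdeg 𝒜 c) :
    parityT 𝒜 g x = ksign k (g.par c) • x := by
  induction h using Submodule.span_induction with
  | mem x hx => obtain ⟨l, h1, rfl, rfl⟩ := hx; exact parityT_prod l h1
  | zero => simp
  | add x y _ _ hx hy => rw [map_add, hx, hy, smul_add]
  | smul r x _ hx => rw [map_smul, hx, smul_comm]

set_option linter.unusedSectionVars false

variable (𝒜) in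
theorem tdeg_mul {b c : Γ} {x y : TensorAlgebra k A} (hx : x ∈ tdeg 𝒜 b) (hy : y ∈ tdeg 𝒜 c) :
    x * y ∈ tdeg 𝒜 (b + c) := by
  have h : tdeg 𝒜 b * tdeg 𝒜 c ≤ tdeg 𝒜 (b + c) := by
    rw [tdeg, tdeg, Submodule.span_mul_span]
    refine Submodule.span_mono ?_
    rintro _ ⟨_, ⟨l, hl, rfl, rfl⟩, _, ⟨m, hm, rfl, rfl⟩, rfl⟩
    refine ⟨l ++ m, fun q hq => ?_, by simp, by simp⟩
    rcases List.mem_append.1 hq with hq | hq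
    exacts [hl q hq, hm q hq]
  exact h (Submodule.mul_mem_mul hx hy)

variable (𝒜) in
theorem iSup_tdeg : (⨆ c, tdeg 𝒜 c) = ⊤ := by
  refine eq_top_iff.2 fun x _ => ?_
  induction x using TensorAlgebra.induction with
  | algebraMap r =>
    refine Submodule.mem_iSup_of_mem 0 ?_
    rw [Algebra.algebraMap_eq_smul_one]
    exact Submodule.smul_mem _ _ (Submodule.subset_span ⟨[], by simp, by simp, by simp⟩)
  | ι a =>
    classical
    rw [← DirectSum.sum_support_decompose 𝒜 a, map_sum]
    refine Submodule.sum_mem _ fun c _ => Submodule.mem_iSup_of_mem c ?_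
    exact Submodule.subset_span ⟨[(c, DirectSum.decompose 𝒜 a c)], by simp, by simp, by simp⟩
  | mul x y hx hy =>
    have h : (⨆ c, tdeg 𝒜 c) * (⨆ c, tdeg 𝒜 c) ≤ ⨆ c, tdeg 𝒜 c := by
      rw [Submodule.iSup_mul]
      refine iSup_le fun b => ?_
      rw [Submodule.mul_iSup]
      refine iSup_le fun c => (Submodule.mul_le.2 fun u hu v hv => ?_)
      exact Submodule.mem_iSup_of_mem (b + c) (tdeg_mul 𝒜 hu hv)
    exact h (Submodule.mul_mem_mul (hx trivial) (hy trivial))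
  | add x y hx hy => exact Submodule.add_mem _ (hx trivial) (hy trivial)

variable (𝒜) in
theorem ext_tdeg {M : Type*} [AddCommGroup M] [Module k M] {f f' : TensorAlgebra k A →ₗ[k] M}
    (h : ∀ c, ∀ x ∈ tdeg 𝒜 c, f x = f' x) : f = f' := by
  refine LinearMap.ext fun x => ?_
  have hx : x ∈ ⨆ c, tdeg 𝒜 c := by rw [iSup_tdeg]; trivial
  induction hx using Submodule.iSup_induction' with
  | mem c x hx => exact h c x hx
  | zero => simp
  | add x y _ _ hx hy => rw [map_add, map_add, hx, hy]

theorem parPow_apply {c : Γ} {x : TensorAlgebra k A} (h : x ∈ tdeg 𝒜 c) (p : ZMod 2) :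
    parPow 𝒜 g p x = ksign k (p * g.par c) • x := by
  rcases zmod2_cases p with rfl | rfl
  · simp [parPow, ksign]
  · simp [parPow, parityT_apply h]

theorem parPow_comp {c : Γ} {f : Module.End k (TensorAlgebra k A)} (h : IsHomog 𝒜 𝒜 c f)
    (p : ZMod 2) : parPow 𝒜 g p ∘ₗ f = ksign k (p * g.par c) • (f ∘ₗ parPow 𝒜 g p) := by
  refine ext_tdeg 𝒜 fun b x hx => ?_
  simp only [LinearMap.comp_apply, LinearMap.smul_apply]
  rw [parPow_apply (h b x hx), parPow_apply hx, map_smul, map_add, mul_add, ksign_add, mul_smul]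

variable (𝒜 g) in
theorem parPow_parPow (p q : ZMod 2) :
    parPow 𝒜 g p ∘ₗ parPow 𝒜 g q = parPow 𝒜 g (p + q) := by
  refine ext_tdeg 𝒜 fun b x hx => ?_
  rw [LinearMap.comp_apply, parPow_apply hx, map_smul, parPow_apply hx, parPow_apply hx, smul_smul,
    add_mul, ksign_add, mul_comm]

theorem isHomog_comp {a b : Γ} {f f' : Module.End k (TensorAlgebra k A)} (h : IsHomog 𝒜 𝒜 a f)
    (h' : IsHomog 𝒜 𝒜 b f') : IsHomog 𝒜 𝒜 (a + b) (f ∘ₗ f') := fun c x hx => by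
  rw [add_assoc]; exact h _ _ (h' _ _ hx)

theorem deconc_comp {a b : Γ} {f f' : Module.End k (TensorAlgebra k A)} (h : f ∈ Coder 𝒜 g a)
    (h' : f' ∈ Coder 𝒜 g b) : deconc k A ∘ₗ (f ∘ₗ f') =
      (TensorProduct.map (f ∘ₗ f') LinearMap.id
        + TensorProduct.map (f ∘ₗ parPow 𝒜 g (g.par b)) f'
        + ksign k (g.par a * g.par b) • TensorProduct.map (f' ∘ₗ parPow 𝒜 g (g.par a)) f
        + TensorProduct.map (parPow 𝒜 g (g.par (a + b))) (f ∘ₗ f')) ∘ₗ deconc k A := by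
  rw [← LinearMap.comp_assoc, h.2, LinearMap.comp_assoc, h'.2, ← LinearMap.comp_assoc]
  congr 1
  rw [LinearMap.add_comp, LinearMap.comp_add, LinearMap.comp_add]
  simp only [← TensorProduct.map_comp, LinearMap.id_comp, LinearMap.comp_id]
  rw [parPow_comp h'.1, parPow_parPow, map_add, TensorProduct.map_smul_left]
  abel

/-- The graded commutator `[x, y] = x y - (-1)^{|x| |y|} y x` of coderivations. -/
theorem commutator_mem {a b : Γ} {f f' : Module.End k (TensorAlgebra k A)}
    (h : f ∈ Coder 𝒜 g a) (h' : f' ∈ Coder 𝒜 g b) :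
    f ∘ₗ f' - ksign k (g.par a * g.par b) • (f' ∘ₗ f) ∈ Coder 𝒜 g (a + b) := by
  have hs : ∀ p : ZMod 2, ksign k p * ksign k p = 1 := fun p => by
    rcases zmod2_cases p with rfl | rfl <;> simp [ksign]
  constructor
  · intro c x hx
    refine Submodule.sub_mem _ (isHomog_comp h.1 h'.1 c x hx) (Submodule.smul_mem _ _ ?_)
    rw [add_comm a b]
    exact isHomog_comp h'.1 h.1 c x hx
  · rw [LinearMap.comp_sub, LinearMap.comp_smul, deconc_comp h h', deconc_comp h' h,
      ← LinearMap.smul_comp, ← LinearMap.sub_comp]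
    congr 1
    have h1 : ∀ (s : k) (u v : Module.End k (TensorAlgebra k A)),
        u - s • v = u + (-s) • v := fun s u v => by
      refine LinearMap.ext fun x => ?_
      rw [LinearMap.sub_apply, LinearMap.add_apply, LinearMap.smul_apply, LinearMap.smul_apply]
      exact (sub_eq_add_neg _ _).trans (congrArg _ (neg_smul s (v x)).symm)
    rw [h1, TensorProduct.map_add_left, TensorProduct.map_add_right, TensorProduct.map_smul_left,
      TensorProduct.map_smul_right, mul_comm (g.par b), add_comm b a]
    have h2 : ∀ (s : k) (u : Module.End k (TensorAlgebra k A ⊗[k] TensorAlgebra k A)),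
        (-s) • u = -(s • u) := fun s u => LinearMap.ext fun x => neg_smul s (u x)
    simp only [smul_add, smul_smul, hs, one_smul, h2]
    abel

/-! ### `A∞`-algebras and their coderivations

Here `A` carries the suspended degrees, so that all products `r_n : A^{⊗ n} → A` have degree
`e`. -/

variable (𝒜 g) in
/-- A (non-curved) `A∞`-algebra structure on the graded vector space `A`: a coderivation `∂` of
`T_A` of degree `e` with `∂² = 0` and `r₀ = 0`. -/
structure AInftyAlgebra where
  diff : Module.End k (TensorAlgebra k A)
  diff_mem : diff ∈ Coder 𝒜 g g.e
  diff_diff : diff ∘ₗ diff = 0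
  diff_one : diff 1 = 0

/-- The graded Lie bracket `[f, f'] = f f' - (-1)^{|f| |f'|} f' f` on coderivations. -/
def coderBracket (a b : Γ) : Coder 𝒜 g a →ₗ[k] Coder 𝒜 g b →ₗ[k] Coder 𝒜 g (a + b) :=
  LinearMap.mk₂ k (fun f f' => ⟨f.1 ∘ₗ f'.1 - ksign k (g.par a * g.par b) • (f'.1 ∘ₗ f.1),
      commutator_mem f.2 f'.2⟩)
    (fun f₁ f₂ f' => Subtype.ext <| by
      simp only [Submodule.coe_add, LinearMap.add_comp, LinearMap.comp_add, smul_add]; abel)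
    (fun c f f' => Subtype.ext <| by
      simp only [Submodule.coe_smul, LinearMap.smul_comp, LinearMap.comp_smul, smul_sub,
        smul_comm c])
    (fun f f₁ f₂ => Subtype.ext <| by
      simp only [Submodule.coe_add, LinearMap.add_comp, LinearMap.comp_add, smul_add]; abel)
    (fun c f f' => Subtype.ext <| by
      simp only [Submodule.coe_smul, LinearMap.smul_comp, LinearMap.comp_smul, smul_sub,
        smul_comm c])

theorem coderBracket_coe {a b : Γ} (f : Coder 𝒜 g a) (f' : Coder 𝒜 g b) :
    (coderBracket a b f f' : Module.End k (TensorAlgebra k A)) =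
      f.1 * f'.1 - ksign k (g.par a * g.par b) • (f'.1 * f.1) := rfl

/-- The DG Lie algebra `(Coder(T_A), [∂, ·], [·, ·])`. -/
def AInftyAlgebra.coder (X : AInftyAlgebra 𝒜 g) :
    DGLie k g (Module.End k (TensorAlgebra k A)) where
  gr := Coder 𝒜 g
  d a := coderBracket g.e a ⟨X.diff, X.diff_mem⟩
  br := coderBracket
  d_d a x := Subtype.ext <| by
    have h := gcomm_sq (k := k) (g.par a) X.diff x.1 X.diff_diff
    simp only [coderBracket_coe, map_add, g.par_e]
    exact h
  br_symm a b x y := gcomm_symm (k := k) (g.par a) (g.par b) x.1 y.1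
  jacobi a b c x y z := by
    have h := gcomm_jacobi (k := k) (g.par a) (g.par b) (g.par c) x.1 y.1 z.1
    simp only [coderBracket_coe, map_add]
    exact h
  leibniz a b x y := by
    have h := gcomm_jacobi (k := k) (g.par g.e) (g.par a) (g.par b) X.diff x.1 y.1
    simp only [coderBracket_coe, map_add]
    simp only [g.par_e, one_mul] at h ⊢
    exact h

/-- The component `π_A f|_B : B → A` of a map `f : T_B → T_A`. For `∂` it is `r₁`. -/
def lin₁ (f : TensorAlgebra k B →ₗ[k] TensorAlgebra k A) : B →ₗ[k] A :=
  TensorAlgebra.ιInv ∘ₗ f ∘ₗ TensorAlgebra.ι k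

/-- The map `T_B → A` with components `f_n = π_A f|_{B^{⊗ n}}` for `n ≠ 1` and with component `0`
for `n = 1`. -/
def higher (f : TensorAlgebra k B →ₗ[k] TensorAlgebra k A) : TensorAlgebra k B →ₗ[k] A :=
  TensorAlgebra.ιInv ∘ₗ f - lin₁ f ∘ₗ TensorAlgebra.ιInv

/-- Minimality: `r₁ = 0`. -/
def AInftyAlgebra.IsMinimal (X : AInftyAlgebra 𝒜 g) : Prop := lin₁ X.diff = 0

/-- A morphism of graded coalgebras `T_B → T_A` of degree `0` with `F₀ = 0`. -/
structure IsCoalgMorphism (𝒜 : Γ → Submodule k A) (ℬ : Γ → Submodule k B)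
    (F : TensorAlgebra k B →ₗ[k] TensorAlgebra k A) : Prop where
  homog : IsHomog ℬ 𝒜 0 F
  map_one : F 1 = 1
  comul : deconc k A ∘ₗ F = TensorProduct.map F F ∘ₗ deconc k B

/-- An `A∞`-morphism `(B, ∂') → (A, ∂)`. -/
structure IsAInftyMorphism (Y : AInftyAlgebra ℬ g) (X : AInftyAlgebra 𝒜 g)
    (F : TensorAlgebra k B →ₗ[k] TensorAlgebra k A) : Prop
    extends IsCoalgMorphism 𝒜 ℬ F where
  comm : F ∘ₗ Y.diff = X.diff ∘ₗ F

/-- An `A∞`-quasi-isomorphism: `F₁` is injective and surjective on the cohomology of `r₁`. -/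
structure IsAInftyQuasiIso (Y : AInftyAlgebra ℬ g) (X : AInftyAlgebra 𝒜 g)
    (F : TensorAlgebra k B →ₗ[k] TensorAlgebra k A) : Prop
    extends IsAInftyMorphism Y X F where
  inj : ∀ b, lin₁ Y.diff b = 0 → (∃ a, lin₁ F b = lin₁ X.diff a) → ∃ b', b = lin₁ Y.diff b'
  surj : ∀ a, lin₁ X.diff a = 0 → ∃ b, lin₁ Y.diff b = 0 ∧ ∃ a', a - lin₁ F b = lin₁ X.diff a'

/-! ### The deformation retraction -/

/-- A propagator `G : A → A` of degree `-e` with its projection `π : A → H`. These are the same as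
a decomposition `A = F₁(H) ⊕ Im r₁ ⊕ L` into graded subspaces: `π` is the projection to `H`, and
`G` is inverse to `r₁ : L → Im r₁` and vanishes on `F₁(H) ⊕ L`. -/
structure IsPropagator (𝒜 : Γ → Submodule k A) (ℬ : Γ → Submodule k B) (g : SignGrading Γ)
    (r₁ : A →ₗ[k] A) (F₁ : B →ₗ[k] A) (π : A →ₗ[k] B) (G : A →ₗ[k] A) : Prop where
  homog_π : ∀ c, ∀ a ∈ 𝒜 c, π a ∈ ℬ c
  homog_G : ∀ c, ∀ a ∈ 𝒜 c, G a ∈ 𝒜 (-g.e + c)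
  π_F : π ∘ₗ F₁ = LinearMap.id
  homotopy : LinearMap.id - F₁ ∘ₗ π = r₁ ∘ₗ G + G ∘ₗ r₁
  G_G : G ∘ₗ G = 0
  G_F : G ∘ₗ F₁ = 0
  π_G : π ∘ₗ G = 0

/-- The maps `F̄ : T_A → T_H` and `U : T_A → T_A` that are defined recursively from `F`, `∂`, `π`
and `G`. Here `F̄` is a morphism of coalgebras with `F̄₀ = 0`, and `U` satisfies `U₀ = 0` and
`Δ U = (U ⊗ F F̄ + 1 ⊗ U) Δ`, so both are determined by their components `F̄ₙ : A^{⊗ n} → H` and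
`Uₙ : A^{⊗ n} → A`. These are `F̄₁ = π`, `U₁ = G` and, for `n ≥ 2`,
`Uₙ = - G (∑_{m=2}^n rₘ U|_{A^{⊗ n} → A^{⊗ m}} + ∑_{m=2}^n Fₘ F̄|_{A^{⊗ n} → H^{⊗ m}})`,
and the same with `π` in place of `G` for `F̄ₙ`. -/
structure IsRecursiveRetraction (X : AInftyAlgebra 𝒜 g)
    (F : TensorAlgebra k B →ₗ[k] TensorAlgebra k A) (π : A →ₗ[k] B) (G : A →ₗ[k] A)
    (F' : TensorAlgebra k A →ₗ[k] TensorAlgebra k B) (U : Module.End k (TensorAlgebra k A)) :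
    Prop where
  F'_one : F' 1 = 1
  F'_comul : deconc k B ∘ₗ F' = TensorProduct.map F' F' ∘ₗ deconc k A
  U_one : U 1 = 0
  U_comul : deconc k A ∘ₗ U =
    (TensorProduct.map U (F ∘ₗ F') + TensorProduct.map (parPow 𝒜 g 1) U) ∘ₗ deconc k A
  F'_rec : TensorAlgebra.ιInv ∘ₗ F' =
    π ∘ₗ (TensorAlgebra.ιInv - higher X.diff ∘ₗ U - higher F ∘ₗ F')
  U_rec : TensorAlgebra.ιInv ∘ₗ U =
    G ∘ₗ (TensorAlgebra.ιInv - higher X.diff ∘ₗ U - higher F ∘ₗ F')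

/-- A deformation retraction between `(T_H, ∂̃)` and `(T_A, ∂)`: `F` and `F̄` are morphisms of
complexes, `F̄ F = 1` and `1 - F F̄ = ∂ U + U ∂`. -/
structure IsDeformationRetraction (Y : AInftyAlgebra ℬ g) (X : AInftyAlgebra 𝒜 g)
    (F : TensorAlgebra k B →ₗ[k] TensorAlgebra k A)
    (F' : TensorAlgebra k A →ₗ[k] TensorAlgebra k B) (U : Module.End k (TensorAlgebra k A)) :
    Prop where
  F_homog : IsHomog ℬ 𝒜 0 F
  F_comm : F ∘ₗ Y.diff = X.diff ∘ₗ F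
  F'_homog : IsHomog 𝒜 ℬ 0 F'
  F'_comm : F' ∘ₗ X.diff = Y.diff ∘ₗ F'
  U_homog : IsHomog 𝒜 𝒜 (-g.e) U
  retract : F' ∘ₗ F = LinearMap.id
  homotopy : LinearMap.id - F ∘ₗ F' = X.diff ∘ₗ U + U ∘ₗ X.diff

/-- The map `F̄ f₀ U f₁ U ⋯ U fₙ F`. -/
def transferWord (F : TensorAlgebra k B →ₗ[k] TensorAlgebra k A)
    (F' : TensorAlgebra k A →ₗ[k] TensorAlgebra k B) (U : Module.End k (TensorAlgebra k A))
    {n : ℕ} (f : Fin (n + 1) → Module.End k (TensorAlgebra k A)) :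
    Module.End k (TensorAlgebra k B) :=
  F' ∘ₗ ((List.ofFn fun i : Fin n => f i.castSucc * U).prod * f (Fin.last n)) ∘ₗ F

end Coalgebra

end AInf

end

open AInf

/-! Write `F'` for the map F̄ and `Φ = F F'`. The tensor coalgebra is cofree: a coalgebra morphism
into it that preserves the unit, or a coderivation along two such morphisms, is determined by its
projection to the generators, and these projections can be prescribed (`exists_comul`,
`exists_coder`). Uniqueness is used in the form of `apply_word_eq_ι`: a coderivation that vanishes
on all words shorter than `w` has a primitive value on `w`, and primitive elements lie in `A`
(`eq_ι_of_primitive`). Identities between such maps are therefore proved by induction on word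
length, comparing linear components only.

The two recursions share a single unknown, the map `z = ιInv - higher ∂ ∘ U - higher F ∘ F'`
(`recSource`), and `F'`, `U` have components `π z`, `G z`. Since `higher` vanishes on primitive
elements, `z` on words of length `n` depends only on shorter words, so `z` is the fixed point of a
contraction. The same device proves the retraction identities. The pairs of defects `F' F - 1`, `U
F`; then `F' ∂ - ∂̃ F'`, `1 - Φ - ∂ U - U ∂`; then `F' U`, `U U` are coderivations up to corrections
that the induction controls, and their linear parts vanish by the identities for `π` and `G`. The
propagator itself is linear algebra: a homogeneous generalised inverse of `r₁`, suitably projected.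

The side conditions `U F = 0`, `F' U = 0`, `U U = 0` make each word `F' x₀ U x₁ ⋯ U xₙ F` a
coderivation even before symmetrisation. The comultiplication of its tail `U x₁ ⋯ U xₙ F` is that of
a coderivation along `F`, up to a term in `Im U ⊗ Im U` (`IsTail`), and this term dies under `F' ⊗
F'`.

The `L∞`-relation follows formally from `1 - Φ = d U + U d` in an associative algebra. When `d`
moves through an alternating word it meets each letter, giving a commutator, and each `U`, giving `1
- Φ`; the `1` merges two neighbouring letters and `Φ` cuts the word in two
(`homotopyWord_differential`). Summed over all orders with Koszul signs, merged letters form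
brackets of the arguments and cut words form brackets of the components (`symWord_relation`).

For Maurer–Cartan series the relation is not needed: `D = ∑ (-1)^n (δ U)^n δ` satisfies `D = δ - δ U
D`, its curvature `K = d D + D d + D Φ D` satisfies `K = -δ U K`, and since `δ` has no constant
term, `K = 0` order by order. -/

noncomputable section

namespace AInf

/-! ### Words and the tensor coalgebra -/

section Words

variable {k : Type*} [Field k] {A : Type*} [AddCommGroup A] [Module k A]
  {B : Type*} [AddCommGroup B] [Module k B] {M : Type*} [AddCommGroup M] [Module k M]

variable (k) in
/-- The element `a₁ ⋯ aₙ` of `T_A`. -/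
def word (l : List A) : TensorAlgebra k A := (l.map (TensorAlgebra.ι k)).prod

@[simp] theorem word_nil : word k ([] : List A) = 1 := rfl

@[simp] theorem word_cons (a : A) (l : List A) :
    word k (a :: l) = TensorAlgebra.ι k a * word k l := by simp [word]

theorem word_singleton (a : A) : word k [a] = TensorAlgebra.ι k a := by simp

theorem deconc_word (l : List A) : deconc k A (word k l) =
    ∑ j ∈ Finset.range (l.length + 1), word k (l.take j) ⊗ₜ word k (l.drop j) :=
  deconc_prod l

theorem span_range_word :
    Submodule.span k (Set.range (word k : List A → TensorAlgebra k A)) = ⊤ := by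
  refine eq_top_iff.2 fun x _ => ?_
  induction x using TensorAlgebra.induction with
  | algebraMap r =>
    rw [Algebra.algebraMap_eq_smul_one]
    exact Submodule.smul_mem _ _ (Submodule.subset_span ⟨[], rfl⟩)
  | ι a => exact Submodule.subset_span ⟨[a], word_singleton a⟩
  | mul x y hx hy =>
    have h := Submodule.mul_mem_mul (hx trivial) (hy trivial)
    rw [Submodule.span_mul_span] at h
    refine Submodule.span_mono ?_ h
    rintro _ ⟨_, ⟨l, rfl⟩, _, ⟨m, rfl⟩, rfl⟩
    exact ⟨l ++ m, by simp [word]⟩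
  | add x y hx hy => exact Submodule.add_mem _ (hx trivial) (hy trivial)

theorem ext_word {f f' : TensorAlgebra k A →ₗ[k] M} (h : ∀ l, f (word k l) = f' (word k l)) :
    f = f' :=
  LinearMap.ext_on_range span_range_word h

/-- The counit of `T_A`. -/
abbrev counit : TensorAlgebra k A →ₐ[k] k := TensorAlgebra.algebraMapInv

@[simp] theorem counit_ι (a : A) : counit (TensorAlgebra.ι k a) = 0 := by
  simp [counit, TensorAlgebra.algebraMapInv]

theorem counit_word (l : List A) : counit (word k l) = if l = [] then 1 else 0 := by
  cases l <;> simp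

@[simp] theorem ιInv_ι (a : A) : TensorAlgebra.ιInv (TensorAlgebra.ι k a) = a :=
  TensorAlgebra.ι_leftInverse a

/-- The map `ιInv` is the nilpotent component of an algebra map to the trivial square-zero
extension, whose scalar component is the counit. Hence it is a derivation over the counit, and it
kills words with at least two letters. -/
theorem ιInv_mul (x y : TensorAlgebra k A) : TensorAlgebra.ιInv (x * y) =
    counit x • TensorAlgebra.ιInv y + counit y • TensorAlgebra.ιInv x := by
  let : Module kᵐᵒᵖ A := Module.compHom _ ((RingHom.id k).fromOpposite mul_comm)
  have : IsCentralScalar k A := ⟨fun r m => rfl⟩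
  have h : (TrivSqZeroExt.fstHom k k A).comp TensorAlgebra.toTrivSqZeroExt = counit := by
    ext a
    simp
  have h' : ∀ x, (TensorAlgebra.toTrivSqZeroExt x : TrivSqZeroExt k A).fst = counit x :=
    fun x => DFunLike.congr_fun h x
  have h2 : ∀ x : TensorAlgebra k A, TensorAlgebra.ιInv x =
    (TensorAlgebra.toTrivSqZeroExt x : TrivSqZeroExt k A).snd := fun x => rfl
  rw [h2, h2, h2, map_mul, TrivSqZeroExt.snd_mul, h', h', op_smul_eq_smul]

@[simp] theorem ιInv_one : TensorAlgebra.ιInv (1 : TensorAlgebra k A) = 0 := by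
  have h := ιInv_mul (1 : TensorAlgebra k A) 1
  simpa using h

theorem ιInv_word_cons_cons (a b : A) (l : List A) :
    TensorAlgebra.ιInv (word k (a :: b :: l)) = 0 := by
  simp [ιInv_mul]

theorem counit_rTensor_deconc :
    (TensorProduct.lid k _).toLinearMap ∘ₗ counit.toLinearMap.rTensor _ ∘ₗ deconc k A =
      LinearMap.id := by
  refine ext_word fun l => ?_
  simp only [LinearMap.comp_apply, deconc_word, map_sum, LinearMap.rTensor_tmul]
  rw [Finset.sum_range_succ']
  rw [Finset.sum_eq_zero]
  · simp
  · intro i hi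
    cases l with
    | nil => simp at hi
    | cons a l => simp

/-- Both iterated comultiplications obey the same recursion when a letter is put in front of a word;
`h1` and `h2` are this recursion for the two sides. -/
theorem deconc_coassoc :
    (TensorProduct.assoc k _ _ _).toLinearMap ∘ₗ (deconc k A).rTensor _ ∘ₗ deconc k A =
      (deconc k A).lTensor _ ∘ₗ deconc k A := by
  refine ext_word fun l => ?_
  induction l with
  | nil => simp [deconc_one]
  | cons a l ih =>
    simp only [LinearMap.comp_apply, word_cons, deconc_ι_mul, map_add, LinearMap.rTensor_tmul,
      LinearMap.lTensor_tmul, deconc_one, LinearEquiv.coe_coe, TensorProduct.assoc_tmul] at ih ⊢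
    have h1 : (deconc k A).lTensor (TensorAlgebra k A) ∘ₗ
        (LinearMap.mulLeft k (TensorAlgebra.ι k a)).rTensor _ =
        (LinearMap.mulLeft k (TensorAlgebra.ι k a)).rTensor _ ∘ₗ (deconc k A).lTensor _ := by
      ext; simp
    have h2 : (TensorProduct.assoc k _ _ _).toLinearMap ∘ₗ
        (deconc k A).rTensor _ ∘ₗ (LinearMap.mulLeft k (TensorAlgebra.ι k a)).rTensor _ =
        (LinearMap.mulLeft k (TensorAlgebra.ι k a)).rTensor _ ∘ₗ
          (TensorProduct.assoc k _ _ _).toLinearMap ∘ₗ (deconc k A).rTensor _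
        + TensorProduct.mk k _ _ 1 ∘ₗ
          (LinearMap.mulLeft k (TensorAlgebra.ι k a)).rTensor (TensorAlgebra k A) := by
      have h3 : ∀ (u : TensorAlgebra k A ⊗[k] TensorAlgebra k A) (y : TensorAlgebra k A),
          TensorProduct.assoc k _ _ _
            ((LinearMap.mulLeft k (TensorAlgebra.ι k a)).rTensor _ u ⊗ₜ[k] y) =
          (LinearMap.mulLeft k (TensorAlgebra.ι k a)).rTensor _
            (TensorProduct.assoc k _ _ _ (u ⊗ₜ[k] y)) := by
        intro u y
        induction u with
        | zero => simp
        | tmul p q => simp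
        | add p q hp hq => simp only [map_add, TensorProduct.add_tmul, hp, hq]
      refine TensorProduct.ext' fun x y => ?_
      simp [deconc_ι_mul, TensorProduct.add_tmul, h3]
    have h1' := LinearMap.congr_fun h1 (deconc k A (word k l))
    have h2' := LinearMap.congr_fun h2 (deconc k A (word k l))
    simp only [LinearMap.comp_apply, LinearEquiv.coe_coe, LinearMap.add_apply] at h1' h2'
    rw [h1', h2', ih, TensorProduct.tmul_add]
    simp [add_assoc]

/-! #### Primitive elements -/

/-- The map `x ⊗ y ↦ ι (ιInv x) * y`. -/
def firstLetter : TensorAlgebra k A ⊗[k] TensorAlgebra k A →ₗ[k] TensorAlgebra k A :=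
  LinearMap.mul' k _ ∘ₗ (TensorAlgebra.ι k ∘ₗ TensorAlgebra.ιInv).rTensor _

@[simp] theorem firstLetter_tmul (x y : TensorAlgebra k A) :
    firstLetter (x ⊗ₜ[k] y) = TensorAlgebra.ι k (TensorAlgebra.ιInv x) * y := by
  simp [firstLetter]

/-- Only the cut after the first letter survives, since `ιInv` kills every prefix of another length.
Thus the coproduct and the counit of an element recover the element. -/
theorem firstLetter_deconc (x : TensorAlgebra k A) :
    x = counit x • 1 + firstLetter (deconc k A x) := by
  suffices h : LinearMap.id = LinearMap.toSpanSingleton k (TensorAlgebra k A) 1 ∘ₗ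
      counit.toLinearMap + firstLetter ∘ₗ deconc k A from LinearMap.congr_fun h x
  refine ext_word fun l => ?_
  simp only [LinearMap.add_apply, LinearMap.comp_apply, deconc_word, map_sum, firstLetter_tmul]
  cases l with
  | nil => simp
  | cons a l =>
    rw [List.length_cons, Finset.sum_range_succ', Finset.sum_range_succ', Finset.sum_eq_zero]
    · simp
    · intro i hi
      cases l with
      | nil => simp at hi
      | cons b l =>
        rw [List.take_succ_cons, List.take_succ_cons, ιInv_word_cons_cons]
        simp

/-- In the reconstruction formula the summand `1 ⊗ x` contributes nothing because `ιInv 1 = 0`. The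
counit of `x` vanishes because the counit axiom counts it twice. -/
theorem eq_ι_of_primitive {x : TensorAlgebra k A} (h : deconc k A x = x ⊗ₜ 1 + 1 ⊗ₜ x) :
    x = TensorAlgebra.ι k (TensorAlgebra.ιInv x) := by
  have h1 := firstLetter_deconc x
  have h2 : counit x = 0 := by
    have h3 := LinearMap.congr_fun counit_rTensor_deconc x
    have h4 := congrArg counit h3
    simp [h] at h4
    exact h4
  rw [h2, h] at h1
  simpa using h1

/-- If `f` is a coderivation up to a correction by `C ⊗ K`, and `f` and `K` vanish on the words
shorter than `l`, then `f` takes a primitive value on `l`. -/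
theorem apply_word_eq_ι {f Φ Ψ C K : TensorAlgebra k A →ₗ[k] TensorAlgebra k B}
    (hf : deconc k B ∘ₗ f = (TensorProduct.map f Φ + TensorProduct.map Ψ f
      + TensorProduct.map C K) ∘ₗ deconc k A)
    (hΦ : Φ 1 = 1) (hΨ : Ψ 1 = 1) (hC : C 1 = 0) {l : List A}
    (h : ∀ m : List A, m.length < l.length → f (word k m) = 0)
    (hK : ∀ m : List A, m.length < l.length → K (word k m) = 0) :
    f (word k l) = TensorAlgebra.ι k (TensorAlgebra.ιInv (f (word k l))) := by
  refine eq_ι_of_primitive ?_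
  have h1 := LinearMap.congr_fun hf (word k l)
  simp only [LinearMap.comp_apply, deconc_word, map_sum, LinearMap.add_apply,
    TensorProduct.map_tmul] at h1
  rw [h1, Finset.sum_add_distrib, Finset.sum_add_distrib]
  -- In each of the first two sums only the cut at one end survives, since every other cut evaluates
  -- `f` on a shorter word. In the third sum no cut survives: `C` kills the empty prefix, and after
  -- a nonempty prefix the suffix is short enough for `K` to vanish.
  have e1 : ∑ x ∈ Finset.range (l.length + 1), f (word k (l.take x)) ⊗ₜ[k] Φ (word k (l.drop x)) =
      f (word k l) ⊗ₜ 1 := by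
    rw [Finset.sum_range_succ, Finset.sum_eq_zero]
    · simp [hΦ]
    · intro i hi
      rw [h _ (by simpa using hi), TensorProduct.zero_tmul]
  have e2 : ∑ x ∈ Finset.range (l.length + 1), Ψ (word k (l.take x)) ⊗ₜ[k] f (word k (l.drop x)) =
      1 ⊗ₜ f (word k l) := by
    rw [Finset.sum_range_succ', Finset.sum_eq_zero]
    · simp [hΨ]
    · intro i hi
      rw [h _ (by simp at hi ⊢; omega), TensorProduct.tmul_zero]
  have e3 : ∑ x ∈ Finset.range (l.length + 1), C (word k (l.take x)) ⊗ₜ[k] K (word k (l.drop x)) =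
      0 := by
    rw [Finset.sum_range_succ', Finset.sum_eq_zero]
    · simp [hC]
    · intro i hi
      rw [hK _ (by simp at hi ⊢; omega), TensorProduct.tmul_zero]
  rw [e1, e2, e3, add_zero]

/-! #### The convolution product -/

section Conv

variable {R : Type*} [Ring R] [Algebra k R] {R' : Type*} [Ring R'] [Algebra k R']

/-- The convolution product of linear maps from `T_A` to an algebra. -/
def conv (f f' : TensorAlgebra k A →ₗ[k] R) : TensorAlgebra k A →ₗ[k] R :=
  LinearMap.mul' k R ∘ₗ TensorProduct.map f f' ∘ₗ deconc k A

theorem conv_word (f f' : TensorAlgebra k A →ₗ[k] R) (l : List A) :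
    conv f f' (word k l) =
      ∑ j ∈ Finset.range (l.length + 1), f (word k (l.take j)) * f' (word k (l.drop j)) := by
  simp [conv, deconc_word]

theorem conv_one (f f' : TensorAlgebra k A →ₗ[k] R) : conv f f' 1 = f 1 * f' 1 := by
  simp [conv, deconc_one]

theorem add_conv (f f₁ f₂ : TensorAlgebra k A →ₗ[k] R) :
    conv (f₁ + f₂) f = conv f₁ f + conv f₂ f := by
  simp [conv, TensorProduct.map_add_left, LinearMap.add_comp, LinearMap.comp_add]

theorem conv_assoc (f₁ f₂ f₃ : TensorAlgebra k A →ₗ[k] R) :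
    conv (conv f₁ f₂) f₃ = conv f₁ (conv f₂ f₃) := by
  refine LinearMap.ext fun x => ?_
  have h1 : ∀ u : TensorAlgebra k A ⊗[k] TensorAlgebra k A,
      LinearMap.mul' k R (TensorProduct.map (conv f₁ f₂) f₃ u) =
      LinearMap.mul' k R (TensorProduct.map f₁ (LinearMap.mul' k R ∘ₗ TensorProduct.map f₂ f₃)
        (TensorProduct.assoc k _ _ _ ((deconc k A).rTensor _ u))) := by
    intro u
    induction u with
    | zero => simp
    | add p q hp hq => simp only [map_add, hp, hq]
    | tmul p q =>
      simp only [TensorProduct.map_tmul, LinearMap.mul'_apply, conv, LinearMap.comp_apply,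
        LinearMap.rTensor_tmul]
      induction deconc k A p with
      | zero => simp
      | add p q hp hq => simp only [map_add, hp, hq, add_mul, TensorProduct.add_tmul]
      | tmul p q => simp [mul_assoc]
  have h2 : ∀ u : TensorAlgebra k A ⊗[k] TensorAlgebra k A,
      LinearMap.mul' k R (TensorProduct.map f₁ (conv f₂ f₃) u) =
      LinearMap.mul' k R (TensorProduct.map f₁ (LinearMap.mul' k R ∘ₗ TensorProduct.map f₂ f₃)
        ((deconc k A).lTensor _ u)) := by
    intro u
    induction u with
    | zero => simp
    | add p q hp hq => simp only [map_add, hp, hq]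
    | tmul p q => simp [conv]
  have h3 := LinearMap.congr_fun (deconc_coassoc (k := k) (A := A)) x
  rw [conv, conv.eq_def f₁ (conv f₂ f₃)]
  simp only [LinearMap.comp_apply, LinearEquiv.coe_coe] at h3 ⊢
  rw [h1, h2, h3]

theorem algHom_comp_conv (φ : R →ₐ[k] R') (f f' : TensorAlgebra k A →ₗ[k] R) :
    φ.toLinearMap ∘ₗ conv f f' = conv (φ.toLinearMap ∘ₗ f) (φ.toLinearMap ∘ₗ f') := by
  refine ext_word fun l => ?_
  simp [conv_word]

end Conv

/-- This turns comultiplication identities into identities for convolution with values in `T_B ⊗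
T_B`, where associativity of convolution does the bookkeeping. -/
theorem map_comp_deconc (f f' : TensorAlgebra k A →ₗ[k] TensorAlgebra k B) :
    TensorProduct.map f f' ∘ₗ deconc k A =
      conv (Algebra.TensorProduct.includeLeft.toLinearMap ∘ₗ f)
        (Algebra.TensorProduct.includeRight.toLinearMap ∘ₗ f') := by
  refine ext_word fun l => ?_
  simp [conv_word, deconc_word]

/-- A cut of `x a y` lies either to the left of the letter `a`, hence is a cut of `x`, or to its
right, hence is a cut of `y`. -/
theorem deconc_mul_ι_mul (x y : TensorAlgebra k A) (a : A) :
    deconc k A (x * TensorAlgebra.ι k a * y) =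
      deconc k A x * 1 ⊗ₜ (TensorAlgebra.ι k a * y) +
        (x * TensorAlgebra.ι k a) ⊗ₜ 1 * deconc k A y := by
  have hL : ∀ (b : A) (u : TensorAlgebra k A ⊗[k] TensorAlgebra k A),
      (LinearMap.mulLeft k (TensorAlgebra.ι k b)).rTensor _ u = TensorAlgebra.ι k b ⊗ₜ 1 * u := by
    intro b u
    induction u with
    | zero => simp
    | add p q hp hq => simp only [map_add, hp, hq, mul_add]
    | tmul p q => simp
  suffices h : deconc k A ∘ₗ LinearMap.mulRight k (TensorAlgebra.ι k a * y) =
      LinearMap.mulRight k (1 ⊗ₜ (TensorAlgebra.ι k a * y)) ∘ₗ deconc k A +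
      LinearMap.mulRight k (deconc k A y) ∘ₗ (TensorProduct.mk k _ _).flip 1 ∘ₗ
        LinearMap.mulRight k (TensorAlgebra.ι k a) by
    have := LinearMap.congr_fun h x
    simpa [mul_assoc] using this
  refine ext_word fun l => ?_
  induction l with
  | nil => simp [deconc_ι_mul, deconc_one, hL, add_comm]
  | cons b l ih =>
    simp only [LinearMap.comp_apply, LinearMap.mulRight_apply, LinearMap.add_apply, word_cons,
      LinearMap.flip_apply, TensorProduct.mk_apply, mul_assoc] at ih ⊢
    rw [deconc_ι_mul, ih, deconc_ι_mul, hL, hL]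
    simp only [mul_add, add_mul, ← mul_assoc, Algebra.TensorProduct.tmul_mul_tmul, mul_one]
    abel

end Words

/-! ### Cofreeness of the tensor coalgebra and the recursive construction -/

section Cofree

variable {k : Type*} [Field k] {A : Type*} [AddCommGroup A] [Module k A]
  {B : Type*} [AddCommGroup B] [Module k B] {M : Type*} [AddCommGroup M] [Module k M]

theorem word_mem_pow (l : List A) :
    word k l ∈ LinearMap.range (TensorAlgebra.ι k : A →ₗ[k] TensorAlgebra k A) ^ l.length := by
  induction l with
  | nil => simp [Submodule.one_le.1 le_rfl]
  | cons a l ih =>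
    rw [word_cons, List.length_cons, pow_succ']
    exact Submodule.mul_mem_mul ⟨a, rfl⟩ ih

/-- The maps given by `h n` on the words of length `n` are the values of one linear map. -/
theorem exists_linearMap_word (h : ℕ → TensorAlgebra k A →ₗ[k] M) :
    ∃ f : TensorAlgebra k A →ₗ[k] M, ∀ l, f (word k l) = h l.length (word k l) := by
  let 𝒯 : ℕ → Submodule k (TensorAlgebra k A) :=
    (LinearMap.range (TensorAlgebra.ι k : A →ₗ[k] TensorAlgebra k A) ^ ·)
  refine ⟨DirectSum.toModule k ℕ M (fun n => h n ∘ₗ (𝒯 n).subtype) ∘ₗ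
    (DirectSum.decomposeLinearEquiv 𝒯).toLinearMap, fun l => ?_⟩
  have h1 := DirectSum.decompose_of_mem 𝒯 (word_mem_pow (k := k) l)
  simp only [LinearMap.comp_apply, LinearEquiv.coe_coe, DirectSum.decomposeLinearEquiv_apply, h1]
  exact DirectSum.toModule_lof (M := fun i => 𝒯 i) k l.length ⟨word k l, word_mem_pow l⟩

/-- A map from `Hom(T_A, M)` to itself that improves agreement on short words has a fixed point. -/
theorem exists_fixedPoint (T : (TensorAlgebra k A →ₗ[k] M) → TensorAlgebra k A →ₗ[k] M)
    (hT : ∀ (n : ℕ) (f f' : TensorAlgebra k A →ₗ[k] M),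
      (∀ l : List A, l.length < n → f (word k l) = f' (word k l)) →
      ∀ l : List A, l.length ≤ n → T f (word k l) = T f' (word k l)) :
    ∃ f, T f = f := by
  -- After `n` iterations the values on words of length below `n` no longer change, so the limit can
  -- be taken length by length.
  have h1 : ∀ (n : ℕ) (l : List A), l.length < n →
      T^[n] 0 (word k l) = T^[n + 1] 0 (word k l) := by
    intro n
    induction n with
    | zero => intro l hl; omega
    | succ n ih =>
      intro l hl
      rw [Function.iterate_succ_apply', Function.iterate_succ_apply' _ (n + 1)]
      exact hT n _ _ ih l (by omega)
  have h2 : ∀ (l : List A) (n : ℕ), l.length < n →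
      T^[n] 0 (word k l) = T^[l.length + 1] 0 (word k l) := by
    intro l n hn
    induction n, hn using Nat.le_induction with
    | base => rfl
    | succ n hn ih => rw [← h1 n l hn, ih]
  obtain ⟨f, hf⟩ := exists_linearMap_word fun n => T^[n + 1] (0 : TensorAlgebra k A →ₗ[k] M)
  refine ⟨f, ext_word fun l => ?_⟩
  rw [hf, h1 _ _ (Nat.lt_succ_self _), Function.iterate_succ_apply']
  exact hT l.length _ _ (fun m hm => by rw [hf, h2 m (l.length + 1) (by omega)]) l le_rfl

/-- The uniqueness half of cofreeness: at the first length where `f` could be nonzero its values are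
primitive, and `ιInv` detects primitive elements. -/
theorem eq_of_ιInv_eq {f Φ Ψ : TensorAlgebra k A →ₗ[k] TensorAlgebra k B}
    (hf : deconc k B ∘ₗ f = (TensorProduct.map f Φ + TensorProduct.map Ψ f) ∘ₗ deconc k A)
    (hΦ : Φ 1 = 1) (hΨ : Ψ 1 = 1) (h : TensorAlgebra.ιInv ∘ₗ f = 0) : f = 0 := by
  refine ext_word fun l => ?_
  induction hn : l.length using Nat.strong_induction_on generalizing l with
  | _ n ih =>
    subst hn
    have := apply_word_eq_ι (C := 0) (K := 0) (l := l) (by simpa using hf) hΦ hΨ rfl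
      (fun m hm => ih _ hm m rfl) (fun m hm => rfl)
    rw [this]
    have h1 := LinearMap.congr_fun h (word k l)
    simp only [LinearMap.comp_apply] at h1
    simp [h1]

/-- The difference of two coalgebra morphisms is a coderivation along the pair, which brings it
within reach of the uniqueness principle for coderivations. -/
theorem comul_sub {Φ Φ' : TensorAlgebra k A →ₗ[k] TensorAlgebra k B}
    (h : deconc k B ∘ₗ Φ = TensorProduct.map Φ Φ ∘ₗ deconc k A)
    (h' : deconc k B ∘ₗ Φ' = TensorProduct.map Φ' Φ' ∘ₗ deconc k A) :
    deconc k B ∘ₗ (Φ - Φ') =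
      (TensorProduct.map (Φ - Φ') Φ + TensorProduct.map Φ' (Φ - Φ')) ∘ₗ deconc k A := by
  rw [LinearMap.comp_sub, h, h', ← LinearMap.sub_comp]
  congr 1
  refine TensorProduct.ext' fun x y => ?_
  simp [TensorProduct.sub_tmul, TensorProduct.tmul_sub]

theorem eq_of_comul {Φ Φ' : TensorAlgebra k A →ₗ[k] TensorAlgebra k B}
    (h : deconc k B ∘ₗ Φ = TensorProduct.map Φ Φ ∘ₗ deconc k A)
    (h' : deconc k B ∘ₗ Φ' = TensorProduct.map Φ' Φ' ∘ₗ deconc k A)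
    (h1 : Φ 1 = 1) (h1' : Φ' 1 = 1) (hι : TensorAlgebra.ιInv ∘ₗ Φ = TensorAlgebra.ιInv ∘ₗ Φ') :
    Φ = Φ' :=
  sub_eq_zero.1 <| eq_of_ιInv_eq (comul_sub h h') h1 h1' (by rw [LinearMap.comp_sub, hι, sub_self])

/-- On a nonempty word `w` the induction hypothesis removes all interior cuts from the counit axiom
for `Φ w`. The two extreme cuts give `Φ w = Φ w + counit (Φ w) • 1`. -/
theorem counit_comp_of_comul {Φ : TensorAlgebra k A →ₗ[k] TensorAlgebra k B}
    (h : deconc k B ∘ₗ Φ = TensorProduct.map Φ Φ ∘ₗ deconc k A) (h1 : Φ 1 = 1)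
    (x : TensorAlgebra k A) : counit (Φ x) = counit x := by
  suffices hs : counit.toLinearMap ∘ₗ Φ = counit.toLinearMap from LinearMap.congr_fun hs x
  refine ext_word fun l => ?_
  induction hn : l.length using Nat.strong_induction_on generalizing l with
  | _ n ih =>
    subst hn
    rcases eq_or_ne l [] with rfl | hl
    · simp [h1]
    have hl' : 0 < l.length := List.length_pos_of_ne_nil hl
    have h2 := LinearMap.congr_fun counit_rTensor_deconc (Φ (word k l))
    have h3 := LinearMap.congr_fun h (word k l)
    simp only [LinearMap.comp_apply, LinearMap.id_apply] at h2 h3 ih ⊢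
    rw [h3, deconc_word] at h2
    simp only [map_sum, TensorProduct.map_tmul, LinearMap.rTensor_tmul, LinearEquiv.coe_coe,
      TensorProduct.lid_tmul] at h2
    rw [Finset.sum_range_succ, Finset.sum_eq_single_of_mem 0 (by simpa using hl')] at h2
    · have h4 := congrArg counit h2
      simpa [h1, counit_word, hl] using h4
    · intro j hj hj'
      have h5 := ih (l.take j).length (by simpa using hj) (l.take j) rfl
      rw [h5]
      simp [counit_word, hj', hl]

/-- A morphism of coalgebras `T_A → T_B` with prescribed components. -/
theorem exists_comul (f : TensorAlgebra k A →ₗ[k] B) (hf : f 1 = 0) :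
    ∃ Φ : TensorAlgebra k A →ₗ[k] TensorAlgebra k B, Φ 1 = 1 ∧
      deconc k B ∘ₗ Φ = TensorProduct.map Φ Φ ∘ₗ deconc k A ∧ TensorAlgebra.ιInv ∘ₗ Φ = f := by
  -- The empty prefix contributes nothing because `f 1 = 0`, so convolution with `f` on the left
  -- evaluates `h` on strictly shorter words only. This is the contraction property.
  have hα : ∀ {R : Type _} [Ring R] [Algebra k R] (j : B →ₗ[k] R)
      (h h' : TensorAlgebra k A →ₗ[k] R) (n : ℕ),
      (∀ l : List A, l.length < n → h (word k l) = h' (word k l)) →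
      ∀ l : List A, l.length ≤ n →
        conv (j ∘ₗ f) h (word k l) = conv (j ∘ₗ f) h' (word k l) := by
    intro R _ _ j h h' n hh l hl
    rw [conv_word, conv_word]
    refine Finset.sum_congr rfl fun i hi => ?_
    cases i with
    | zero => simp [hf]
    | succ i => rw [hh _ (by simp at hi ⊢; omega)]
  -- The equation says that `Φ` is the sum over all ways of cutting a word into blocks and applying
  -- `f` to each block: the first block is split off and `Φ` is applied to the rest.
  obtain ⟨Φ, hΦ⟩ := exists_fixedPoint (fun Φ : TensorAlgebra k A →ₗ[k] TensorAlgebra k B =>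
      LinearMap.toSpanSingleton k (TensorAlgebra k B) 1 ∘ₗ counit.toLinearMap
        + conv (TensorAlgebra.ι k ∘ₗ f) Φ) (fun n h h' hh l hl => by
    rw [LinearMap.add_apply, LinearMap.add_apply, hα _ h h' n hh l hl])
  have h1 : Φ 1 = 1 := by
    rw [← hΦ]
    simp [conv_one, hf]
  refine ⟨Φ, h1, ?_, ?_⟩
  · -- both sides are fixed points of the same contraction
    let j₁ : TensorAlgebra k B →ₐ[k] TensorAlgebra k B ⊗[k] TensorAlgebra k B :=
      Algebra.TensorProduct.includeLeft
    let j₂ : TensorAlgebra k B →ₐ[k] TensorAlgebra k B ⊗[k] TensorAlgebra k B :=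
      Algebra.TensorProduct.includeRight
    have hfix : ∀ Q : TensorAlgebra k A →ₗ[k] TensorAlgebra k B ⊗[k] TensorAlgebra k B,
        Q = deconc k B ∘ₗ Φ ∨ Q = TensorProduct.map Φ Φ ∘ₗ deconc k A →
        Q = j₂.toLinearMap ∘ₗ Φ + conv (j₁.toLinearMap ∘ₗ TensorAlgebra.ι k ∘ₗ f) Q := by
      rintro Q (rfl | rfl)
      · refine ext_word fun l => ?_
        have h2 := LinearMap.congr_fun hΦ (word k l)
        simp only [LinearMap.comp_apply, LinearMap.add_apply, conv_word] at h2 ⊢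
        rw [← h2]
        simp only [map_add, map_sum]
        have h3 : ∀ b : B, ∀ y, deconc k B (TensorAlgebra.ι k b * y) =
            TensorAlgebra.ι k b ⊗ₜ 1 * deconc k B y + 1 ⊗ₜ (TensorAlgebra.ι k b * y) := by
          intro b y
          have := deconc_mul_ι_mul 1 y b
          simpa [deconc_one, add_comm] using this
        simp only [h3, Finset.sum_add_distrib]
        simp [deconc_one, j₁, j₂]
        abel
      · rw [map_comp_deconc]
        change conv (j₁.toLinearMap ∘ₗ Φ) _ = j₂.toLinearMap ∘ₗ Φ + conv _
          (conv (j₁.toLinearMap ∘ₗ Φ) (j₂.toLinearMap ∘ₗ Φ))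
        rw [← conv_assoc, ← algHom_comp_conv]
        conv_lhs => rw [← hΦ, LinearMap.comp_add, add_conv, hΦ]
        refine congrArg₂ (· + ·) ?_ rfl
        have h4 : j₁.toLinearMap ∘ₗ (LinearMap.toSpanSingleton k (TensorAlgebra k B) 1 ∘ₗ
            counit.toLinearMap) =
            LinearMap.toSpanSingleton k _ 1 ∘ₗ (counit (A := A)).toLinearMap := by
          ext
          simp
        rw [h4]
        refine ext_word fun l => ?_
        rw [conv_word, Finset.sum_range_succ', Finset.sum_eq_zero]
        · simp [j₂]
        · intro i hi
          cases l with
          | nil => simp at hi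
          | cons a l => simp
    have e1 := hfix _ (Or.inl rfl)
    have e2 := hfix _ (Or.inr rfl)
    refine ext_word fun l => ?_
    induction hn : l.length using Nat.strong_induction_on generalizing l with
    | _ n ih =>
      subst hn
      rw [e1, e2, LinearMap.add_apply, LinearMap.add_apply, ← LinearMap.comp_assoc,
        hα _ _ _ l.length (fun m hm => ih _ hm m rfl) l le_rfl]
  · refine ext_word fun l => ?_
    conv_lhs => rw [← hΦ]
    have h2 : counit.toLinearMap ∘ₗ Φ = counit.toLinearMap := by
      refine ext_word fun l => ?_
      conv_lhs => rw [← hΦ]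
      simp [conv_word]
    simp only [LinearMap.comp_apply, LinearMap.add_apply, conv_word, map_add, map_sum, ιInv_mul,
      ιInv_ι, counit_ι, zero_smul, zero_add]
    have h3 : ∀ x, counit (Φ x) = counit x := LinearMap.congr_fun h2
    rw [Finset.sum_range_succ, Finset.sum_eq_zero]
    · simp [h1]
    · intro i hi
      have hi' := Finset.mem_range.1 hi
      simp [h3, counit_word, hi']

/-- A coderivation along two morphisms of coalgebras `T_A → T_B` with prescribed components. -/
theorem exists_coder {Ψ Φ : TensorAlgebra k A →ₗ[k] TensorAlgebra k B}
    (hΨ : deconc k B ∘ₗ Ψ = TensorProduct.map Ψ Ψ ∘ₗ deconc k A)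
    (hΦ : deconc k B ∘ₗ Φ = TensorProduct.map Φ Φ ∘ₗ deconc k A)
    (hΨ1 : Ψ 1 = 1) (hΦ1 : Φ 1 = 1) (u : TensorAlgebra k A →ₗ[k] B) :
    ∃ U : TensorAlgebra k A →ₗ[k] TensorAlgebra k B, U 1 = TensorAlgebra.ι k (u 1) ∧
      deconc k B ∘ₗ U = (TensorProduct.map U Φ + TensorProduct.map Ψ U) ∘ₗ deconc k A ∧
      TensorAlgebra.ιInv ∘ₗ U = u := by
  let j₁ : TensorAlgebra k B →ₐ[k] TensorAlgebra k B ⊗[k] TensorAlgebra k B :=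
    Algebra.TensorProduct.includeLeft
  let j₂ : TensorAlgebra k B →ₐ[k] TensorAlgebra k B ⊗[k] TensorAlgebra k B :=
    Algebra.TensorProduct.includeRight
  -- The explicit solution marks one block of the word, applies `u` to it, `Ψ` to everything before
  -- it and `Φ` to everything after it.
  refine ⟨conv (conv Ψ (TensorAlgebra.ι k ∘ₗ u)) Φ, ?_, ?_, ?_⟩
  · simp [conv_one, hΨ1, hΦ1]
  · rw [LinearMap.add_comp, map_comp_deconc, map_comp_deconc]
    change _ = conv (j₁.toLinearMap ∘ₗ _) (j₂.toLinearMap ∘ₗ _) +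
      conv (j₁.toLinearMap ∘ₗ _) (j₂.toLinearMap ∘ₗ _)
    rw [map_comp_deconc] at hΨ hΦ
    change _ = conv (j₁.toLinearMap ∘ₗ _) (j₂.toLinearMap ∘ₗ _) at hΨ hΦ
    rw [conv_assoc Ψ]
    simp only [algHom_comp_conv]
    rw [← conv_assoc (j₁.toLinearMap ∘ₗ Ψ) (j₂.toLinearMap ∘ₗ Ψ), ← hΨ,
      conv_assoc (j₁.toLinearMap ∘ₗ Ψ), conv_assoc (j₁.toLinearMap ∘ₗ TensorAlgebra.ι k ∘ₗ u),
      ← hΦ]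
    -- A cut of the image falls to the left or to the right of the letter produced by `u`; the two
    -- cases are the two summands of the coderivation rule.
    have h1 : ∀ u' : TensorAlgebra k A →ₗ[k] B, ∀ l : List A,
        deconc k B (conv Ψ (conv (TensorAlgebra.ι k ∘ₗ u') Φ) (word k l)) =
        conv (deconc k B ∘ₗ Ψ) (conv (j₂.toLinearMap ∘ₗ TensorAlgebra.ι k ∘ₗ u')
          (j₂.toLinearMap ∘ₗ Φ)) (word k l) +
        conv (j₁.toLinearMap ∘ₗ Ψ) (conv (j₁.toLinearMap ∘ₗ TensorAlgebra.ι k ∘ₗ u')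
          (deconc k B ∘ₗ Φ)) (word k l) := by
      intro u' l
      simp only [conv_word, Finset.mul_sum, map_sum, ← Finset.sum_add_distrib]
      refine Finset.sum_congr rfl fun i _ => Finset.sum_congr rfl fun j _ => ?_
      rw [LinearMap.comp_apply, ← mul_assoc, deconc_mul_ι_mul]
      have e1 : ∀ p q : TensorAlgebra k B, (1 : TensorAlgebra k B) ⊗ₜ[k] (p * q) =
          1 ⊗ₜ[k] p * 1 ⊗ₜ[k] q := fun p q => by simp
      have e2 : ∀ p q : TensorAlgebra k B, (p * q) ⊗ₜ[k] (1 : TensorAlgebra k B) =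
          p ⊗ₜ[k] 1 * q ⊗ₜ[k] 1 := fun p q => by simp
      simp [j₁, j₂, mul_assoc, e1, e2, -Algebra.TensorProduct.tmul_mul_tmul]
    refine ext_word fun l => ?_
    rw [LinearMap.comp_apply, h1, LinearMap.add_apply, add_comm]
  · refine ext_word fun l => ?_
    rw [LinearMap.comp_apply, conv_word, Finset.sum_range_succ, map_add, map_sum,
      Finset.sum_eq_zero]
    · simp only [List.take_length, List.drop_length, word_nil, hΦ1, mul_one, zero_add]
      rw [conv_word, Finset.sum_range_succ', map_add, map_sum, Finset.sum_eq_zero]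
      · simp [hΨ1]
      · intro i hi
        have : l ≠ [] := by rintro rfl; simp at hi
        simp [ιInv_mul, counit_comp_of_comul hΨ hΨ1, counit_word, this]
    · intro i hi
      have hi' := Finset.mem_range.1 hi
      simp [ιInv_mul, counit_comp_of_comul hΦ hΦ1, counit_word, hi', conv_word]

end Cofree

/-! ### Well-foundedness of the recursion for the pair `(F', U)` -/

section Recursion

variable {k : Type*} [Field k] {A : Type*} [AddCommGroup A] [Module k A]
  {B : Type*} [AddCommGroup B] [Module k B]
  {F : TensorAlgebra k B →ₗ[k] TensorAlgebra k A} {P : Module.End k (TensorAlgebra k A)}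

theorem higher_ι (f : TensorAlgebra k B →ₗ[k] TensorAlgebra k A) (b : B) :
    higher f (TensorAlgebra.ι k b) = 0 := by
  simp [higher, lin₁]

theorem higher_one (f : TensorAlgebra k B →ₗ[k] TensorAlgebra k A)
    (h : TensorAlgebra.ιInv (f 1) = 0) : higher f 1 = 0 := by
  simp [higher, h]

theorem ιInv_comp_eq (f : TensorAlgebra k B →ₗ[k] TensorAlgebra k A) (x : TensorAlgebra k B) :
    TensorAlgebra.ιInv (f x) = lin₁ f (TensorAlgebra.ιInv x) + higher f x := by
  simp [higher]

/-- The map `ιInv - ∑_{m ≥ 2} (D_m U + F_m F̄)` of the recursion for `F̄` and `U`. -/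
def recSource (D : Module.End k (TensorAlgebra k A)) (F : TensorAlgebra k B →ₗ[k] TensorAlgebra k A)
    (F' : TensorAlgebra k A →ₗ[k] TensorAlgebra k B) (U : Module.End k (TensorAlgebra k A)) :
    TensorAlgebra k A →ₗ[k] A :=
  TensorAlgebra.ιInv - higher D ∘ₗ U - higher F ∘ₗ F'

/-- The equations `Δ F̄ = (F̄ ⊗ F̄) Δ`, `F̄ 1 = 1`, `Δ U = (U ⊗ F F̄ + P ⊗ U) Δ` and `U 1 = 0`. -/
structure IsCoalgPair (F : TensorAlgebra k B →ₗ[k] TensorAlgebra k A)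
    (P : Module.End k (TensorAlgebra k A)) (F' : TensorAlgebra k A →ₗ[k] TensorAlgebra k B)
    (U : Module.End k (TensorAlgebra k A)) : Prop where
  one₁ : F' 1 = 1
  comul₁ : deconc k B ∘ₗ F' = TensorProduct.map F' F' ∘ₗ deconc k A
  comul₂ : deconc k A ∘ₗ U =
    (TensorProduct.map U (F ∘ₗ F') + TensorProduct.map P U) ∘ₗ deconc k A

/-- Two pairs whose components agree on the words of length `< n` differ on the words of length
`≤ n` by primitive elements. -/
theorem IsCoalgPair.sub_eq_ι {F' F'' : TensorAlgebra k A →ₗ[k] TensorAlgebra k B}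
    {U U' : Module.End k (TensorAlgebra k A)} (h : IsCoalgPair F P F' U)
    (h' : IsCoalgPair F P F'' U') (hF : F 1 = 1) (hP : P 1 = 1) (hU' : U' 1 = 0) {n : ℕ}
    (h₁ : ∀ l : List A, l.length < n →
      TensorAlgebra.ιInv (F' (word k l)) = TensorAlgebra.ιInv (F'' (word k l)))
    (h₂ : ∀ l : List A, l.length < n →
      TensorAlgebra.ιInv (U (word k l)) = TensorAlgebra.ιInv (U' (word k l)))
    (l : List A) (hl : l.length ≤ n) :
    (F' - F'') (word k l) = TensorAlgebra.ι k (TensorAlgebra.ιInv ((F' - F'') (word k l))) ∧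
    (U - U') (word k l) = TensorAlgebra.ι k (TensorAlgebra.ιInv ((U - U') (word k l))) := by
  -- The rules for `U` and `U'` involve different morphisms `F F'` and `F F''`. Hence the difference
  -- `U - U'` is a coderivation only up to the correction `U' ⊗ F (F' - F'')`, which the
  -- simultaneous induction controls.
  have hs : deconc k A ∘ₗ (U - U') = (TensorProduct.map (U - U') (F ∘ₗ F')
      + TensorProduct.map P (U - U') + TensorProduct.map U' (F ∘ₗ (F' - F''))) ∘ₗ deconc k A := by
    rw [LinearMap.comp_sub, h.comul₂, h'.comul₂, ← LinearMap.sub_comp]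
    congr 1
    refine TensorProduct.ext' fun x y => ?_
    simp [TensorProduct.sub_tmul, TensorProduct.tmul_sub]
    abel
  have key : ∀ l : List A, (∀ m : List A, m.length < l.length →
      (F' - F'') (word k m) = 0 ∧ (U - U') (word k m) = 0) →
      (F' - F'') (word k l) = TensorAlgebra.ι k (TensorAlgebra.ιInv ((F' - F'') (word k l))) ∧
      (U - U') (word k l) = TensorAlgebra.ι k (TensorAlgebra.ιInv ((U - U') (word k l))) :=
    fun l hl => ⟨apply_word_eq_ι (C := 0) (K := 0) (by simpa using comul_sub h.comul₁ h'.comul₁)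
      h.one₁ h'.one₁ rfl (fun m hm => (hl m hm).1) (fun _ _ => rfl),
      apply_word_eq_ι hs (by simp [h.one₁, hF]) hP hU' (fun m hm => (hl m hm).2)
        (fun m hm => by rw [LinearMap.comp_apply, (hl m hm).1, map_zero])⟩
  have h0 : ∀ (i : ℕ) (m : List A), m.length = i → i < n →
      (F' - F'') (word k m) = 0 ∧ (U - U') (word k m) = 0 := by
    intro i
    induction i using Nat.strong_induction_on with
    | _ i ih =>
      rintro m rfl hm
      obtain ⟨e1, e2⟩ := key m fun m' hm' => ih _ hm' m' rfl (hm'.trans hm)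
      rw [e1, e2]
      simp [h₁ m hm, h₂ m hm]
  exact key l fun m hm => h0 _ m rfl (hm.trans_le hl)

/-- By `IsCoalgPair.sub_eq_ι` the two pairs differ by primitive elements up to length `n`, and
`higher` does not see these. So the source at length `n` is fixed by the components of smaller
length. -/
theorem IsCoalgPair.higher_eq {F' F'' : TensorAlgebra k A →ₗ[k] TensorAlgebra k B}
    {U U' : Module.End k (TensorAlgebra k A)} (h : IsCoalgPair F P F' U)
    (h' : IsCoalgPair F P F'' U') (hF : F 1 = 1) (hP : P 1 = 1) (hU' : U' 1 = 0) {n : ℕ}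
    (h₁ : ∀ l : List A, l.length < n →
      TensorAlgebra.ιInv (F' (word k l)) = TensorAlgebra.ιInv (F'' (word k l)))
    (h₂ : ∀ l : List A, l.length < n →
      TensorAlgebra.ιInv (U (word k l)) = TensorAlgebra.ιInv (U' (word k l)))
    (D : Module.End k (TensorAlgebra k A)) (l : List A) (hl : l.length ≤ n) :
    recSource D F F' U (word k l) = recSource D F F'' U' (word k l) := by
  obtain ⟨e1, e2⟩ := h.sub_eq_ι h' hF hP hU' h₁ h₂ l hl
  have e3 : higher F ((F' - F'') (word k l)) = 0 := by rw [e1, higher_ι]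
  have e4 : higher D ((U - U') (word k l)) = 0 := by rw [e2, higher_ι]
  rw [LinearMap.sub_apply, map_sub, sub_eq_zero] at e3 e4
  simp [recSource, e3, e4]

end Recursion

/-! ### Existence and uniqueness of the recursive retraction -/

section Retraction

variable {k : Type*} [Field k] {Γ : Type*} [AddCommGroup Γ] [DecidableEq Γ] {g : SignGrading Γ}
  {A : Type*} [AddCommGroup A] [Module k A] {𝒜 : Γ → Submodule k A} [DirectSum.Decomposition 𝒜]
  {B : Type*} [AddCommGroup B] [Module k B] {ℬ : Γ → Submodule k B}
  {X : AInftyAlgebra 𝒜 g} {F : TensorAlgebra k B →ₗ[k] TensorAlgebra k A}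
  {π : A →ₗ[k] B} {G : A →ₗ[k] A}

theorem parityT_comul :
    deconc k A ∘ₗ parityT 𝒜 g = TensorProduct.map (parityT 𝒜 g) (parityT 𝒜 g) ∘ₗ deconc k A := by
  refine ext_word fun l => ?_
  induction l with
  | nil => simp [deconc_one, parityT_one]
  | cons a l ih =>
    have h1 : parityT 𝒜 g (TensorAlgebra.ι k a) = TensorAlgebra.ι k (parityA 𝒜 g a) := by
      simp [parityT]
    have h2 : TensorProduct.map (parityT 𝒜 g) (parityT 𝒜 g) ∘ₗ
        (LinearMap.mulLeft k (TensorAlgebra.ι k a)).rTensor _ =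
        (LinearMap.mulLeft k (TensorAlgebra.ι k (parityA 𝒜 g a))).rTensor _ ∘ₗ
          TensorProduct.map (parityT 𝒜 g) (parityT 𝒜 g) := by
      refine TensorProduct.ext' fun x y => ?_
      simp [parityT_mul, h1]
    have h3 := LinearMap.congr_fun h2 (deconc k A (word k l))
    simp only [LinearMap.comp_apply, word_cons, deconc_ι_mul, parityT_mul, h1, map_add,
      TensorProduct.map_tmul, parityT_one] at ih h3 ⊢
    rw [h3, ih]

theorem parPow_one_eq : parPow 𝒜 g 1 = parityT 𝒜 g := by simp [parPow]

theorem parPow_map_one (p : ZMod 2) : parPow 𝒜 g p 1 = 1 := by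
  rcases zmod2_cases p with rfl | rfl <;> simp [parPow, parityT_one]

theorem IsRecursiveRetraction.isCoalgPair {F' : TensorAlgebra k A →ₗ[k] TensorAlgebra k B}
    {U : Module.End k (TensorAlgebra k A)} (h : IsRecursiveRetraction X F π G F' U) :
    IsCoalgPair F (parPow 𝒜 g 1) F' U :=
  ⟨h.F'_one, h.F'_comul, h.U_comul⟩

theorem IsRecursiveRetraction.ιInv_F' {F' : TensorAlgebra k A →ₗ[k] TensorAlgebra k B}
    {U : Module.End k (TensorAlgebra k A)} (h : IsRecursiveRetraction X F π G F' U)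
    (x : TensorAlgebra k A) : TensorAlgebra.ιInv (F' x) = π (recSource X.diff F F' U x) :=
  LinearMap.congr_fun h.F'_rec x

theorem IsRecursiveRetraction.ιInv_U {F' : TensorAlgebra k A →ₗ[k] TensorAlgebra k B}
    {U : Module.End k (TensorAlgebra k A)} (h : IsRecursiveRetraction X F π G F' U)
    (x : TensorAlgebra k A) : TensorAlgebra.ιInv (U x) = G (recSource X.diff F F' U x) :=
  LinearMap.congr_fun h.U_rec x

/-- The sources agree by induction on the length, since each determines the components from which
the next one is computed. Cofreeness then gives `F' = F''`, and only after that do `U` and `U'` obey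
the same coderivation rule. -/
theorem IsRecursiveRetraction.unique {F' F'' : TensorAlgebra k A →ₗ[k] TensorAlgebra k B}
    {U U' : Module.End k (TensorAlgebra k A)} (h : IsRecursiveRetraction X F π G F' U)
    (h' : IsRecursiveRetraction X F π G F'' U') (hF : F 1 = 1) : F' = F'' ∧ U = U' := by
  have key : ∀ n : ℕ, ∀ l : List A, l.length < n →
      recSource X.diff F F' U (word k l) = recSource X.diff F F'' U' (word k l) := by
    intro n
    induction n with
    | zero => intro l hl; omega
    | succ n ih =>
      intro l hl
      refine h.isCoalgPair.higher_eq h'.isCoalgPair hF (parPow_map_one 1) h'.U_one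
        (n := n) (fun m hm => ?_) (fun m hm => ?_) X.diff l (by omega)
      · rw [h.ιInv_F', h'.ιInv_F', ih m hm]
      · rw [h.ιInv_U, h'.ιInv_U, ih m hm]
  have hz : recSource X.diff F F' U = recSource X.diff F F'' U' :=
    ext_word fun l => key _ l (Nat.lt_succ_self _)
  have e1 : F' = F'' := eq_of_comul h.F'_comul h'.F'_comul h.F'_one h'.F'_one
    (LinearMap.ext fun x => by
      rw [LinearMap.comp_apply, LinearMap.comp_apply, h.ιInv_F', h'.ιInv_F', hz])
  subst e1
  refine ⟨rfl, sub_eq_zero.1 (eq_of_ιInv_eq (Φ := F ∘ₗ F') (Ψ := parPow 𝒜 g 1) ?_ ?_ ?_ ?_)⟩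
  · rw [LinearMap.comp_sub, h.U_comul, h'.U_comul, ← LinearMap.sub_comp]
    congr 1
    refine TensorProduct.ext' fun x y => ?_
    simp [TensorProduct.sub_tmul, TensorProduct.tmul_sub]
    abel
  · simp [h.F'_one, hF]
  · exact parPow_map_one 1
  · ext x
    rw [LinearMap.comp_apply, LinearMap.sub_apply, map_sub, h.ιInv_U, h'.ιInv_U, hz, sub_self]
    rfl

/-- The unknown is the source `z` alone. Each `z` defines a pair through cofreeness, and the source
of that pair depends contractively on `z`. -/
theorem exists_isRecursiveRetraction (X : AInftyAlgebra 𝒜 g) (hF : IsCoalgMorphism 𝒜 ℬ F)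
    (π : A →ₗ[k] B) (G : A →ₗ[k] A) :
    ∃ (F' : TensorAlgebra k A →ₗ[k] TensorAlgebra k B) (U : Module.End k (TensorAlgebra k A)),
      IsRecursiveRetraction X F π G F' U := by
  -- A coalgebra morphism with prescribed components exists only if these vanish at `1`, so the
  -- value of `z` at `1` is removed first. At the fixed point `z 1 = 0` holds and the correction
  -- disappears.
  let red : (TensorAlgebra k A →ₗ[k] A) → TensorAlgebra k A →ₗ[k] A := fun z =>
    z - LinearMap.toSpanSingleton k A (z 1) ∘ₗ counit.toLinearMap
  have red_one : ∀ z, red z 1 = 0 := fun z => by simp [red]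
  have hcomp : ∀ Φ : TensorAlgebra k A →ₗ[k] TensorAlgebra k B,
      deconc k B ∘ₗ Φ = TensorProduct.map Φ Φ ∘ₗ deconc k A →
      deconc k A ∘ₗ (F ∘ₗ Φ) = TensorProduct.map (F ∘ₗ Φ) (F ∘ₗ Φ) ∘ₗ deconc k A := by
    intro Φ hΦ
    rw [← LinearMap.comp_assoc, hF.comul, LinearMap.comp_assoc, hΦ, ← LinearMap.comp_assoc,
      ← TensorProduct.map_comp]
  choose Φ hΦ1 hΦ hΦι using fun z : TensorAlgebra k A →ₗ[k] A =>
    exists_comul (π ∘ₗ red z) (by simp [red_one])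
  choose U hU1 hU hUι using fun z : TensorAlgebra k A →ₗ[k] A =>
    exists_coder (Ψ := parPow 𝒜 g 1) (by rw [parPow_one_eq]; exact parityT_comul)
      (hcomp (Φ z) (hΦ z)) (parPow_map_one 1) (by simp [hΦ1, hF.map_one]) (G ∘ₗ red z)
  have hU1' : ∀ z, U z 1 = 0 := fun z => by simp [hU1, red_one]
  have hp : ∀ z, IsCoalgPair F (parPow 𝒜 g 1) (Φ z) (U z) := fun z => ⟨hΦ1 z, hΦ z, hU z⟩
  obtain ⟨z, hz⟩ := exists_fixedPoint (fun z : TensorAlgebra k A →ₗ[k] A =>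
      recSource X.diff F (Φ z) (U z)) (fun n z z' hzz l hl => by
    have hr : ∀ m : List A, m.length < n → red z (word k m) = red z' (word k m) := by
      intro m hm
      -- A word of length below `n` exists, so `n` is positive and the hypothesis also covers the
      -- empty word.
      have := hzz [] (by simp; omega)
      simp only [word_nil] at this
      simp [red, hzz m hm, this]
    refine (hp z).higher_eq (hp z') hF.map_one (parPow_map_one 1) (hU1' z')
        (n := n) (fun m hm => ?_) (fun m hm => ?_) X.diff l hl
    · have e1 := LinearMap.congr_fun (hΦι z) (word k m)
      have e2 := LinearMap.congr_fun (hΦι z') (word k m)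
      rw [LinearMap.comp_apply, LinearMap.comp_apply] at e1 e2
      rw [e1, e2, hr m hm]
    · have e1 := LinearMap.congr_fun (hUι z) (word k m)
      have e2 := LinearMap.congr_fun (hUι z') (word k m)
      rw [LinearMap.comp_apply, LinearMap.comp_apply] at e1 e2
      rw [e1, e2, hr m hm])
  have hz1 : z 1 = 0 := by
    rw [← hz]
    simp [recSource, hU1', hΦ1, higher_one F (by rw [hF.map_one, ιInv_one])]
  have hr : red z = z := by ext; simp [red, hz1]
  refine ⟨Φ z, U z, hΦ1 z, hΦ z, hU1' z, hU z, ?_, ?_⟩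
  · rw [hΦι, hr]
    exact congrArg (π ∘ₗ ·) hz.symm
  · rw [hUι, hr]
    exact congrArg (G ∘ₗ ·) hz.symm

end Retraction

/-! ### Homogeneity -/

section Homog

variable {k : Type*} [Field k] {Γ : Type*} [AddCommGroup Γ] {g : SignGrading Γ}
  {A : Type*} [AddCommGroup A] [Module k A] {𝒜 : Γ → Submodule k A}
  {B : Type*} [AddCommGroup B] [Module k B] {ℬ : Γ → Submodule k B}
  {C : Type*} [AddCommGroup C] [Module k C] {𝒞 : Γ → Submodule k C}

theorem word_mem_tdeg {l : List (Γ × A)} (hl : ∀ q ∈ l, q.2 ∈ 𝒜 q.1) :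
    word k (l.map Prod.snd) ∈ tdeg 𝒜 (l.map Prod.fst).sum :=
  Submodule.subset_span ⟨l, hl, rfl, by simp [word, Function.comp_def]⟩

theorem isHomog_of_word {c : Γ} {f : TensorAlgebra k A →ₗ[k] TensorAlgebra k B}
    (h : ∀ l : List (Γ × A), (∀ q ∈ l, q.2 ∈ 𝒜 q.1) →
      f (word k (l.map Prod.snd)) ∈ tdeg ℬ (c + (l.map Prod.fst).sum)) : IsHomog 𝒜 ℬ c f := by
  intro b x hx
  induction hx using Submodule.span_induction with
  | mem x hx =>
    obtain ⟨l, hl, rfl, rfl⟩ := hx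
    have := h l hl
    simpa [word, Function.comp_def] using this
  | zero => simp
  | add x y _ _ hx hy => rw [map_add]; exact Submodule.add_mem _ hx hy
  | smul r x _ hx => rw [map_smul]; exact Submodule.smul_mem _ _ hx

theorem ι_mem_tdeg {c : Γ} {a : A} (h : a ∈ 𝒜 c) : TensorAlgebra.ι k a ∈ tdeg 𝒜 c :=
  Submodule.subset_span ⟨[(c, a)], by simpa using h, by simp, by simp⟩

theorem one_mem_tdeg : (1 : TensorAlgebra k A) ∈ tdeg 𝒜 0 :=
  Submodule.subset_span ⟨[], by simp, by simp, by simp⟩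

theorem ιInv_mem_of_tdeg {c : Γ} {x : TensorAlgebra k A} (h : x ∈ tdeg 𝒜 c) :
    TensorAlgebra.ιInv x ∈ 𝒜 c := by
  induction h using Submodule.span_induction with
  | mem x hx =>
    obtain ⟨l, hl, rfl, rfl⟩ := hx
    match l with
    | [] => simp
    | [q] => simpa using hl q
    | q :: q' :: l => simp [ιInv_mul]
  | zero => simp
  | add x y _ _ hx hy => rw [map_add]; exact Submodule.add_mem _ hx hy
  | smul r x _ hx => rw [map_smul]; exact Submodule.smul_mem _ _ hx

theorem IsHomog.comp {a b : Γ} {f : TensorAlgebra k B →ₗ[k] TensorAlgebra k C}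
    {f' : TensorAlgebra k A →ₗ[k] TensorAlgebra k B} (h : IsHomog ℬ 𝒞 a f)
    (h' : IsHomog 𝒜 ℬ b f') : IsHomog 𝒜 𝒞 (a + b) (f ∘ₗ f') := fun c x hx => by
  rw [add_assoc]; exact h _ _ (h' _ _ hx)

theorem IsHomog.lin₁_mem {c d : Γ} {f : TensorAlgebra k B →ₗ[k] TensorAlgebra k A}
    (h : IsHomog ℬ 𝒜 c f) {b : B} (hb : b ∈ ℬ d) : lin₁ f b ∈ 𝒜 (c + d) :=
  ιInv_mem_of_tdeg (h d _ (ι_mem_tdeg hb))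

theorem IsHomog.higher_mem {c d : Γ} {f : TensorAlgebra k B →ₗ[k] TensorAlgebra k A}
    (h : IsHomog ℬ 𝒜 c f) {x : TensorAlgebra k B} (hx : x ∈ tdeg ℬ d) :
    higher f x ∈ 𝒜 (c + d) :=
  Submodule.sub_mem _ (ιInv_mem_of_tdeg (h d x hx)) (h.lin₁_mem (ιInv_mem_of_tdeg hx))

variable [DecidableEq Γ] [DirectSum.Decomposition 𝒜]

/-- When the counit is applied to both factors of the rule for `Δ U`, each of the two sums has one
surviving extreme cut. The result is `counit (U w) = 2 counit (U w)`. -/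
theorem counit_comp_of_coder {F : TensorAlgebra k B →ₗ[k] TensorAlgebra k A}
    {F' : TensorAlgebra k A →ₗ[k] TensorAlgebra k B} {U : Module.End k (TensorAlgebra k A)}
    (hF : deconc k A ∘ₗ F = TensorProduct.map F F ∘ₗ deconc k B) (hF1 : F 1 = 1)
    (h : IsCoalgPair F (parPow 𝒜 g 1) F' U) (x : TensorAlgebra k A) : counit (U x) = 0 := by
  suffices hs : counit.toLinearMap ∘ₗ U = 0 from LinearMap.congr_fun hs x
  refine ext_word fun l => ?_
  have h2 := congrArg counit (LinearMap.congr_fun counit_rTensor_deconc (U (word k l)))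
  have h3 := LinearMap.congr_fun h.comul₂ (word k l)
  simp only [LinearMap.comp_apply, LinearMap.id_apply] at h2 h3
  rw [h3, deconc_word] at h2
  have hP : ∀ y, counit (parPow 𝒜 g 1 y) = counit y := by
    rw [parPow_one_eq]; exact counit_comp_of_comul parityT_comul parityT_one
  simp only [map_sum, map_add, TensorProduct.map_tmul, LinearMap.rTensor_tmul, LinearEquiv.coe_coe,
    TensorProduct.lid_tmul, LinearMap.add_apply, Finset.sum_add_distrib, map_smul, smul_eq_mul,
    AlgHom.toLinearMap_apply, LinearMap.comp_apply, counit_comp_of_comul hF hF1,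
    counit_comp_of_comul h.comul₁ h.one₁, hP] at h2
  rw [Finset.sum_range_succ, Finset.sum_eq_zero, Finset.sum_range_succ', Finset.sum_eq_zero] at h2
  · simpa using h2
  · intro i hi
    have : l ≠ [] := by rintro rfl; simp at hi
    simp [counit_word, this]
  · intro i hi
    have hi' := Finset.mem_range.1 hi
    simp [counit_word, hi']

theorem parPow_mem_tdeg {c : Γ} {x : TensorAlgebra k A} (h : x ∈ tdeg 𝒜 c) (p : ZMod 2) :
    parPow 𝒜 g p x ∈ tdeg 𝒜 c := by
  rw [parPow_apply h]; exact Submodule.smul_mem _ _ h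

variable [DirectSum.Decomposition ℬ]

theorem IsHomog.parPow_comp {c : Γ} {f : TensorAlgebra k A →ₗ[k] TensorAlgebra k B}
    (h : IsHomog 𝒜 ℬ c f) (p : ZMod 2) :
    parPow ℬ g p ∘ₗ f = ksign k (p * g.par c) • (f ∘ₗ parPow 𝒜 g p) := by
  refine ext_tdeg 𝒜 fun b x hx => ?_
  simp only [LinearMap.comp_apply, LinearMap.smul_apply]
  rw [parPow_apply (h b x hx), parPow_apply hx, map_smul, map_add, mul_add, ksign_add, mul_smul]

theorem IsHomog.parPow_comp_zero {f : TensorAlgebra k A →ₗ[k] TensorAlgebra k B}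
    (h : IsHomog 𝒜 ℬ 0 f) (p : ZMod 2) : parPow ℬ g p ∘ₗ f = f ∘ₗ parPow 𝒜 g p := by
  simp [h.parPow_comp, ksign_zero]

variable {X : AInftyAlgebra 𝒜 g} {F : TensorAlgebra k B →ₗ[k] TensorAlgebra k A}
  {π : A →ₗ[k] B} {G : A →ₗ[k] A} {F' : TensorAlgebra k A →ₗ[k] TensorAlgebra k B}
  {U : Module.End k (TensorAlgebra k A)}

/-- By `firstLetter_deconc`, a value minus its linear part is assembled from linear parts and values
on proper subwords, so it is homogeneous by induction. The source does not see the linear parts of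
`F'` and `U`, so it is homogeneous as well, and `π` and `G` of it supply the missing linear parts.
-/
theorem IsRecursiveRetraction.word_mem (h : IsRecursiveRetraction X F π G F' U)
    (hF : IsCoalgMorphism 𝒜 ℬ F) (hπ : ∀ c, ∀ a ∈ 𝒜 c, π a ∈ ℬ c)
    (hG : ∀ c, ∀ a ∈ 𝒜 c, G a ∈ 𝒜 (-g.e + c)) (l : List (Γ × A)) (hl : ∀ q ∈ l, q.2 ∈ 𝒜 q.1) :
    F' (word k (l.map Prod.snd)) ∈ tdeg ℬ (l.map Prod.fst).sum ∧
    U (word k (l.map Prod.snd)) ∈ tdeg 𝒜 (-g.e + (l.map Prod.fst).sum) := by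
  induction hn : l.length using Nat.strong_induction_on generalizing l with
  | _ n ih =>
    subst hn
    rcases eq_or_ne l [] with rfl | hne
    · simp [h.F'_one, h.U_one, one_mem_tdeg]
    have hpos : 0 < l.length := List.length_pos_of_ne_nil hne
    have hsum : ∀ j, ((l.take j).map Prod.fst).sum + ((l.drop j).map Prod.fst).sum =
        (l.map Prod.fst).sum := fun j => by
      rw [← List.sum_append, ← List.map_append, List.take_append_drop]
    have htake : ∀ j, ∀ q ∈ l.take j, q.2 ∈ 𝒜 q.1 := fun j q hq => hl q (List.mem_of_mem_take hq)
    have hdrop : ∀ j, ∀ q ∈ l.drop j, q.2 ∈ 𝒜 q.1 := fun j q hq => hl q (List.mem_of_mem_drop hq)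
    have ihT : ∀ j < l.length, _ := fun j hj =>
      ih (l.take j).length (by simpa using hj) (l.take j) (htake j) rfl
    have ihD : ∀ j, 0 < j → _ := fun j hj =>
      ih (l.drop j).length (by simp; omega) (l.drop j) (hdrop j) rfl
    have hne' : l.map Prod.snd ≠ [] := by simpa using hne
    have key₁ : F' (word k (l.map Prod.snd)) -
        TensorAlgebra.ι k (TensorAlgebra.ιInv (F' (word k (l.map Prod.snd)))) ∈
          tdeg ℬ (l.map Prod.fst).sum := by
      have h1 := firstLetter_deconc (F' (word k (l.map Prod.snd)))
      have h2 := LinearMap.congr_fun h.F'_comul (word k (l.map Prod.snd))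
      rw [LinearMap.comp_apply] at h2
      rw [h2, LinearMap.comp_apply, deconc_word, counit_comp_of_comul h.F'_comul h.F'_one,
        counit_word, if_neg hne', zero_smul, zero_add] at h1
      simp only [map_sum, TensorProduct.map_tmul, firstLetter_tmul] at h1
      rw [Finset.sum_range_succ, List.take_length, List.drop_length, word_nil, h.F'_one,
        mul_one] at h1
      rw [sub_eq_of_eq_add h1, List.length_map]
      refine Submodule.sum_mem _ fun j hj => ?_
      rcases Nat.eq_zero_or_pos j with rfl | hj0
      · simp [h.F'_one]
      · rw [← hsum j, ← List.map_take, ← List.map_drop]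
        exact tdeg_mul ℬ (ι_mem_tdeg (ιInv_mem_of_tdeg (ihT j (Finset.mem_range.1 hj)).1))
          (ihD j hj0).1
    have key₂ : U (word k (l.map Prod.snd)) -
        TensorAlgebra.ι k (TensorAlgebra.ιInv (U (word k (l.map Prod.snd)))) ∈
          tdeg 𝒜 (-g.e + (l.map Prod.fst).sum) := by
      have h1 := firstLetter_deconc (U (word k (l.map Prod.snd)))
      have h2 := LinearMap.congr_fun h.U_comul (word k (l.map Prod.snd))
      rw [LinearMap.comp_apply] at h2
      rw [h2, LinearMap.comp_apply, deconc_word,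
        counit_comp_of_coder hF.comul hF.map_one h.isCoalgPair, zero_smul, zero_add] at h1
      simp only [map_sum, LinearMap.add_apply, map_add, TensorProduct.map_tmul, firstLetter_tmul,
        Finset.sum_add_distrib] at h1
      rw [Finset.sum_range_succ, List.take_length, List.drop_length, word_nil,
        LinearMap.comp_apply, h.F'_one, hF.map_one, mul_one, add_comm (Finset.sum _ _),
        add_assoc, add_comm (TensorAlgebra.ι k _)] at h1
      rw [sub_eq_of_eq_add h1, List.length_map]
      refine Submodule.add_mem _ (Submodule.sum_mem _ fun j hj => ?_)
        (Submodule.sum_mem _ fun j hj => ?_)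
      · rcases Nat.eq_zero_or_pos j with rfl | hj0
        · simp [h.U_one]
        · rw [← hsum j, ← List.map_take, ← List.map_drop, ← add_assoc]
          refine tdeg_mul 𝒜 (ι_mem_tdeg (ιInv_mem_of_tdeg (ihT j (Finset.mem_range.1 hj)).2)) ?_
          have := hF.homog _ _ (ihD j hj0).1
          rwa [zero_add] at this
      · rcases Nat.eq_zero_or_pos j with rfl | hj0
        · simp [parPow_map_one]
        · rw [← hsum j, ← List.map_take, ← List.map_drop, add_left_comm]
          exact tdeg_mul 𝒜 (ι_mem_tdeg (ιInv_mem_of_tdeg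
            (parPow_mem_tdeg (word_mem_tdeg (htake j)) 1))) (ihD j hj0).2
    -- The component of `∂` raises the degree by `e` and `U` lowers it by `e`, so the source
    -- preserves degrees.
    have hz : recSource X.diff F F' U (word k (l.map Prod.snd)) ∈ 𝒜 (l.map Prod.fst).sum := by
      have e1 := hF.homog.higher_mem key₁
      have e2 := X.diff_mem.1.higher_mem key₂
      rw [map_sub, higher_ι, sub_zero] at e1 e2
      rw [zero_add] at e1
      rw [add_neg_cancel_left] at e2
      exact Submodule.sub_mem _ (Submodule.sub_mem _ (ιInv_mem_of_tdeg (word_mem_tdeg hl)) e2) e1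
    constructor
    · have := Submodule.add_mem _ key₁ (ι_mem_tdeg (hπ _ _ hz))
      rwa [← h.ιInv_F', sub_add_cancel] at this
    · have := Submodule.add_mem _ key₂ (ι_mem_tdeg (hG _ _ hz))
      rwa [← h.ιInv_U, sub_add_cancel] at this

theorem IsRecursiveRetraction.isHomog_F' (h : IsRecursiveRetraction X F π G F' U)
    (hF : IsCoalgMorphism 𝒜 ℬ F) (hπ : ∀ c, ∀ a ∈ 𝒜 c, π a ∈ ℬ c)
    (hG : ∀ c, ∀ a ∈ 𝒜 c, G a ∈ 𝒜 (-g.e + c)) : IsHomog 𝒜 ℬ 0 F' :=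
  isHomog_of_word fun l hl => by rw [zero_add]; exact (h.word_mem hF hπ hG l hl).1

theorem IsRecursiveRetraction.isHomog_U (h : IsRecursiveRetraction X F π G F' U)
    (hF : IsCoalgMorphism 𝒜 ℬ F) (hπ : ∀ c, ∀ a ∈ 𝒜 c, π a ∈ ℬ c)
    (hG : ∀ c, ∀ a ∈ 𝒜 c, G a ∈ 𝒜 (-g.e + c)) : IsHomog 𝒜 𝒜 (-g.e) U :=
  isHomog_of_word fun l hl => (h.word_mem hF hπ hG l hl).2

end Homog

/-! ### The deformation retraction -/

section Linear

variable {k : Type*} [Field k] {Γ : Type*} [AddCommGroup Γ] {g : SignGrading Γ}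
  {A : Type*} [AddCommGroup A] [Module k A] {𝒜 : Γ → Submodule k A}
  {B : Type*} [AddCommGroup B] [Module k B] {ℬ : Γ → Submodule k B}

theorem par_neg_e : g.par (-g.e) = 1 := by
  rw [map_neg, g.par_e]; decide

theorem deconc_ι (a : A) : deconc k A (TensorAlgebra.ι k a) =
    TensorAlgebra.ι k a ⊗ₜ 1 + 1 ⊗ₜ TensorAlgebra.ι k a := by
  have := deconc_ι_mul (k := k) a 1
  simpa [deconc_one] using this

theorem IsCoalgMorphism.map_ι {F : TensorAlgebra k B →ₗ[k] TensorAlgebra k A}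
    (hF : IsCoalgMorphism 𝒜 ℬ F) (b : B) :
    F (TensorAlgebra.ι k b) = TensorAlgebra.ι k (lin₁ F b) := by
  refine eq_ι_of_primitive ?_
  have := LinearMap.congr_fun hF.comul (TensorAlgebra.ι k b)
  simpa [deconc_ι, hF.map_one] using this

end Linear

section Parity

variable {k : Type*} [Field k] {Γ : Type*} [AddCommGroup Γ] [DecidableEq Γ] {g : SignGrading Γ}
  {A : Type*} [AddCommGroup A] [Module k A] {𝒜 : Γ → Submodule k A} [DirectSum.Decomposition 𝒜]
  {B : Type*} [AddCommGroup B] [Module k B] {ℬ : Γ → Submodule k B} [DirectSum.Decomposition ℬ]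

theorem IsHomog.parPow_one_apply {c : Γ} (hc : g.par c = 1)
    {f : TensorAlgebra k A →ₗ[k] TensorAlgebra k B} (h : IsHomog 𝒜 ℬ c f) (x : TensorAlgebra k A) :
    parPow ℬ g 1 (f x) = -f (parPow 𝒜 g 1 x) := by
  have := LinearMap.congr_fun (h.parPow_comp (g := g) 1) x
  simpa [hc, ksign_one] using this

theorem parPow_one_parPow_one (x : TensorAlgebra k A) :
    parPow 𝒜 g 1 (parPow 𝒜 g 1 x) = x := by
  have := LinearMap.congr_fun (parPow_parPow (k := k) 𝒜 g 1 1) x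
  rw [zmod2_one_add_one] at this
  simpa [parPow] using this

end Parity

section Retraction

variable {k : Type*} [Field k] {Γ : Type*} [AddCommGroup Γ] [DecidableEq Γ] {g : SignGrading Γ}
  {A : Type*} [AddCommGroup A] [Module k A] {𝒜 : Γ → Submodule k A} [DirectSum.Decomposition 𝒜]
  {B : Type*} [AddCommGroup B] [Module k B] {ℬ : Γ → Submodule k B}

theorem AInftyAlgebra.comul_diff (X : AInftyAlgebra 𝒜 g) :
    deconc k A ∘ₗ X.diff = (TensorProduct.map X.diff LinearMap.id
      + TensorProduct.map (parPow 𝒜 g 1) X.diff) ∘ₗ deconc k A := by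
  have := X.diff_mem.2
  rwa [g.par_e] at this

theorem AInftyAlgebra.diff_diff_apply (X : AInftyAlgebra 𝒜 g) (x : TensorAlgebra k A) :
    X.diff (X.diff x) = 0 :=
  LinearMap.congr_fun X.diff_diff x

theorem AInftyAlgebra.diff_ι (X : AInftyAlgebra 𝒜 g) (a : A) :
    X.diff (TensorAlgebra.ι k a) = TensorAlgebra.ι k (lin₁ X.diff a) := by
  refine eq_ι_of_primitive ?_
  have := LinearMap.congr_fun X.comul_diff (TensorAlgebra.ι k a)
  simpa [deconc_ι, X.diff_one, parPow_map_one] using this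

theorem AInftyAlgebra.lin₁_lin₁ (X : AInftyAlgebra 𝒜 g) (a : A) :
    lin₁ X.diff (lin₁ X.diff a) = 0 := by
  have := X.diff_diff_apply (TensorAlgebra.ι k a)
  rwa [X.diff_ι, X.diff_ι, TensorAlgebra.ι_eq_zero_iff] at this

/-- The linear component of `∂ ∂ = 0`, split into `r₁` and the higher products; the contribution of
`r₁ r₁` drops out. -/
theorem AInftyAlgebra.higher_diff (X : AInftyAlgebra 𝒜 g) (x : TensorAlgebra k A) :
    higher X.diff (X.diff x) = -lin₁ X.diff (higher X.diff x) := by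
  have h := ιInv_comp_eq X.diff (X.diff x)
  rw [X.diff_diff_apply, ιInv_comp_eq X.diff x, map_add, X.lin₁_lin₁, map_zero, zero_add] at h
  exact (neg_eq_of_add_eq_zero_right h.symm).symm

variable {X : AInftyAlgebra 𝒜 g} {F : TensorAlgebra k B →ₗ[k] TensorAlgebra k A}
  {π : A →ₗ[k] B} {G : A →ₗ[k] A} {F' : TensorAlgebra k A →ₗ[k] TensorAlgebra k B}
  {U : Module.End k (TensorAlgebra k A)}

/-- Applying `π` to the homotopy formula gives `π r₁ G = 0`, by `π F₁ = 1` and `π G = 0`. Applying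
`r₁` to it gives `r₁ = r₁ G r₁`, because `r₁ F₁ = 0`. -/
theorem IsPropagator.π_lin₁ (hp : IsPropagator 𝒜 ℬ g (lin₁ X.diff) (lin₁ F) π G)
    (hr : ∀ b, lin₁ X.diff (lin₁ F b) = 0) (a : A) : π (lin₁ X.diff a) = 0 := by
  have h1 : ∀ a, a - lin₁ F (π a) = lin₁ X.diff (G a) + G (lin₁ X.diff a) :=
    LinearMap.congr_fun hp.homotopy
  have h2 : ∀ b, π (lin₁ F b) = b := LinearMap.congr_fun hp.π_F
  have h3 : ∀ a, π (G a) = 0 := LinearMap.congr_fun hp.π_G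
  have h4 : ∀ a, π (lin₁ X.diff (G a)) = 0 := fun a => by
    have := congrArg π (h1 a)
    rw [map_sub, h2, sub_self, map_add, h3, add_zero] at this
    exact this.symm
  have h5 := congrArg (lin₁ X.diff) (h1 a)
  rw [map_sub, hr, sub_zero, map_add, X.lin₁_lin₁, zero_add] at h5
  rw [h5, h4]

theorem recSource_apply (D : Module.End k (TensorAlgebra k A)) (x : TensorAlgebra k A) :
    recSource D F F' U x =
      TensorAlgebra.ιInv x - higher D (U x) - higher F (F' x) := rfl

theorem map_eq_zero_of_eq_ι {M : Type*} [AddCommGroup M] [Module k M]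
    {f : TensorAlgebra k B →ₗ[k] M} (hf : ∀ b, f (TensorAlgebra.ι k b) = 0)
    {x : TensorAlgebra k B} (hx : x = TensorAlgebra.ι k (TensorAlgebra.ιInv x)) : f x = 0 := by
  rw [hx, hf]

/-- On the first word `w` not covered by the induction both `F' F - 1` and `U F` are primitive.
Hence the source at `F w` sees `U F w` as `0` and `F' F w` as `w`, and collapses to `F₁ (ιInv w)`.
The rest is `π F₁ = 1` and `G F₁ = 0`. -/
theorem IsRecursiveRetraction.retract (h : IsRecursiveRetraction X F π G F' U)
    (hF : IsCoalgMorphism 𝒜 ℬ F) (hp : IsPropagator 𝒜 ℬ g (lin₁ X.diff) (lin₁ F) π G) :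
    F' ∘ₗ F = LinearMap.id ∧ U ∘ₗ F = 0 := by
  have hcF : deconc k B ∘ₗ (F' ∘ₗ F) = TensorProduct.map (F' ∘ₗ F) (F' ∘ₗ F) ∘ₗ deconc k B := by
    rw [← LinearMap.comp_assoc, h.F'_comul, LinearMap.comp_assoc, hF.comul, ← LinearMap.comp_assoc,
      ← TensorProduct.map_comp]
  have hc₁ := comul_sub hcF (Φ' := LinearMap.id) (by simp)
  have hc₂ : deconc k A ∘ₗ (U ∘ₗ F) = (TensorProduct.map (U ∘ₗ F) (F ∘ₗ F' ∘ₗ F)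
      + TensorProduct.map (parPow 𝒜 g 1 ∘ₗ F) (U ∘ₗ F)) ∘ₗ deconc k B := by
    rw [← LinearMap.comp_assoc, h.U_comul, LinearMap.comp_assoc, hF.comul, ← LinearMap.comp_assoc,
      LinearMap.add_comp, ← TensorProduct.map_comp, ← TensorProduct.map_comp, LinearMap.comp_assoc]
  suffices hs : ∀ l : List B, (F' ∘ₗ F - LinearMap.id : Module.End k _) (word k l) = 0 ∧
      (U ∘ₗ F) (word k l) = 0 from
    ⟨sub_eq_zero.1 (ext_word fun l => (hs l).1), ext_word fun l => (hs l).2⟩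
  intro l
  induction hn : l.length using Nat.strong_induction_on generalizing l with
  | _ n ih =>
    subst hn
    have e1 := apply_word_eq_ι (C := 0) (K := 0) (l := l) (by simpa using hc₁)
      (by simp [h.F'_one, hF.map_one]) rfl rfl (fun m hm => (ih _ hm m rfl).1) (fun _ _ => rfl)
    have e2 := apply_word_eq_ι (C := 0) (K := 0) (l := l) (by simpa using hc₂)
      (by simp [h.F'_one, hF.map_one]) (by simp [hF.map_one, parPow_map_one]) rfl
      (fun m hm => (ih _ hm m rfl).2) (fun _ _ => rfl)
    have e3 := map_eq_zero_of_eq_ι (higher_ι F) e1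
    have e4 := map_eq_zero_of_eq_ι (higher_ι X.diff) e2
    have hz : recSource X.diff F F' U (F (word k l)) = lin₁ F (TensorAlgebra.ιInv (word k l)) := by
      simp only [LinearMap.sub_apply, LinearMap.comp_apply, LinearMap.id_apply, map_sub,
        sub_eq_zero] at e3 e4
      rw [recSource_apply, e3, e4, ιInv_comp_eq]
      abel
    rw [e1, e2]
    simp only [LinearMap.sub_apply, LinearMap.comp_apply, LinearMap.id_apply, map_sub, h.ιInv_F',
      h.ιInv_U, hz]
    rw [← LinearMap.comp_apply π, hp.π_F, ← LinearMap.comp_apply G, hp.G_F]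
    simp

variable [DirectSum.Decomposition ℬ] {Y : AInftyAlgebra ℬ g}

theorem IsAInftyMorphism.lin₁_lin₁ (hF : IsAInftyMorphism Y X F) (hY : Y.IsMinimal) (b : B) :
    lin₁ X.diff (lin₁ F b) = 0 := by
  have := LinearMap.congr_fun hF.comm (TensorAlgebra.ι k b)
  rw [LinearMap.comp_apply, LinearMap.comp_apply, Y.diff_ι, hF.map_ι b, X.diff_ι,
    LinearMap.congr_fun hY b] at this
  simpa using this.symm

/-- The linear component of `F ∂̃ = ∂ F`, where minimality removes `r₁ F₁`. -/
theorem IsAInftyMorphism.higher_diff (hF : IsAInftyMorphism Y X F) (hY : Y.IsMinimal)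
    (x : TensorAlgebra k B) :
    lin₁ F (TensorAlgebra.ιInv (Y.diff x)) + higher F (Y.diff x) =
      lin₁ X.diff (higher F x) + higher X.diff (F x) := by
  have h := congrArg TensorAlgebra.ιInv (LinearMap.congr_fun hF.comm x)
  rw [LinearMap.comp_apply, LinearMap.comp_apply, ιInv_comp_eq F, ιInv_comp_eq X.diff (F x),
    ιInv_comp_eq F x, map_add, hF.lin₁_lin₁ hY, zero_add] at h
  exact h

/-- The defects `K` of the chain map property and `E` of the homotopy formula have to vanish
together, since the comultiplication of `E` contains a correction built from `K`. On the linear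
level both follow from the behaviour of the source under `∂`. -/
theorem IsRecursiveRetraction.homotopy (h : IsRecursiveRetraction X F π G F' U)
    (hF : IsAInftyMorphism Y X F) (hY : Y.IsMinimal)
    (hp : IsPropagator 𝒜 ℬ g (lin₁ X.diff) (lin₁ F) π G) :
    F' ∘ₗ X.diff = Y.diff ∘ₗ F' ∧
      LinearMap.id - F ∘ₗ F' = X.diff ∘ₗ U + U ∘ₗ X.diff := by
  have hPd := X.diff_mem.1.parPow_one_apply g.par_e
  have hPU := (h.isHomog_U hF.toIsCoalgMorphism hp.homog_π hp.homog_G).parPow_one_apply par_neg_e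
  have hPF : ∀ x, parPow ℬ g 1 (F' x) = F' (parPow 𝒜 g 1 x) := LinearMap.congr_fun
    ((h.isHomog_F' hF.toIsCoalgMorphism hp.homog_π hp.homog_G).parPow_comp_zero 1)
  have hcomm : ∀ x, F (Y.diff x) = X.diff (F x) := LinearMap.congr_fun hF.comm
  set K := F' ∘ₗ X.diff - Y.diff ∘ₗ F' with hK
  set E := LinearMap.id - F ∘ₗ F' - (X.diff ∘ₗ U + U ∘ₗ X.diff) with hE
  have hc₁ : deconc k B ∘ₗ K = (TensorProduct.map K F'
      + TensorProduct.map (parPow ℬ g 1 ∘ₗ F') K) ∘ₗ deconc k A := by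
    have e1 : deconc k B ∘ₗ (F' ∘ₗ X.diff) = (TensorProduct.map F' F' ∘ₗ
        (TensorProduct.map X.diff LinearMap.id
          + TensorProduct.map (parPow 𝒜 g 1) X.diff)) ∘ₗ deconc k A := by
      rw [← LinearMap.comp_assoc, h.F'_comul, LinearMap.comp_assoc, X.comul_diff,
        LinearMap.comp_assoc]
    have e2 : deconc k B ∘ₗ (Y.diff ∘ₗ F') = ((TensorProduct.map Y.diff LinearMap.id
          + TensorProduct.map (parPow ℬ g 1) Y.diff) ∘ₗ TensorProduct.map F' F') ∘ₗ deconc k A := by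
      rw [← LinearMap.comp_assoc, Y.comul_diff, LinearMap.comp_assoc, h.F'_comul,
        LinearMap.comp_assoc]
    rw [hK, LinearMap.comp_sub, e1, e2, ← LinearMap.sub_comp]
    congr 1
    refine TensorProduct.ext' fun x y => ?_
    simp [hPF, TensorProduct.sub_tmul, TensorProduct.tmul_sub]
    abel
  -- Since `U` and `∂` are odd, the cross terms of `∂ U` and `U ∂` cancel, except that `F F' ∂` and
  -- `∂ F F'` differ by `F K`.
  have hc₂ : deconc k A ∘ₗ E = (TensorProduct.map E (F ∘ₗ F') + TensorProduct.map LinearMap.id E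
      + TensorProduct.map (parPow 𝒜 g 1 ∘ₗ U) (F ∘ₗ K)) ∘ₗ deconc k A := by
    have e1 : deconc k A ∘ₗ (F ∘ₗ F') =
        TensorProduct.map (F ∘ₗ F') (F ∘ₗ F') ∘ₗ deconc k A := by
      rw [← LinearMap.comp_assoc, hF.comul, LinearMap.comp_assoc, h.F'_comul,
        ← LinearMap.comp_assoc, ← TensorProduct.map_comp]
    have e2 : deconc k A ∘ₗ (X.diff ∘ₗ U) = ((TensorProduct.map X.diff LinearMap.id
        + TensorProduct.map (parPow 𝒜 g 1) X.diff) ∘ₗ (TensorProduct.map U (F ∘ₗ F')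
        + TensorProduct.map (parPow 𝒜 g 1) U)) ∘ₗ deconc k A := by
      rw [← LinearMap.comp_assoc, X.comul_diff, LinearMap.comp_assoc, h.U_comul,
        LinearMap.comp_assoc]
    have e3 : deconc k A ∘ₗ (U ∘ₗ X.diff) = ((TensorProduct.map U (F ∘ₗ F')
        + TensorProduct.map (parPow 𝒜 g 1) U) ∘ₗ (TensorProduct.map X.diff LinearMap.id
        + TensorProduct.map (parPow 𝒜 g 1) X.diff)) ∘ₗ deconc k A := by
      rw [← LinearMap.comp_assoc, h.U_comul, LinearMap.comp_assoc, X.comul_diff,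
        LinearMap.comp_assoc]
    rw [hE, hK, LinearMap.comp_sub, LinearMap.comp_sub, LinearMap.comp_add, e1, e2, e3,
      LinearMap.comp_id, ← LinearMap.add_comp]
    have e4 : deconc k A = LinearMap.id ∘ₗ deconc k A := rfl
    conv_lhs => enter [1, 1]; rw [e4]
    rw [← LinearMap.sub_comp, ← LinearMap.sub_comp]
    congr 1
    refine TensorProduct.ext' fun x y => ?_
    simp only [LinearMap.sub_apply, LinearMap.add_apply, LinearMap.comp_apply, LinearMap.id_apply,
      TensorProduct.map_tmul, map_add, map_sub, TensorProduct.sub_tmul, TensorProduct.tmul_sub,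
      TensorProduct.add_tmul, TensorProduct.tmul_add, hPU, hPd, parPow_one_parPow_one, hcomm,
      TensorProduct.neg_tmul]
    abel
  suffices hs : ∀ l : List A, K (word k l) = 0 ∧ E (word k l) = 0 from
    ⟨sub_eq_zero.1 (ext_word fun l => (hs l).1), sub_eq_zero.1 (ext_word fun l => (hs l).2)⟩
  intro l
  induction hn : l.length using Nat.strong_induction_on generalizing l with
  | _ n ih =>
    subst hn
    have e1 := apply_word_eq_ι (C := 0) (K := 0) (l := l) (by simpa using hc₁)
      h.F'_one (by simp [h.F'_one, parPow_map_one]) rfl (fun m hm => (ih _ hm m rfl).1)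
      (fun _ _ => rfl)
    have e2 := apply_word_eq_ι (l := l) hc₂
      (by simp [h.F'_one, hF.map_one]) rfl (by simp [h.U_one])
      (fun m hm => (ih _ hm m rfl).2)
      (fun m hm => by rw [LinearMap.comp_apply, (ih _ hm m rfl).1, map_zero])
    have e3 := map_eq_zero_of_eq_ι (higher_ι F) e1
    have e4 := map_eq_zero_of_eq_ι (higher_ι X.diff) e2
    generalize word k l = w at e1 e2 e3 e4 ⊢
    have hFd := hF.higher_diff hY (F' w)
    -- The source intertwines `∂` with `r₁` up to a term in the image of `F₁`. This uses that `K w`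
    -- and `E w` are primitive, so that under `higher` the two defects may be taken to be zero.
    have hz : recSource X.diff F F' U (X.diff w) = lin₁ X.diff (recSource X.diff F F' U w)
        + lin₁ F (TensorAlgebra.ιInv (Y.diff (F' w))) := by
      simp only [hK, hE, LinearMap.sub_apply, LinearMap.comp_apply, LinearMap.id_apply, map_sub,
        LinearMap.add_apply, map_add, X.higher_diff] at e3 e4
      rw [recSource_apply, recSource_apply, ιInv_comp_eq X.diff, sub_eq_zero.1 e3, map_sub, map_sub]
      have e5 : higher X.diff (U (X.diff w)) = higher X.diff w - higher X.diff (F (F' w))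
          + lin₁ X.diff (higher X.diff (U w)) := by
        rw [← sub_eq_zero, ← neg_eq_zero, ← e4]; abel
      rw [e5, ← sub_eq_zero]
      rw [← sub_eq_zero] at hFd
      rw [← neg_eq_zero, ← hFd]
      abel
    have hr := hF.lin₁_lin₁ hY
    constructor
    · rw [e1, hK, LinearMap.sub_apply, LinearMap.comp_apply, LinearMap.comp_apply, map_sub,
        h.ιInv_F', hz, map_add, hp.π_lin₁ hr, ← LinearMap.comp_apply π, hp.π_F]
      simp
    -- The linear part of `E w` reduces to the homotopy formula of the propagator, evaluated at the
    -- source of `w`; the term in `Im F₁` is killed by `G`.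
    · have e6 := LinearMap.congr_fun hp.homotopy (recSource X.diff F F' U w)
      have e7 : ∀ b, G (lin₁ F b) = 0 := LinearMap.congr_fun hp.G_F
      simp only [LinearMap.sub_apply, LinearMap.comp_apply, LinearMap.id_apply,
        LinearMap.add_apply] at e6
      suffices e9 : TensorAlgebra.ιInv (E w) = 0 by rw [e2, e9, map_zero]
      rw [hE]
      simp only [LinearMap.sub_apply, LinearMap.comp_apply, LinearMap.id_apply, map_sub,
        LinearMap.add_apply, map_add, h.ιInv_U, hz, ιInv_comp_eq X.diff, ιInv_comp_eq F,
        h.ιInv_F', e7, add_zero]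
      have e8 := recSource_apply (F := F) (F' := F') (U := U) X.diff w
      rw [← sub_eq_zero] at e6 e8
      rw [← e6, ← sub_eq_zero, ← neg_eq_zero, ← e8]
      abel

/-- Here the induction treats `F' U` and `U U` together, as the latter has a correction containing
the former. Once both are primitive on `w`, the source satisfies `z (U w) = G (z w)`, and `π G = 0`,
`G G = 0` finish the argument. -/
theorem IsRecursiveRetraction.side_conditions (h : IsRecursiveRetraction X F π G F' U)
    (hF : IsCoalgMorphism 𝒜 ℬ F) (hp : IsPropagator 𝒜 ℬ g (lin₁ X.diff) (lin₁ F) π G) :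
    F' ∘ₗ U = 0 ∧ U ∘ₗ U = 0 := by
  obtain ⟨hr, hUF⟩ := h.retract hF hp
  have hr' : ∀ x, F' (F x) = x := LinearMap.congr_fun hr
  have hUF' : ∀ x, U (F x) = 0 := LinearMap.congr_fun hUF
  have hPU := (h.isHomog_U hF hp.homog_π hp.homog_G).parPow_one_apply (g := g) par_neg_e
  have hc₁ : deconc k B ∘ₗ (F' ∘ₗ U) = (TensorProduct.map (F' ∘ₗ U) F'
      + TensorProduct.map (F' ∘ₗ parPow 𝒜 g 1) (F' ∘ₗ U)) ∘ₗ deconc k A := by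
    rw [← LinearMap.comp_assoc, h.F'_comul, LinearMap.comp_assoc, h.U_comul, ← LinearMap.comp_assoc]
    congr 1
    refine TensorProduct.ext' fun x y => ?_
    simp [hr']
  have hc₂ : deconc k A ∘ₗ (U ∘ₗ U) = (TensorProduct.map (U ∘ₗ U) (F ∘ₗ F')
      + TensorProduct.map LinearMap.id (U ∘ₗ U)
      + TensorProduct.map (U ∘ₗ parPow 𝒜 g 1) (F ∘ₗ (F' ∘ₗ U))) ∘ₗ deconc k A := by
    rw [← LinearMap.comp_assoc, h.U_comul, LinearMap.comp_assoc, h.U_comul, ← LinearMap.comp_assoc]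
    congr 1
    refine TensorProduct.ext' fun x y => ?_
    simp [hr', hUF', parPow_one_parPow_one]
    abel
  suffices hs : ∀ l : List A, (F' ∘ₗ U) (word k l) = 0 ∧ (U ∘ₗ U) (word k l) = 0 from
    ⟨ext_word fun l => (hs l).1, ext_word fun l => (hs l).2⟩
  intro l
  induction hn : l.length using Nat.strong_induction_on generalizing l with
  | _ n ih =>
    subst hn
    have e1 := apply_word_eq_ι (C := 0) (K := 0) (l := l) (by simpa using hc₁)
      h.F'_one (by simp [h.F'_one, parPow_map_one]) rfl (fun m hm => (ih _ hm m rfl).1)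
      (fun _ _ => rfl)
    have e2 := apply_word_eq_ι (l := l) hc₂
      (by simp [h.F'_one, hF.map_one]) rfl (by simp [h.U_one, parPow_map_one])
      (fun m hm => (ih _ hm m rfl).2)
      (fun m hm => by rw [LinearMap.comp_apply, (ih _ hm m rfl).1, map_zero])
    have e3 := map_eq_zero_of_eq_ι (higher_ι F) e1
    have e4 := map_eq_zero_of_eq_ι (higher_ι X.diff) e2
    rw [LinearMap.comp_apply] at e3 e4
    have hz : recSource X.diff F F' U (U (word k l)) = G (recSource X.diff F F' U (word k l)) := by
      rw [recSource_apply, e3, e4, sub_zero, sub_zero, h.ιInv_U]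
    rw [e1, e2, LinearMap.comp_apply, LinearMap.comp_apply, h.ιInv_F', h.ιInv_U, hz,
      ← LinearMap.comp_apply π, ← LinearMap.comp_apply G, hp.π_G, hp.G_G]
    simp

theorem IsRecursiveRetraction.isDeformationRetraction (h : IsRecursiveRetraction X F π G F' U)
    (hF : IsAInftyMorphism Y X F) (hY : Y.IsMinimal)
    (hp : IsPropagator 𝒜 ℬ g (lin₁ X.diff) (lin₁ F) π G) :
    IsDeformationRetraction Y X F F' U where
  F_homog := hF.homog
  F_comm := hF.comm
  F'_homog := h.isHomog_F' hF.toIsCoalgMorphism hp.homog_π hp.homog_G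
  F'_comm := (h.homotopy hF hY hp).1
  U_homog := h.isHomog_U hF.toIsCoalgMorphism hp.homog_π hp.homog_G
  retract := (h.retract hF.toIsCoalgMorphism hp).1
  homotopy := (h.homotopy hF hY hp).2

end Retraction

/-! ### Existence of propagators -/

section Propagator

variable {k : Type*} [Field k] {Γ : Type*} [DecidableEq Γ]
  {A : Type*} [AddCommGroup A] [Module k A] (𝒜 : Γ → Submodule k A) [DirectSum.Decomposition 𝒜]
  {B : Type*} [AddCommGroup B] [Module k B] (ℬ : Γ → Submodule k B) [DirectSum.Decomposition ℬ]
  {M : Type*} [AddCommGroup M] [Module k M]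

theorem ext_homogeneous {f f' : A →ₗ[k] M} (h : ∀ c, ∀ a ∈ 𝒜 c, f a = f' a) : f = f' := by
  refine LinearMap.ext fun a => ?_
  induction a using DirectSum.Decomposition.inductionOn 𝒜 with
  | zero => simp
  | @homogeneous c a => exact h c a a.2
  | add a b ha hb => rw [map_add, map_add, ha, hb]

theorem exists_linearMap_homogeneous (φ : ∀ c, 𝒜 c →ₗ[k] M) :
    ∃ f : A →ₗ[k] M, ∀ c, ∀ a : 𝒜 c, f a = φ c a := by
  refine ⟨DirectSum.toModule k Γ M φ ∘ₗ (DirectSum.decomposeLinearEquiv 𝒜).toLinearMap,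
    fun c a => ?_⟩
  have h1 := DirectSum.decompose_of_mem 𝒜 a.2
  simp only [LinearMap.comp_apply, LinearEquiv.coe_coe, DirectSum.decomposeLinearEquiv_apply, h1]
  exact DirectSum.toModule_lof (M := fun i => 𝒜 i) k c a

theorem decompose_map {t : Γ → Γ} (ht : Function.Injective t) {f : A →ₗ[k] B}
    (hf : ∀ c, ∀ a ∈ 𝒜 c, f a ∈ ℬ (t c)) (a : A) (c : Γ) :
    (DirectSum.decompose ℬ (f a) (t c) : B) = f (DirectSum.decompose 𝒜 a c) := by
  induction a using DirectSum.Decomposition.inductionOn 𝒜 with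
  | zero => simp
  | @homogeneous d a =>
    rcases eq_or_ne d c with rfl | hd
    · rw [DirectSum.decompose_of_mem_same ℬ (hf d a a.2), DirectSum.decompose_of_mem_same 𝒜 a.2]
    · rw [DirectSum.decompose_of_mem_ne ℬ (hf d a a.2) (ht.ne hd),
        DirectSum.decompose_of_mem_ne 𝒜 a.2 hd, map_zero]
  | add a b ha hb => simp [DirectSum.decompose_add, ha, hb]

theorem exists_generalizedInverse {V W : Type*} [AddCommGroup V] [Module k V] [AddCommGroup W]
    [Module k W] (f : V →ₗ[k] W) : ∃ s : W →ₗ[k] V, ∀ v, f (s (f v)) = f v := by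
  obtain ⟨s, hs⟩ := f.rangeRestrict.exists_rightInverse_of_surjective f.range_rangeRestrict
  obtain ⟨s', hs'⟩ := s.exists_extend
  refine ⟨s', fun v => ?_⟩
  have h1 := LinearMap.congr_fun hs' (f.rangeRestrict v)
  have h2 := congrArg Subtype.val (LinearMap.congr_fun hs (f.rangeRestrict v))
  change s' (f v) = _ at h1
  change f (s (f.rangeRestrict v)) = f v at h2
  rw [h1, h2]

variable {𝒜 ℬ} [AddCommGroup Γ]

/-- A generalised inverse is chosen separately for the part of `r` that lands in each degree, so
homogeneity holds by construction. -/
theorem exists_homogeneous_generalizedInverse {r : A →ₗ[k] A} {e : Γ}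
    (hr : ∀ c, ∀ a ∈ 𝒜 c, r a ∈ 𝒜 (e + c)) :
    ∃ s : A →ₗ[k] A, (∀ a, r (s (r a)) = r a) ∧ ∀ c, ∀ a ∈ 𝒜 c, s a ∈ 𝒜 (-e + c) := by
  choose s hs using fun c => exists_generalizedInverse (r ∘ₗ (𝒜 (-e + c)).subtype)
  obtain ⟨s', hs'⟩ := exists_linearMap_homogeneous 𝒜
    fun c => (𝒜 (-e + c)).subtype ∘ₗ s c ∘ₗ (𝒜 c).subtype
  refine ⟨s', fun a => ?_, fun c a ha => ?_⟩
  · suffices h : r ∘ₗ s' ∘ₗ r = r from LinearMap.congr_fun h a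
    refine ext_homogeneous 𝒜 fun c a ha => ?_
    have h1 := hs' (e + c) ⟨r a, hr c a ha⟩
    have h2 := hs (e + c) ⟨a, by rwa [neg_add_cancel_left]⟩
    simp only [LinearMap.comp_apply, Submodule.subtype_apply] at h1 h2 ⊢
    rw [h1, h2]
  · have h1 := hs' c ⟨a, ha⟩
    rw [h1]
    exact (s c a).2

/-- With `r s r = r`, the map `1 - s r` projects onto `Ker r`, and `p` reads off the cohomology
class there. So `π = p (1 - s r)`, the remainder `q = 1 - s r - f π` projects onto `Im r`, and `G =
s q`. The identity `s q = s r s q` makes `π` and `q` vanish on the image of `G`, which yields the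
side conditions. -/
theorem exists_isPropagator {g : SignGrading Γ} {r : A →ₗ[k] A} {f : B →ₗ[k] A}
    (hr : ∀ c, ∀ a ∈ 𝒜 c, r a ∈ 𝒜 (g.e + c)) (hrr : ∀ a, r (r a) = 0)
    (hf : ∀ c, ∀ b ∈ ℬ c, f b ∈ 𝒜 c) (hrf : ∀ b, r (f b) = 0)
    (hinj : ∀ b, (∃ a, f b = r a) → b = 0) (hsurj : ∀ a, r a = 0 → ∃ b a', a - f b = r a') :
    ∃ (π : A →ₗ[k] B) (G : A →ₗ[k] A), IsPropagator 𝒜 ℬ g r f π G := by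
  obtain ⟨s, hs, hsdeg⟩ := exists_homogeneous_generalizedInverse hr
  -- The quasi-isomorphism hypothesis makes `f` injective modulo `Im r`; a left inverse there gives
  -- a left inverse of `f` that kills `Im r`.
  obtain ⟨ρ, hρ⟩ := ((LinearMap.range r).mkQ ∘ₗ f).exists_leftInverse_of_injective (by
    refine LinearMap.ker_eq_bot'.2 fun b hb => hinj b ?_
    rw [LinearMap.comp_apply, Submodule.mkQ_apply, Submodule.Quotient.mk_eq_zero] at hb
    obtain ⟨a, ha⟩ := hb
    exact ⟨a, ha.symm⟩)
  obtain ⟨p, hp⟩ : ∃ p : A →ₗ[k] B, p = ρ ∘ₗ (LinearMap.range r).mkQ := ⟨_, rfl⟩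
  have hpf : ∀ b, p (f b) = b := fun b => by rw [hp]; exact LinearMap.congr_fun hρ b
  have hpr : ∀ a, p (r a) = 0 := fun a => by
    have : (LinearMap.range r).mkQ (r a) = 0 :=
      (Submodule.Quotient.mk_eq_zero _).2 ⟨a, rfl⟩
    rw [hp, LinearMap.comp_apply, this, map_zero]
  have hdec : ∀ a, r a = 0 → ∃ y, a = f (p a) + r y := by
    intro a ha
    obtain ⟨b, y, hy⟩ := hsurj a ha
    rw [sub_eq_iff_eq_add'] at hy
    refine ⟨y, ?_⟩
    have : p a = b := by rw [hy, map_add, hpf, hpr, add_zero]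
    rw [this, hy]
  have hker : ∀ a, r (a - s (r a)) = 0 := fun a => by rw [map_sub, hs, sub_self]
  have hsr : ∀ c, ∀ a ∈ 𝒜 c, s (r a) ∈ 𝒜 c := fun c a ha => by
    have := hsdeg _ _ (hr c a ha)
    rwa [neg_add_cancel_left] at this
  -- The map `p` was chosen without regard to degrees. It is nevertheless homogeneous on cycles:
  -- comparing components of degree `c` in `x = f h + r y` and applying `p` shows that `h` is its
  -- own component of degree `c`.
  have hπdeg : ∀ c, ∀ a ∈ 𝒜 c, p (a - s (r a)) ∈ ℬ c := by
    intro c a ha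
    have hx : a - s (r a) ∈ 𝒜 c := Submodule.sub_mem _ ha (hsr c a ha)
    obtain ⟨y, hy⟩ := hdec _ (hker a)
    set h := p (a - s (r a))
    have h1 := DirectSum.decompose_of_mem_same 𝒜 hx
    have h2 := decompose_map ℬ 𝒜 (t := id) Function.injective_id hf h c
    have h3 : ∀ d, d = g.e + (-g.e + c) → (DirectSum.decompose 𝒜 (r y) d : A) =
        r (DirectSum.decompose 𝒜 y (-g.e + c)) := by
      rintro _ rfl
      exact decompose_map 𝒜 𝒜 (t := fun c => g.e + c) (add_right_injective g.e) hr y (-g.e + c)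
    have h3 := h3 c (add_neg_cancel_left _ _).symm
    simp only [id] at h2
    rw [hy, DirectSum.decompose_add, DirectSum.add_apply, Submodule.coe_add, h2, h3, ← hy] at h1
    have h4 := congrArg p h1
    rw [map_add, hpf, hpr, add_zero] at h4
    have h5 : (DirectSum.decompose ℬ h c : B) = h := h4
    rw [← h5]
    exact (DirectSum.decompose ℬ h c).2
  let π : A →ₗ[k] B := p ∘ₗ (LinearMap.id - s ∘ₗ r)
  let q : A →ₗ[k] A := LinearMap.id - s ∘ₗ r - f ∘ₗ π
  have hπ : ∀ a, π a = p (a - s (r a)) := fun a => rfl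
  have hq : ∀ a, q a = a - s (r a) - f (π a) := fun a => rfl
  have hqr : ∀ a, r (s (q a)) = q a := by
    intro a
    obtain ⟨y, hy⟩ := hdec _ (hker a)
    have : q a = r y := by rw [hq, hπ, sub_eq_iff_eq_add']; exact hy
    rw [this, hs]
  have hπf : ∀ b, π (f b) = b := fun b => by rw [hπ, hrf, map_zero, sub_zero, hpf]
  have hπr : ∀ a, π (r a) = 0 := fun a => by rw [hπ, hrr, map_zero, sub_zero, hpr]
  have hrq : ∀ a, q (r a) = r a := fun a => by
    rw [hq, hrr, hπr, map_zero, map_zero, sub_zero, sub_zero]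
  have hsq : ∀ a, s (q a) = s (r (s (q a))) := fun a => by rw [hqr]
  have hsrs : ∀ a, s (q a) - s (r (s (q a))) = 0 := fun a => by rw [← hsq, sub_self]
  have hπs : ∀ a, π (s (q a)) = 0 := fun a => by rw [hπ, hsrs, map_zero]
  refine ⟨π, s ∘ₗ q, hπdeg, fun c a ha => hsdeg c _ ?_, LinearMap.ext hπf,
    LinearMap.ext fun a => ?_, LinearMap.ext fun a => ?_, LinearMap.ext fun b => ?_,
    LinearMap.ext hπs⟩
  · exact Submodule.sub_mem _ (Submodule.sub_mem _ ha (hsr c a ha)) (hf c _ (hπdeg c a ha))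
  · change a - f (π a) = r (s (q a)) + s (q (r a))
    rw [hqr, hrq, hq]
    abel
  · simp only [LinearMap.comp_apply, LinearMap.zero_apply]
    rw [hq (s (q a)), hsrs, hπs, map_zero, sub_zero, map_zero]
  · simp only [LinearMap.comp_apply, LinearMap.zero_apply]
    rw [hq, hrf, hπf, map_zero, sub_zero, sub_self, map_zero]

end Propagator

section QuasiIso

variable {k : Type*} [Field k] {Γ : Type*} [AddCommGroup Γ] [DecidableEq Γ] {g : SignGrading Γ}
  {A : Type*} [AddCommGroup A] [Module k A] {𝒜 : Γ → Submodule k A} [DirectSum.Decomposition 𝒜]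
  {B : Type*} [AddCommGroup B] [Module k B] {ℬ : Γ → Submodule k B} [DirectSum.Decomposition ℬ]
  {X : AInftyAlgebra 𝒜 g} {Y : AInftyAlgebra ℬ g}
  {F : TensorAlgebra k B →ₗ[k] TensorAlgebra k A}

theorem IsAInftyQuasiIso.exists_isPropagator (hF : IsAInftyQuasiIso Y X F) (hY : Y.IsMinimal) :
    ∃ (π : A →ₗ[k] B) (G : A →ₗ[k] A), IsPropagator 𝒜 ℬ g (lin₁ X.diff) (lin₁ F) π G := by
  have hY' : ∀ b, lin₁ Y.diff b = 0 := LinearMap.congr_fun hY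
  refine AInf.exists_isPropagator (fun c a ha => X.diff_mem.1.lin₁_mem ha) X.lin₁_lin₁
    (fun c b hb => ?_) (hF.lin₁_lin₁ hY) (fun b hb => ?_) (fun a ha => ?_)
  · have := hF.homog.lin₁_mem hb
    rwa [zero_add] at this
  · obtain ⟨b', rfl⟩ := hF.inj b (hY' b) hb
    exact hY' b'
  · obtain ⟨b, -, h⟩ := hF.surj a ha
    exact ⟨b, h⟩

end QuasiIso

/-! ### The transferred coderivations -/

section TransferWord

variable {k : Type*} [Field k] {Γ : Type*} [AddCommGroup Γ] [DecidableEq Γ] {g : SignGrading Γ}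
  {A : Type*} [AddCommGroup A] [Module k A] {𝒜 : Γ → Submodule k A} [DirectSum.Decomposition 𝒜]
  {B : Type*} [AddCommGroup B] [Module k B] {ℬ : Γ → Submodule k B}
  {F : TensorAlgebra k B →ₗ[k] TensorAlgebra k A} {F' : TensorAlgebra k A →ₗ[k] TensorAlgebra k B}
  {U : Module.End k (TensorAlgebra k A)}

/-- The properties of a retraction `(F, F̄, U)` of tensor coalgebras that make the maps
`F̄ x₀ U x₁ ⋯ U xₙ F` coderivations. -/
structure IsSpecialRetraction (𝒜 : Γ → Submodule k A) [DirectSum.Decomposition 𝒜]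
    (ℬ : Γ → Submodule k B) (g : SignGrading Γ)
    (F : TensorAlgebra k B →ₗ[k] TensorAlgebra k A) (F' : TensorAlgebra k A →ₗ[k] TensorAlgebra k B)
    (U : Module.End k (TensorAlgebra k A)) : Prop where
  F_homog : IsHomog ℬ 𝒜 0 F
  F'_homog : IsHomog 𝒜 ℬ 0 F'
  U_homog : IsHomog 𝒜 𝒜 (-g.e) U
  F_comul : deconc k A ∘ₗ F = TensorProduct.map F F ∘ₗ deconc k B
  F'_comul : deconc k B ∘ₗ F' = TensorProduct.map F' F' ∘ₗ deconc k A
  U_comul : deconc k A ∘ₗ U =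
    (TensorProduct.map U (F ∘ₗ F') + TensorProduct.map (parPow 𝒜 g 1) U) ∘ₗ deconc k A
  F'_F : ∀ x, F' (F x) = x
  U_F : ∀ x, U (F x) = 0
  F'_U : ∀ x, F' (U x) = 0
  U_U : ∀ x, U (U x) = 0

/-- The comultiplication of the maps `R = U x₁ U ⋯ U xₙ F` of parity `p`: up to terms in
`Im U ⊗ Im U`, they are coderivations along `F`. -/
def IsTail (𝒜 : Γ → Submodule k A) [DirectSum.Decomposition 𝒜] (g : SignGrading Γ)
    (F : TensorAlgebra k B →ₗ[k] TensorAlgebra k A) (U : Module.End k (TensorAlgebra k A))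
    (p : ZMod 2) (R : TensorAlgebra k B →ₗ[k] TensorAlgebra k A) : Prop :=
  (∃ R', R = U ∘ₗ R') ∧ ∃ s, deconc k A ∘ₗ R =
    (TensorProduct.map R F + TensorProduct.map (parPow 𝒜 g p ∘ₗ F) R) ∘ₗ deconc k B
      + TensorProduct.map U U ∘ₗ s

theorem parPow_parPow_apply (p q : ZMod 2) (x : TensorAlgebra k A) :
    parPow 𝒜 g p (parPow 𝒜 g q x) = parPow 𝒜 g (p + q) x :=
  LinearMap.congr_fun (parPow_parPow 𝒜 g p q) x

theorem IsHomog.comp_parPow_apply [DirectSum.Decomposition ℬ] {c : Γ}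
    {f : TensorAlgebra k A →ₗ[k] TensorAlgebra k B}
    (h : IsHomog 𝒜 ℬ c f) (p : ZMod 2) (x : TensorAlgebra k A) :
    f (parPow 𝒜 g p x) = ksign k (p * g.par c) • parPow ℬ g p (f x) := by
  have := LinearMap.congr_fun (h.parPow_comp (g := g) p) x
  simp only [LinearMap.comp_apply, LinearMap.smul_apply] at this
  rw [this, smul_smul, ← ksign_add, CharTwo.add_self_eq_zero, ksign_zero, one_smul]

theorem comul_apply_of_mem {c : Γ} {f : Module.End k (TensorAlgebra k A)} (hf : f ∈ Coder 𝒜 g c)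
    (x : TensorAlgebra k A) : deconc k A (f x) = (TensorProduct.map f LinearMap.id
      + TensorProduct.map (parPow 𝒜 g (g.par c)) f : Module.End k _) (deconc k A x) :=
  LinearMap.congr_fun hf.2 x

namespace IsSpecialRetraction

variable (h : IsSpecialRetraction 𝒜 ℬ g F F' U)
include h

theorem U_parPow_U (p : ZMod 2) (x : TensorAlgebra k A) : U (parPow 𝒜 g p (U x)) = 0 := by
  rw [h.U_homog.comp_parPow_apply, h.U_U, map_zero, smul_zero]

theorem U_parPow_F (p : ZMod 2) (x : TensorAlgebra k B) : U (parPow 𝒜 g p (F x)) = 0 := by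
  rw [h.U_homog.comp_parPow_apply, h.U_F, map_zero, smul_zero]

theorem F_comul_apply (x : TensorAlgebra k B) :
    deconc k A (F x) = TensorProduct.map F F (deconc k B x) :=
  LinearMap.congr_fun h.F_comul x

theorem F'_comul_apply (x : TensorAlgebra k A) :
    deconc k B (F' x) = TensorProduct.map F' F' (deconc k A x) :=
  LinearMap.congr_fun h.F'_comul x

theorem U_comul_apply (x : TensorAlgebra k A) :
    deconc k A (U x) = (TensorProduct.map U (F ∘ₗ F') + TensorProduct.map (parPow 𝒜 g 1) U)
      (deconc k A x) :=
  LinearMap.congr_fun h.U_comul x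

/-- With `F` at the end, `F' F = 1` and `U F = 0` remove all cross terms, so there is no error term
yet. -/
theorem isTail_last {c : Γ} {f : Module.End k (TensorAlgebra k A)} (hf : f ∈ Coder 𝒜 g c) :
    IsTail 𝒜 g F U (1 + g.par c) (U ∘ₗ f ∘ₗ F) := by
  refine ⟨⟨_, rfl⟩, 0, ?_⟩
  have key : (TensorProduct.map U (F ∘ₗ F') + TensorProduct.map (parPow 𝒜 g 1) U) ∘ₗ
      (TensorProduct.map f LinearMap.id + TensorProduct.map (parPow 𝒜 g (g.par c)) f) ∘ₗ
      TensorProduct.map F F = TensorProduct.map (U ∘ₗ f ∘ₗ F) F +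
        TensorProduct.map (parPow 𝒜 g (1 + g.par c) ∘ₗ F) (U ∘ₗ f ∘ₗ F) := by
    refine TensorProduct.ext' fun x y => ?_
    simp [h.F'_F, h.U_F, h.U_parPow_F, parPow_parPow_apply]
  refine LinearMap.ext fun x => ?_
  rw [LinearMap.comp_zero, add_zero, LinearMap.comp_apply, LinearMap.comp_apply,
    LinearMap.comp_apply, h.U_comul_apply, comul_apply_of_mem hf, h.F_comul_apply]
  exact LinearMap.congr_fun key _

/-- Of the old error only the term with `f` and `U` both acting on the second factor survives, by
`F' U = 0` and `U U = 0`, and it stays in `Im U ⊗ Im U`. One new error appears: `U` hits `f F` in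
the second factor while the first already lies in `Im U`. This is why the tail is recorded in the
form `U R'`. -/
theorem isTail_cons {c : Γ} {f : Module.End k (TensorAlgebra k A)} (hf : f ∈ Coder 𝒜 g c)
    {p : ZMod 2} {R : TensorAlgebra k B →ₗ[k] TensorAlgebra k A} (hR : IsTail 𝒜 g F U p R) :
    IsTail 𝒜 g F U (1 + g.par c + p) (U ∘ₗ f ∘ₗ R) := by
  obtain ⟨⟨R', rfl⟩, s, hs⟩ := hR
  have hP := fun x => LinearMap.congr_fun (h.U_homog.parPow_comp (g := g) (1 + g.par c)) x
  simp only [LinearMap.comp_apply, LinearMap.smul_apply] at hP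
  have h2 : (TensorProduct.map U (F ∘ₗ F') + TensorProduct.map (parPow 𝒜 g 1) U) ∘ₗ
      (TensorProduct.map f LinearMap.id + TensorProduct.map (parPow 𝒜 g (g.par c)) f) ∘ₗ
      TensorProduct.map U U =
      TensorProduct.map U U ∘ₗ (ksign k ((1 + g.par c) * g.par (-g.e)) •
        TensorProduct.map (parPow 𝒜 g (1 + g.par c)) (f ∘ₗ U)) := by
    refine TensorProduct.ext' fun x y => ?_
    simp only [LinearMap.comp_apply, LinearMap.add_apply, TensorProduct.map_tmul, map_add,
      LinearMap.id_apply, h.F'_U, h.U_U, h.U_parPow_U, map_zero, TensorProduct.tmul_zero,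
      TensorProduct.zero_tmul, parPow_parPow_apply, zero_add, LinearMap.smul_apply, map_smul]
    rw [hP, TensorProduct.smul_tmul']
  have h3 : (TensorProduct.map U (F ∘ₗ F') + TensorProduct.map (parPow 𝒜 g 1) U) ∘ₗ
      (TensorProduct.map f LinearMap.id + TensorProduct.map (parPow 𝒜 g (g.par c)) f) ∘ₗ
      (TensorProduct.map (U ∘ₗ R') F + TensorProduct.map (parPow 𝒜 g p ∘ₗ F) (U ∘ₗ R')) =
      TensorProduct.map (U ∘ₗ f ∘ₗ U ∘ₗ R') F +
        TensorProduct.map (parPow 𝒜 g (1 + g.par c + p) ∘ₗ F) (U ∘ₗ f ∘ₗ U ∘ₗ R') +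
      TensorProduct.map U U ∘ₗ (ksign k ((1 + g.par c) * g.par (-g.e)) •
        TensorProduct.map (parPow 𝒜 g (1 + g.par c) ∘ₗ R') (f ∘ₗ F)) := by
    refine TensorProduct.ext' fun x y => ?_
    simp only [LinearMap.comp_apply, LinearMap.add_apply, TensorProduct.map_tmul, map_add,
      LinearMap.id_apply, h.F'_U, h.U_U, h.U_F, h.F'_F, h.U_parPow_U, h.U_parPow_F, map_zero,
      TensorProduct.tmul_zero, TensorProduct.zero_tmul, parPow_parPow_apply, zero_add, add_zero,
      LinearMap.smul_apply, map_smul, ← add_assoc]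
    rw [hP, TensorProduct.smul_tmul']
    abel
  refine ⟨⟨_, rfl⟩, (ksign k ((1 + g.par c) * g.par (-g.e)) •
      TensorProduct.map (parPow 𝒜 g (1 + g.par c) ∘ₗ R') (f ∘ₗ F)) ∘ₗ deconc k B
      + (ksign k ((1 + g.par c) * g.par (-g.e)) •
        TensorProduct.map (parPow 𝒜 g (1 + g.par c)) (f ∘ₗ U)) ∘ₗ s, LinearMap.ext fun x => ?_⟩
  have e1 := LinearMap.congr_fun hs x
  have e2 := LinearMap.congr_fun h2 (s x)
  have e3 := LinearMap.congr_fun h3 (deconc k B x)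
  rw [LinearMap.comp_apply, LinearMap.comp_apply, LinearMap.comp_apply, h.U_comul_apply,
    comul_apply_of_mem hf]
  rw [LinearMap.comp_apply, LinearMap.add_apply] at e1
  rw [e1, map_add, map_add]
  refine (congrArg₂ (· + ·) e3 e2).trans ?_
  simp only [LinearMap.add_apply, LinearMap.comp_apply, map_add, add_assoc]

variable [DirectSum.Decomposition ℬ]

theorem F'_parPow_U (p : ZMod 2) (x : TensorAlgebra k A) : F' (parPow 𝒜 g p (U x)) = 0 := by
  rw [h.F'_homog.comp_parPow_apply, h.F'_U, (parPow ℬ g p).map_zero, smul_zero]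

theorem F'_parPow_F (p : ZMod 2) (x : TensorAlgebra k B) :
    F' (parPow 𝒜 g p (F x)) = parPow ℬ g p x := by
  rw [h.F'_homog.comp_parPow_apply, map_zero, mul_zero, ksign_zero, one_smul, h.F'_F]

/-- A single coderivation `f` touches only one factor of the error in `Im U ⊗ Im U`; the other
factor is killed by `F' U = 0`. -/
theorem comul_of_isTail {c : Γ} {f : Module.End k (TensorAlgebra k A)} (hf : f ∈ Coder 𝒜 g c)
    {p : ZMod 2} {R : TensorAlgebra k B →ₗ[k] TensorAlgebra k A} (hR : IsTail 𝒜 g F U p R) :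
    deconc k B ∘ₗ (F' ∘ₗ f ∘ₗ R) = (TensorProduct.map (F' ∘ₗ f ∘ₗ R) LinearMap.id
      + TensorProduct.map (parPow ℬ g (g.par c + p)) (F' ∘ₗ f ∘ₗ R)) ∘ₗ deconc k B := by
  obtain ⟨⟨R', rfl⟩, s, hs⟩ := hR
  have h2 : TensorProduct.map F' F' ∘ₗ
      (TensorProduct.map f LinearMap.id + TensorProduct.map (parPow 𝒜 g (g.par c)) f) ∘ₗ
      TensorProduct.map U U = 0 := by
    refine TensorProduct.ext' fun x y => ?_
    simp [h.F'_U, h.F'_parPow_U]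
  have h3 : TensorProduct.map F' F' ∘ₗ
      (TensorProduct.map f LinearMap.id + TensorProduct.map (parPow 𝒜 g (g.par c)) f) ∘ₗ
      (TensorProduct.map (U ∘ₗ R') F + TensorProduct.map (parPow 𝒜 g p ∘ₗ F) (U ∘ₗ R')) =
      TensorProduct.map (F' ∘ₗ f ∘ₗ U ∘ₗ R') LinearMap.id
        + TensorProduct.map (parPow ℬ g (g.par c + p)) (F' ∘ₗ f ∘ₗ U ∘ₗ R') := by
    refine TensorProduct.ext' fun x y => ?_
    simp [h.F'_F, h.F'_U, h.F'_parPow_U, parPow_parPow_apply, h.F'_parPow_F]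
  refine LinearMap.ext fun x => ?_
  have e1 := LinearMap.congr_fun hs x
  have e2 := LinearMap.congr_fun h2 (s x)
  have e3 := LinearMap.congr_fun h3 (deconc k B x)
  rw [LinearMap.comp_apply, LinearMap.comp_apply, LinearMap.comp_apply, h.F'_comul_apply,
    comul_apply_of_mem hf]
  rw [LinearMap.comp_apply, LinearMap.add_apply] at e1
  rw [e1, map_add, map_add]
  refine (congrArg₂ (· + ·) e3 e2).trans ?_
  rw [LinearMap.zero_apply, add_zero]
  rfl

theorem comul_single {c : Γ} {f : Module.End k (TensorAlgebra k A)} (hf : f ∈ Coder 𝒜 g c) :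
    deconc k B ∘ₗ (F' ∘ₗ f ∘ₗ F) = (TensorProduct.map (F' ∘ₗ f ∘ₗ F) LinearMap.id
      + TensorProduct.map (parPow ℬ g (g.par c)) (F' ∘ₗ f ∘ₗ F)) ∘ₗ deconc k B := by
  have key : TensorProduct.map F' F' ∘ₗ
      (TensorProduct.map f LinearMap.id + TensorProduct.map (parPow 𝒜 g (g.par c)) f) ∘ₗ
      TensorProduct.map F F = TensorProduct.map (F' ∘ₗ f ∘ₗ F) LinearMap.id +
        TensorProduct.map (parPow ℬ g (g.par c)) (F' ∘ₗ f ∘ₗ F) := by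
    refine TensorProduct.ext' fun x y => ?_
    simp [h.F'_F, h.F'_parPow_F]
  refine LinearMap.ext fun x => ?_
  rw [LinearMap.comp_apply, LinearMap.comp_apply, LinearMap.comp_apply, h.F'_comul_apply,
    comul_apply_of_mem hf, h.F_comul_apply]
  exact LinearMap.congr_fun key _

end IsSpecialRetraction

theorem transferWord_zero (f : Fin 1 → Module.End k (TensorAlgebra k A)) :
    transferWord F F' U f = F' ∘ₗ f 0 ∘ₗ F := by
  simp [transferWord]

/-- The map `U f₀ U f₁ ⋯ U fₙ F`. -/
def transferTail (F : TensorAlgebra k B →ₗ[k] TensorAlgebra k A)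
    (U : Module.End k (TensorAlgebra k A)) {n : ℕ}
    (f : Fin (n + 1) → Module.End k (TensorAlgebra k A)) :
    TensorAlgebra k B →ₗ[k] TensorAlgebra k A :=
  U ∘ₗ ((List.ofFn fun i : Fin n => f i.castSucc * U).prod * f (Fin.last n)) ∘ₗ F

theorem transferTail_succ {n : ℕ} (f : Fin (n + 2) → Module.End k (TensorAlgebra k A)) :
    transferTail F U f = U ∘ₗ f 0 ∘ₗ transferTail F U (Fin.tail f) := by
  simp only [transferTail, List.ofFn_succ, List.prod_cons, mul_assoc]
  rfl

theorem transferWord_succ {n : ℕ} (f : Fin (n + 2) → Module.End k (TensorAlgebra k A)) :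
    transferWord F F' U f = F' ∘ₗ f 0 ∘ₗ transferTail F U (Fin.tail f) := by
  simp only [transferWord, transferTail, List.ofFn_succ, List.prod_cons, mul_assoc]
  rfl

theorem transferTail_zero (f : Fin 1 → Module.End k (TensorAlgebra k A)) :
    transferTail F U f = U ∘ₗ f 0 ∘ₗ F := by
  simp [transferTail]

theorem IsSpecialRetraction.isTail_transferTail (h : IsSpecialRetraction 𝒜 ℬ g F F' U) {n : ℕ}
    {f : Fin (n + 1) → Module.End k (TensorAlgebra k A)} {a : Fin (n + 1) → Γ}
    (hf : ∀ i, f i ∈ Coder 𝒜 g (a i)) :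
    IsTail 𝒜 g F U (g.par (∑ i, (a i - g.e))) (transferTail F U f) ∧
      IsHomog ℬ 𝒜 (∑ i, (a i - g.e)) (transferTail F U f) := by
  have he : ∀ c, g.par (c - g.e) = 1 + g.par c := fun c => by
    rw [map_sub, g.par_e, CharTwo.sub_eq_add, add_comm]
  induction n with
  | zero =>
    rw [transferTail_zero, Fin.sum_univ_one, he]
    refine ⟨h.isTail_last (hf 0), ?_⟩
    have := h.U_homog.comp ((hf 0).1.comp h.F_homog)
    rwa [add_zero, add_comm, ← sub_eq_add_neg] at this
  | succ n ih =>
    obtain ⟨h1, h2⟩ := ih (f := Fin.tail f) (a := Fin.tail a) fun i => hf i.succ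
    rw [transferTail_succ, Fin.sum_univ_succ, map_add, he]
    refine ⟨h.isTail_cons (hf 0) h1, ?_⟩
    have := h.U_homog.comp ((hf 0).1.comp h2)
    rwa [← add_assoc, add_comm (-g.e), ← sub_eq_add_neg] at this

variable [DirectSum.Decomposition ℬ]

/-- There is one letter more than there are copies of `U`; pairing every letter with a `-e` leaves
one `e` over, whence the form of the degree. -/
theorem IsSpecialRetraction.transferWord_mem (h : IsSpecialRetraction 𝒜 ℬ g F F' U) {n : ℕ}
    {f : Fin (n + 1) → Module.End k (TensorAlgebra k A)} {a : Fin (n + 1) → Γ}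
    (hf : ∀ i, f i ∈ Coder 𝒜 g (a i)) :
    transferWord F F' U f ∈ Coder ℬ g (g.e + ∑ i, (a i - g.e)) := by
  cases n with
  | zero =>
    rw [transferWord_zero, Fin.sum_univ_one, add_sub_cancel]
    refine ⟨?_, h.comul_single (hf 0)⟩
    have := h.F'_homog.comp ((hf 0).1.comp h.F_homog)
    rwa [add_zero, zero_add] at this
  | succ n =>
    obtain ⟨h1, h2⟩ := h.isTail_transferTail (f := Fin.tail f) (a := Fin.tail a) fun i => hf i.succ
    rw [transferWord_succ, Fin.sum_univ_succ, ← add_assoc, add_sub_cancel]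
    refine ⟨?_, ?_⟩
    · have := h.F'_homog.comp ((hf 0).1.comp h2)
      rwa [zero_add] at this
    · rw [map_add]
      exact h.comul_of_isTail (hf 0) h1

theorem IsRecursiveRetraction.isSpecialRetraction {X : AInftyAlgebra 𝒜 g} {π : A →ₗ[k] B}
    {G : A →ₗ[k] A} (h : IsRecursiveRetraction X F π G F' U) (hF : IsCoalgMorphism 𝒜 ℬ F)
    (hp : IsPropagator 𝒜 ℬ g (lin₁ X.diff) (lin₁ F) π G) :
    IsSpecialRetraction 𝒜 ℬ g F F' U where
  F_homog := hF.homog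
  F'_homog := h.isHomog_F' hF hp.homog_π hp.homog_G
  U_homog := h.isHomog_U hF hp.homog_π hp.homog_G
  F_comul := hF.comul
  F'_comul := h.F'_comul
  U_comul := h.U_comul
  F'_F := LinearMap.congr_fun (h.retract hF hp).1
  U_F := LinearMap.congr_fun (h.retract hF hp).2
  F'_U := LinearMap.congr_fun (h.side_conditions hF hp).1
  U_U := LinearMap.congr_fun (h.side_conditions hF hp).2

end TransferWord

/-! ### Koszul signs of lists -/

section Signs

variable {k : Type*} [Field k] {α : Type*} [LinearOrder α]

theorem ksign_mul_self (a : ZMod 2) : ksign k a * ksign k a = 1 := by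
  rw [← ksign_add, CharTwo.add_self_eq_zero, ksign_zero]

variable (k) in
/-- The Koszul sign contributed by the pair `a`, `b` to an arrangement in which `a` precedes `b`. -/
def pairSign (p : α → ZMod 2) (a b : α) : k := if b < a then ksign k (p a * p b) else 1

variable (k) in
/-- The Koszul sign of a list, relative to the increasing order. -/
def listSign (p : α → ZMod 2) : List α → k
  | [] => 1
  | a :: l => (l.map (pairSign k p a)).prod * listSign p l

theorem pairSign_mul_self (p : α → ZMod 2) (a b : α) :
    pairSign k p a b * pairSign k p a b = 1 := by
  unfold pairSign; split_ifs <;> simp [ksign_mul_self]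

theorem pairSign_mul_swap (p : α → ZMod 2) {a b : α} (h : a ≠ b) :
    pairSign k p a b * pairSign k p b a = ksign k (p a * p b) := by
  unfold pairSign
  rcases lt_or_gt_of_ne h with h | h
  · simp [h, h.not_gt, mul_comm]
  · simp [h, h.not_gt]

theorem list_prod_map_mul {ι M : Type*} [CommMonoid M] (l : List ι) (f f' : ι → M) :
    (l.map fun i => f i * f' i).prod = (l.map f).prod * (l.map f').prod := by
  induction l with
  | nil => simp
  | cons a l ih => simp only [List.map_cons, List.prod_cons, ih]; exact mul_mul_mul_comm _ _ _ _

theorem listSign_append_cons (p : α → ZMod 2) (l₁ l₂ : List α) (a : α) :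
    listSign k p (l₁ ++ a :: l₂) = (l₁.map (pairSign k p · a)).prod *
      (l₂.map (pairSign k p a)).prod * listSign k p (l₁ ++ l₂) := by
  induction l₁ with
  | nil => simp [listSign]
  | cons b l₁ ih =>
    simp only [List.cons_append, listSign, ih, List.map_append, List.map_cons, List.prod_append,
      List.prod_cons]
    ring

theorem listSign_append (p : α → ZMod 2) (l₁ l₂ : List α) :
    listSign k p (l₁ ++ l₂) = (l₁.map fun a => (l₂.map (pairSign k p a)).prod).prod *
      (listSign k p l₁ * listSign k p l₂) := by
  induction l₁ with
  | nil => simp [listSign]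
  | cons a l₁ ih =>
    simp only [List.cons_append, listSign, ih, List.map_append, List.map_cons, List.prod_append,
      List.prod_cons]
    ring

theorem listSign_congr {p p' : α → ZMod 2} {l : List α} (h : ∀ a ∈ l, p a = p' a) :
    listSign k p l = listSign k p' l := by
  induction l with
  | nil => rfl
  | cons a l ih =>
    rw [listSign, listSign, ih fun b hb => h b (List.mem_cons_of_mem _ hb)]
    congr 2
    refine List.map_congr_left fun b hb => ?_
    rw [pairSign, pairSign, h a (by simp), h b (List.mem_cons_of_mem _ hb)]

theorem listSign_of_sorted (p : α → ZMod 2) {l : List α} (h : l.Pairwise (· < ·)) :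
    listSign k p l = 1 := by
  induction h with
  | nil => rfl
  | @cons a l ha _ ih =>
    rw [listSign, ih, mul_one]
    refine List.prod_eq_one fun x hx => ?_
    obtain ⟨b, hb, rfl⟩ := List.mem_map.1 hx
    rw [pairSign, if_neg (ha b hb).not_gt]

theorem listSign_ofFn (p : α → ZMod 2) {m : ℕ} (e : Fin m → α) :
    listSign k p (List.ofFn e) = ∏ q : Fin m × Fin m,
      if q.1 < q.2 then pairSign k p (e q.1) (e q.2) else 1 := by
  induction m with
  | zero => simp [listSign]
  | succ m ih =>
    rw [List.ofFn_succ, listSign, ih, Fintype.prod_prod_type, Fintype.prod_prod_type,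
      Fin.prod_univ_succ]
    congr 1
    · rw [Fin.prod_univ_succ, List.map_ofFn, List.prod_ofFn]
      simp
    · refine Finset.prod_congr rfl fun i _ => ?_
      rw [Fin.prod_univ_succ]
      simp

/-- A symmetric function lives on unordered pairs, which `σ` permutes; each pair is represented by
its increasing order, restored after `σ` is applied. -/
theorem prod_lt_comp_perm {M : Type*} [CommMonoid M] {m : ℕ} (σ : Equiv.Perm (Fin m))
    {f : Fin m → Fin m → M} (hf : ∀ i j, f i j = f j i) :
    (∏ q : Fin m × Fin m, if q.1 < q.2 then f (σ q.1) (σ q.2) else 1) =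
      ∏ q : Fin m × Fin m, if q.1 < q.2 then f q.1 q.2 else 1 := by
  rw [← Finset.prod_filter, ← Finset.prod_filter]
  have aux : ∀ (τ : Equiv.Perm (Fin m)) (q : Fin m × Fin m), q.1 < q.2 →
      (if τ q.1 < τ q.2 then (τ q.1, τ q.2) else (τ q.2, τ q.1)).1 <
        (if τ q.1 < τ q.2 then (τ q.1, τ q.2) else (τ q.2, τ q.1)).2 := by
    intro τ q hq
    split_ifs with h
    · exact h
    · exact lt_of_le_of_ne (not_lt.1 h) (τ.injective.ne hq.ne')
  have aux' : ∀ (τ : Equiv.Perm (Fin m)) (q : Fin m × Fin m), q.1 < q.2 →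
      (if τ.symm (if τ q.1 < τ q.2 then (τ q.1, τ q.2) else (τ q.2, τ q.1)).1 <
          τ.symm (if τ q.1 < τ q.2 then (τ q.1, τ q.2) else (τ q.2, τ q.1)).2 then
        (τ.symm (if τ q.1 < τ q.2 then (τ q.1, τ q.2) else (τ q.2, τ q.1)).1,
          τ.symm (if τ q.1 < τ q.2 then (τ q.1, τ q.2) else (τ q.2, τ q.1)).2)
      else (τ.symm (if τ q.1 < τ q.2 then (τ q.1, τ q.2) else (τ q.2, τ q.1)).2,
        τ.symm (if τ q.1 < τ q.2 then (τ q.1, τ q.2) else (τ q.2, τ q.1)).1)) = q := by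
    intro τ q hq
    by_cases h : τ q.1 < τ q.2
    · simp [h, hq]
    · simp [h, hq.not_gt]
  refine Finset.prod_bij' (fun q _ => if σ q.1 < σ q.2 then (σ q.1, σ q.2) else (σ q.2, σ q.1))
    (fun q _ => if σ.symm q.1 < σ.symm q.2 then (σ.symm q.1, σ.symm q.2)
      else (σ.symm q.2, σ.symm q.1)) ?_ ?_ ?_ ?_ ?_
  · intro q hq
    simp only [Finset.mem_filter, Finset.mem_univ, true_and] at hq ⊢
    exact aux σ q hq
  · intro q hq
    simp only [Finset.mem_filter, Finset.mem_univ, true_and] at hq ⊢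
    exact aux σ.symm q hq
  · intro q hq
    simp only [Finset.mem_filter, Finset.mem_univ, true_and] at hq
    exact aux' σ q hq
  · intro q hq
    simp only [Finset.mem_filter, Finset.mem_univ, true_and] at hq
    exact aux' σ.symm q hq
  · intro q _
    split_ifs
    · rfl
    · exact hf _ _

/-- The sign of a rearrangement of an enumeration `e`, as a quotient of signs of lists. -/
theorem prod_perm_eq_listSign (p : α → ZMod 2) {m : ℕ} {e : Fin m → α}
    (he : Function.Injective e) (σ : Equiv.Perm (Fin m)) :
    (∏ q : Fin m × Fin m, if q.1 < q.2 ∧ σ q.2 < σ q.1 then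
      ksign k (p (e (σ q.1)) * p (e (σ q.2))) else 1) =
      listSign k p (List.ofFn (e ∘ σ)) * listSign k p (List.ofFn e) := by
  rw [listSign_ofFn, listSign_ofFn]
  -- Each pair of indices is oriented by its place in the enumeration `e`. The sign of the list `e`
  -- thereby becomes a product over unordered pairs, which may be reindexed by `σ` and compared
  -- factor by factor.
  let f : Fin m → Fin m → k := fun i j =>
    if i < j then pairSign k p (e i) (e j) else pairSign k p (e j) (e i)
  have hf : ∀ i j, f i j = f j i := by
    intro i j
    rcases lt_trichotomy i j with h | rfl | h
    · simp [f, h, h.not_gt]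
    · rfl
    · simp [f, h, h.not_gt]
  have h1 : (∏ q : Fin m × Fin m, if q.1 < q.2 then pairSign k p (e q.1) (e q.2) else 1) =
      ∏ q : Fin m × Fin m, if q.1 < q.2 then f q.1 q.2 else 1 := by
    refine Finset.prod_congr rfl fun q _ => ?_
    by_cases h : q.1 < q.2 <;> simp [f, h]
  rw [h1, ← prod_lt_comp_perm σ hf, ← Finset.prod_mul_distrib]
  refine Finset.prod_congr rfl fun q _ => ?_
  by_cases h : q.1 < q.2
  · have hne : σ q.1 ≠ σ q.2 := σ.injective.ne h.ne
    rcases lt_or_gt_of_ne hne with h' | h'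
    · simp [f, h, h', h'.not_gt, pairSign_mul_self]
    · simp [f, h, h', h'.not_gt, pairSign_mul_swap p (he.ne hne)]
  · simp [h]

end Signs

/-! ### Sums over arrangements -/

section Arrangements

variable {α : Type*}

/-- The decompositions `l = l₁ ++ l₂`. -/
def cuts₀ : List α → List (List α × List α)
  | [] => [([], [])]
  | a :: l => ([], a :: l) :: (cuts₀ l).map fun q => (a :: q.1, q.2)

/-- The decompositions `l = l₁ ++ a :: l₂`. -/
def cuts₁ : List α → List (List α × α × List α)
  | [] => []
  | a :: l => ([], a, l) :: (cuts₁ l).map fun q => (a :: q.1, q.2)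

/-- The decompositions `l = l₁ ++ a :: b :: l₂`. -/
def cuts₂ : List α → List (List α × α × α × List α)
  | [] => []
  | [_] => []
  | a :: b :: l => ([], a, b, l) :: (cuts₂ (b :: l)).map fun q => (a :: q.1, q.2)

theorem mem_cuts₀ {l : List α} {q : List α × List α} : q ∈ cuts₀ l ↔ l = q.1 ++ q.2 := by
  induction l generalizing q with
  | nil => rcases q with ⟨q₁, q₂⟩; simp [cuts₀]
  | cons a l ih =>
    rcases q with ⟨_ | ⟨b, q₁⟩, q₂⟩
    · simp [cuts₀, eq_comm]
    · simp [cuts₀, ih, eq_comm, and_comm]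

theorem mem_cuts₁ {l : List α} {q : List α × α × List α} :
    q ∈ cuts₁ l ↔ l = q.1 ++ q.2.1 :: q.2.2 := by
  induction l generalizing q with
  | nil => simp [cuts₁]
  | cons a l ih =>
    rcases q with ⟨_ | ⟨b, q₁⟩, q₂, q₃⟩
    · simp [cuts₁, eq_comm]
    · simp [cuts₁, ih, eq_comm, and_comm]

theorem mem_cuts₂ {l : List α} {q : List α × α × α × List α} :
    q ∈ cuts₂ l ↔ l = q.1 ++ q.2.1 :: q.2.2.1 :: q.2.2.2 := by
  induction l generalizing q with
  | nil => simp [cuts₂]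
  | cons a l ih =>
    rcases l with _ | ⟨b, l⟩
    · rcases q with ⟨_ | ⟨b, q₁⟩, q₂, q₃, q₄⟩ <;> simp [cuts₂]
    · rcases q with ⟨_ | ⟨c, q₁⟩, q₂, q₃, q₄⟩
      · simp [cuts₂, eq_comm]
      · simp [cuts₂, ih, eq_comm, and_comm]

theorem nodup_cuts₀ (l : List α) : (cuts₀ l).Nodup := by
  induction l with
  | nil => simp [cuts₀]
  | cons a l ih =>
    refine List.nodup_cons.2 ⟨by simp, ih.map fun q q' h => ?_⟩
    simpa [Prod.ext_iff] using h

theorem nodup_cuts₁ (l : List α) : (cuts₁ l).Nodup := by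
  induction l with
  | nil => simp [cuts₁]
  | cons a l ih =>
    refine List.nodup_cons.2 ⟨by simp, ih.map fun q q' h => ?_⟩
    simpa [Prod.ext_iff] using h

theorem nodup_cuts₂ (l : List α) : (cuts₂ l).Nodup := by
  induction l with
  | nil => simp [cuts₂]
  | cons a l ih =>
    rcases l with _ | ⟨b, l⟩
    · simp [cuts₂]
    · refine List.nodup_cons.2 ⟨by simp, ih.map fun q q' h => ?_⟩
      simpa [Prod.ext_iff] using h

variable [DecidableEq α] {M : Type*} [AddCommMonoid M]

/-- The arrangements of the elements of `S` in a list. -/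
def orderings (S : Finset α) : Finset (List α) := S.val.lists.toFinset

theorem mem_orderings {S : Finset α} {l : List α} : l ∈ orderings S ↔ S.val = l := by
  rw [orderings, Multiset.mem_toFinset, Multiset.mem_lists_iff]; rfl

theorem mem_orderings' {S : Finset α} {l : List α} :
    l ∈ orderings S ↔ l.Nodup ∧ ∀ a, a ∈ l ↔ a ∈ S := by
  rw [mem_orderings]
  constructor
  · intro h
    refine ⟨?_, fun a => ?_⟩
    · rw [← Multiset.coe_nodup, ← h]; exact S.nodup
    · rw [← Multiset.mem_coe, ← h]; rfl
  · rintro ⟨h1, h2⟩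
    exact (Multiset.Nodup.ext S.nodup (Multiset.coe_nodup.2 h1)).2 fun a => by
      rw [Multiset.mem_coe, h2]; rfl

/-- The arrangements of the elements of `S` in two lists. -/
def splittings (S : Finset α) : Finset (List α × List α) :=
  (orderings S).biUnion fun l => (cuts₀ l).toFinset

theorem mem_splittings {S : Finset α} {q : List α × List α} :
    q ∈ splittings S ↔ q.1 ++ q.2 ∈ orderings S := by
  simp [splittings, mem_cuts₀]

theorem sum_orderings_cuts₀ (S : Finset α) (f : List α × List α → M) :
    ∑ l ∈ orderings S, ((cuts₀ l).map f).sum = ∑ q ∈ splittings S, f q := by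
  rw [splittings, Finset.sum_biUnion]
  · exact Finset.sum_congr rfl fun l _ => (List.sum_toFinset f (nodup_cuts₀ l)).symm
  · intro l _ l' _ h
    refine Finset.disjoint_left.2 fun q hq hq' => h ?_
    rw [List.mem_toFinset, mem_cuts₀] at hq hq'
    rw [hq, hq']

theorem sum_splittings_univ [Fintype α] (f : List α × List α → M) :
    ∑ q ∈ splittings (Finset.univ : Finset α), f q =
      ∑ S : Finset α, ∑ l₁ ∈ orderings S, ∑ l₂ ∈ orderings Sᶜ, f (l₁, l₂) := by
  simp only [← Finset.sum_product']
  rw [Finset.sum_sigma']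
  refine Finset.sum_bij' (fun q _ => (⟨q.1.toFinset, q⟩ : Σ _ : Finset α, List α × List α))
    (fun x _ => x.2) ?_ ?_ ?_ ?_ ?_
  · rintro ⟨l₁, l₂⟩ h
    rw [mem_splittings, mem_orderings'] at h
    obtain ⟨h1, h2⟩ := h
    obtain ⟨n1, n2, h3⟩ := List.nodup_append'.1 h1
    simp only [Finset.mem_sigma, Finset.mem_univ, true_and, Finset.mem_product, mem_orderings',
      List.mem_toFinset, Finset.mem_compl, implies_true, and_true, n1, n2]
    intro a
    have := h2 a
    simp only [List.mem_append, Finset.mem_univ, iff_true] at this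
    exact ⟨fun h h' => h3 h' h, fun h => this.resolve_left h⟩
  · rintro ⟨S, l₁, l₂⟩ h
    simp only [Finset.mem_sigma, Finset.mem_univ, true_and, Finset.mem_product, mem_orderings',
      Finset.mem_compl] at h
    rw [mem_splittings, mem_orderings']
    refine ⟨List.nodup_append'.2 ⟨h.1.1, h.2.1, fun a ha ha' => ?_⟩, fun a => ?_⟩
    · exact (h.2.2 a).1 ha' ((h.1.2 a).1 ha)
    · simp [h.1.2, h.2.2, em]
  · intro q _; rfl
  · rintro ⟨S, l₁, l₂⟩ h
    simp only [Finset.mem_sigma, Finset.mem_univ, true_and, Finset.mem_product, mem_orderings'] at h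
    have : l₁.toFinset = S := by ext a; simp [h.1.2]
    simp [this]
  · intro q _; rfl

theorem append_cons_mem_orderings {S : Finset α} {l₁ l₂ : List α} {a : α} :
    l₁ ++ a :: l₂ ∈ orderings S ↔ a ∈ S ∧ l₁ ++ l₂ ∈ orderings (S.erase a) := by
  rw [mem_orderings, mem_orderings, Finset.erase_val]
  have h : ((l₁ ++ a :: l₂ : List α) : Multiset α) = a ::ₘ ((l₁ ++ l₂ : List α) : Multiset α) := by
    rw [Multiset.cons_coe, Multiset.coe_eq_coe]; exact List.perm_middle
  rw [h]
  constructor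
  · intro h1
    have h2 : a ∈ S := by rw [← Finset.mem_val, h1]; simp
    refine ⟨h2, ?_⟩
    rw [h1, Multiset.erase_cons_head]
  · rintro ⟨h1, h2⟩
    rw [← h2, Multiset.cons_erase h1]

theorem sum_orderings_cuts₁ (S : Finset α) (f : List α × α × List α → M) :
    ∑ l ∈ orderings S, ((cuts₁ l).map f).sum =
      ∑ a ∈ S, ∑ q ∈ splittings (S.erase a), f (q.1, a, q.2) := by
  have h1 : ∀ l, ((cuts₁ l).map f).sum = ∑ q ∈ (cuts₁ l).toFinset, f q := fun l =>
    (List.sum_toFinset f (nodup_cuts₁ l)).symm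
  simp only [h1]
  rw [Finset.sum_sigma', Finset.sum_sigma']
  refine Finset.sum_bij' (fun x _ => ⟨x.2.2.1, (x.2.1, x.2.2.2)⟩)
    (fun x _ => ⟨x.2.1 ++ x.1 :: x.2.2, (x.2.1, x.1, x.2.2)⟩) ?_ ?_ ?_ ?_ ?_
  · rintro ⟨l, l₁, a, l₂⟩ h
    simp only [Finset.mem_sigma, List.mem_toFinset, mem_cuts₁, mem_splittings] at h ⊢
    rw [h.2, append_cons_mem_orderings] at h
    exact h.1
  · rintro ⟨a, l₁, l₂⟩ h
    simp only [Finset.mem_sigma, List.mem_toFinset, mem_cuts₁, mem_splittings] at h ⊢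
    exact ⟨append_cons_mem_orderings.2 h, trivial⟩
  · rintro ⟨l, l₁, a, l₂⟩ h
    simp only [Finset.mem_sigma, List.mem_toFinset, mem_cuts₁] at h ⊢
    rw [h.2]
  · rintro ⟨a, l₁, l₂⟩ h; rfl
  · rintro ⟨l, l₁, a, l₂⟩ h; rfl

theorem sum_orderings_cuts₂ (S : Finset α) (f : List α × α × α × List α → M) :
    ∑ l ∈ orderings S, ((cuts₂ l).map f).sum =
      ∑ a ∈ S, ∑ b ∈ S.erase a, ∑ q ∈ splittings ((S.erase a).erase b), f (q.1, a, b, q.2) := by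
  have h1 : ∀ l, ((cuts₂ l).map f).sum = ∑ q ∈ (cuts₂ l).toFinset, f q := fun l =>
    (List.sum_toFinset f (nodup_cuts₂ l)).symm
  simp only [h1]
  simp only [Finset.sum_sigma']
  refine Finset.sum_bij' (fun x _ => ⟨x.2.2.1, x.2.2.2.1, (x.2.1, x.2.2.2.2)⟩)
    (fun x _ => ⟨x.2.2.1 ++ x.1 :: x.2.1 :: x.2.2.2, (x.2.2.1, x.1, x.2.1, x.2.2.2)⟩) ?_ ?_ ?_ ?_ ?_
  · rintro ⟨l, l₁, a, b, l₂⟩ h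
    simp only [Finset.mem_sigma, List.mem_toFinset, mem_cuts₂, mem_splittings] at h ⊢
    rw [h.2, append_cons_mem_orderings, append_cons_mem_orderings] at h
    exact h.1
  · rintro ⟨a, b, l₁, l₂⟩ h
    simp only [Finset.mem_sigma, List.mem_toFinset, mem_cuts₂, mem_splittings] at h ⊢
    exact ⟨append_cons_mem_orderings.2 ⟨h.1, append_cons_mem_orderings.2 h.2⟩, trivial⟩
  · rintro ⟨l, l₁, a, b, l₂⟩ h
    simp only [Finset.mem_sigma, List.mem_toFinset, mem_cuts₂] at h ⊢
    rw [h.2]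
  · rintro ⟨a, b, l₁, l₂⟩ h; rfl
  · rintro ⟨l, l₁, a, b, l₂⟩ h; rfl

theorem sum_orderings_insert {S : Finset α} {a : α} (ha : a ∉ S) (f : List α → M) :
    ∑ l ∈ orderings (insert a S), f l = ∑ q ∈ splittings S, f (q.1 ++ a :: q.2) := by
  symm
  refine Finset.sum_bij (fun q _ => q.1 ++ a :: q.2) ?_ ?_ ?_ fun _ _ => rfl
  · intro q hq
    rw [mem_splittings] at hq
    rw [append_cons_mem_orderings, Finset.erase_insert ha]
    exact ⟨Finset.mem_insert_self _ _, hq⟩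
  · rintro ⟨l₁, l₂⟩ hq ⟨m₁, m₂⟩ hq' h
    rw [mem_splittings, mem_orderings'] at hq hq'
    have h1 : a ∉ l₁ ++ l₂ := fun h => ha ((hq.2 a).1 h)
    have h2 : a ∉ m₁ ++ m₂ := fun h => ha ((hq'.2 a).1 h)
    simp only [List.mem_append, not_or] at h1 h2
    dsimp only at h
    clear hq hq'
    induction l₁ generalizing m₁ with
    | nil =>
      cases m₁ with
      | nil => simpa using h
      | cons b m₁ =>
        simp only [List.nil_append, List.cons_append, List.cons.injEq] at h
        simp [h.1] at h2
    | cons b l₁ ih =>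
      cases m₁ with
      | nil =>
        simp only [List.nil_append, List.cons_append, List.cons.injEq] at h
        simp [h.1] at h1
      | cons c m₁ =>
        simp only [List.cons_append, List.cons.injEq] at h
        have := ih m₁ h.2 (by simp at h1; tauto) (by simp at h2; tauto)
        simp only [Prod.mk.injEq] at this
        simp [h.1, this.1, this.2]
  · intro l hl
    have : a ∈ l := ((mem_orderings'.1 hl).2 a).2 (Finset.mem_insert_self _ _)
    obtain ⟨l₁, l₂, rfl⟩ := List.append_of_mem this
    refine ⟨(l₁, l₂), ?_, rfl⟩
    rw [append_cons_mem_orderings, Finset.erase_insert ha] at hl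
    exact mem_splittings.2 hl.2

/-- Summation over the rearrangements of an enumeration of `S`. -/
theorem sum_perm_ofFn {m : ℕ} {e : Fin m → α} (he : Function.Injective e) {S : Finset α}
    (hS : ∀ a, a ∈ S ↔ ∃ i, e i = a) (f : List α → M) :
    ∑ σ : Equiv.Perm (Fin m), f (List.ofFn (e ∘ σ)) = ∑ l ∈ orderings S, f l := by
  refine Finset.sum_bij (fun σ _ => List.ofFn (e ∘ σ)) ?_ ?_ ?_ fun _ _ => rfl
  · intro σ _
    rw [mem_orderings', List.nodup_ofFn]
    refine ⟨he.comp σ.injective, fun a => ?_⟩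
    rw [List.mem_ofFn, hS]
    constructor
    · rintro ⟨i, rfl⟩; exact ⟨σ i, rfl⟩
    · rintro ⟨i, rfl⟩; exact ⟨σ.symm i, by simp⟩
  · intro σ _ τ _ h
    ext i
    have h1 := congrFun (List.ofFn_injective h) i
    exact congrArg Fin.val (he h1)
  · intro l hl
    have hlen : l.length = m := by
      have h1 := congrArg Multiset.card (mem_orderings.1 hl)
      have h2 : S = Finset.univ.map ⟨e, he⟩ := by ext a; simp [hS]
      rw [Multiset.coe_card] at h1
      rw [← h1, Finset.card_val, h2, Finset.card_map, Finset.card_univ, Fintype.card_fin]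
    subst hlen
    obtain ⟨h1, h2⟩ := mem_orderings'.1 hl
    choose t ht using fun i => (hS (l.get i)).1 ((h2 _).1 (List.get_mem l i))
    have hinj : Function.Injective t := fun i j h => by
      refine (List.nodup_iff_injective_get.1 h1) ?_
      rw [← ht, ← ht, h]
    refine ⟨Equiv.ofBijective t (Finite.injective_iff_bijective.1 hinj), Finset.mem_univ _, ?_⟩
    have h3 : e ∘ (Equiv.ofBijective t (Finite.injective_iff_bijective.1 hinj)) = l.get := by
      ext i; exact ht i
    rw [h3, List.ofFn_get]

end Arrangements

/-! ### Alternating words in a homotopy -/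

section HomotopyWord

variable {k : Type*} [Field k] {R : Type*} [Ring R] [Algebra k R]

/-- The word `(-1)^n X₀ U X₁ U ⋯ U Xₙ`, and `0` for the empty list. -/
def homotopyWord (U : R) : List R → R
  | [] => 0
  | X :: l => X * (l.map fun Y => -(U * Y)).prod

variable (U : R)

theorem homotopyWord_cons_of_ne_nil (X : R) {l : List R} (h : l ≠ []) :
    homotopyWord U (X :: l) = -(X * U * homotopyWord U l) := by
  cases l with
  | nil => exact absurd rfl h
  | cons Y l => simp [homotopyWord, mul_assoc]

theorem homotopyWord_cons (X : R) (l : List R) :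
    homotopyWord U (X :: l) = (if l = [] then X else 0) - X * U * homotopyWord U l := by
  split_ifs with h
  · subst h; simp [homotopyWord]
  · rw [homotopyWord_cons_of_ne_nil U X h, zero_sub]

theorem homotopyWord_append_add (l₁ l₂ : List R) (X Y : R) :
    homotopyWord U (l₁ ++ (X + Y) :: l₂) =
      homotopyWord U (l₁ ++ X :: l₂) + homotopyWord U (l₁ ++ Y :: l₂) := by
  cases l₁ with
  | nil => simp [homotopyWord, add_mul]
  | cons Z l₁ => simp [homotopyWord, add_mul, mul_add]; abel

theorem homotopyWord_append_smul (l₁ l₂ : List R) (c : k) (X : R) :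
    homotopyWord U (l₁ ++ (c • X) :: l₂) = c • homotopyWord U (l₁ ++ X :: l₂) := by
  cases l₁ with
  | nil => simp [homotopyWord]
  | cons Z l₁ => simp [homotopyWord, ← smul_neg]

theorem homotopyWord_ofFn {n : ℕ} (f : Fin (n + 1) → R) :
    homotopyWord U (List.ofFn f) =
      (-1 : k) ^ n • ((List.ofFn fun i : Fin n => f i.castSucc * U).prod * f (Fin.last n)) := by
  induction n with
  | zero => simp [homotopyWord]
  | succ n ih =>
    rw [List.ofFn_succ, homotopyWord_cons_of_ne_nil U _ (by simp), ih, List.ofFn_succ,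
      List.prod_cons, pow_succ]
    simp [mul_assoc]

variable (k) in
/-- The product of the signs of the entries of a list. -/
def parityProd {α : Type*} (p : α → ZMod 2) (l : List α) : k := (l.map fun a => ksign k (p a)).prod

/-- Applying a differential to alternating words. -/
theorem homotopyWord_differential {α : Type*} (p : α → ZMod 2) (X : α → R) {d Φ U : R}
    (h : 1 - Φ = d * U + U * d) (l : List α) :
    d * homotopyWord U (l.map X) + parityProd k p l • (homotopyWord U (l.map X) * d)
      + ((cuts₀ l).map fun q => parityProd k p q.1 •
          (homotopyWord U (q.1.map X) * Φ * homotopyWord U (q.2.map X))).sum =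
    ((cuts₁ l).map fun q => parityProd k p q.1 • homotopyWord U (q.1.map X ++
        (d * X q.2.1 + ksign k (p q.2.1) • (X q.2.1 * d)) :: q.2.2.map X)).sum
      + ((cuts₂ l).map fun q => parityProd k p q.1 • homotopyWord U (q.1.map X ++
        (ksign k (p q.2.1) • (X q.2.1 * X q.2.2.1)) :: q.2.2.2.map X)).sum := by
  have hΦ : Φ = 1 - (d * U + U * d) := by rw [← h]; abel
  induction l with
  | nil => simp [cuts₀, cuts₁, cuts₂, homotopyWord]
  | cons x l ih =>
    cases l with
    | nil => simp [cuts₀, cuts₁, cuts₂, homotopyWord, parityProd]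
    | cons y l =>
      -- Among the cuts with a nonempty left part, the one directly after `x` gives `X x Φ W`. The
      -- others come from cuts of the tail with `-X x U` in front.
      have e₀ : ((cuts₀ (y :: l)).map fun q => parityProd k p (x :: q.1) •
          (homotopyWord U ((x :: q.1).map X) * Φ * homotopyWord U (q.2.map X))).sum =
          ksign k (p x) • (X x * Φ * homotopyWord U ((y :: l).map X)) -
          ksign k (p x) • (X x * U * ((cuts₀ (y :: l)).map fun q => parityProd k p q.1 •
          (homotopyWord U (q.1.map X) * Φ * homotopyWord U (q.2.map X))).sum) := by
        have : ∀ q : List α × List α, parityProd k p (x :: q.1) •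
          (homotopyWord U ((x :: q.1).map X) * Φ * homotopyWord U (q.2.map X)) =
          ksign k (p x) • (if q.1 = [] then X x * Φ * homotopyWord U (q.2.map X) else 0) +
          -(ksign k (p x) • (X x * U)) * (parityProd k p q.1 •
            (homotopyWord U (q.1.map X) * Φ * homotopyWord U (q.2.map X))) := by
          rintro ⟨q₁, q₂⟩
          rw [List.map_cons, homotopyWord_cons]
          by_cases hq : q₁ = []
          · subst hq; simp [parityProd, homotopyWord]
          · simp [hq, parityProd, mul_smul, mul_assoc, smul_comm (ksign k (p x))]
        simp only [this, List.sum_map_add, List.sum_map_mul_left]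
        have h2 : ((cuts₀ (y :: l)).map fun q : List α × List α => ksign k (p x) •
            (if q.1 = [] then X x * Φ * homotopyWord U (q.2.map X) else 0)).sum =
            ksign k (p x) • (X x * Φ * homotopyWord U ((y :: l).map X)) := by
          simp [cuts₀, Function.comp_def]
        rw [h2, neg_mul, ← sub_eq_add_neg, smul_mul_assoc]
      have e₁ : ∀ (c : k) (q₁ q₂ : List α) (Y : R), (ksign k (p x) * c) •
          homotopyWord U (X x :: (q₁.map X ++ Y :: q₂.map X)) =
          -(ksign k (p x) • (X x * U)) * (c • homotopyWord U (q₁.map X ++ Y :: q₂.map X)) := by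
        intro c q₁ q₂ Y
        rw [homotopyWord_cons_of_ne_nil U _ (by simp)]
        simp [mul_smul, smul_comm c]
      have e₂ : ∀ q : List α, parityProd k p (x :: q) = ksign k (p x) * parityProd k p q :=
        fun q => by simp [parityProd]
      rw [cuts₀, cuts₁, cuts₂]
      simp only [List.map_cons, List.sum_cons, List.map_map, Function.comp_def] at e₀ ⊢
      rw [e₀]
      simp only [e₂, List.cons_append, e₁, List.sum_map_mul_left]
      set S₀ := ((cuts₀ (y :: l)).map fun q => parityProd k p q.1 •
          (homotopyWord U (q.1.map X) * Φ * homotopyWord U (q.2.map X))).sum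
      set S₁ := ((cuts₁ (y :: l)).map fun q => parityProd k p q.1 • homotopyWord U (q.1.map X ++
        (d * X q.2.1 + ksign k (p q.2.1) • (X q.2.1 * d)) :: q.2.2.map X)).sum
      set S₂ := ((cuts₂ (y :: l)).map fun q => parityProd k p q.1 • homotopyWord U (q.1.map X ++
        (ksign k (p q.2.1) • (X q.2.1 * X q.2.2.1)) :: q.2.2.2.map X)).sum
      have ih' : S₀ = S₁ + S₂ - d * homotopyWord U ((y :: l).map X) -
          parityProd k p (y :: l) • (homotopyWord U ((y :: l).map X) * d) := by
        rw [← ih]; abel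
      have e₃ : homotopyWord U ([] ++ (ksign k (p x) • (X x * X y)) :: l.map X) =
          ksign k (p x) • (X x * homotopyWord U ((y :: l).map X)) := by
        simp [homotopyWord, mul_assoc]
      -- After `Φ = 1 - d U - U d` is substituted in the head term, the `1` merges the first two
      -- letters, `-d U` completes the commutator of `d` with the first letter, and `-U d` cancels
      -- the term with `d` in front of the tail in the induction hypothesis.
      rw [← List.map_cons, List.map_nil, e₃, ih', List.nil_append,
        homotopyWord_cons_of_ne_nil U _ (by simp),
        homotopyWord_cons_of_ne_nil U _ (by simp), hΦ]
      have e₄ : parityProd k p (y :: l) = ksign k (p y) * parityProd k p l := by simp [parityProd]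
      rw [e₄]
      set W := homotopyWord U ((y :: l).map X)
      simp only [List.map_nil, homotopyWord, zero_mul, smul_zero, zero_add, parityProd,
        List.prod_nil, one_smul]
      simp only [mul_add, add_mul, mul_sub, sub_mul, neg_mul, mul_neg, mul_one, smul_add,
        smul_sub, smul_neg, smul_mul_assoc, mul_smul_comm, mul_assoc, mul_smul]
      abel

end HomotopyWord

/-! ### Symmetrised words -/

section SymmetrizedWord

variable {k : Type*} [Field k]

theorem prod_eq_of_mem_orderings {α M : Type*} [DecidableEq α] [CommMonoid M] {T : Finset α}
    {l : List α} (h : l ∈ orderings T) (f : α → M) : ∏ b ∈ T, f b = (l.map f).prod := by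
  rw [Finset.prod, mem_orderings.1 h, Multiset.map_coe, Multiset.prod_coe]

theorem list_prod_mul_prod_of_eq {ι : Type*} {l : List ι} {f f' h h' : ι → k}
    (H : ∀ b ∈ l, f b * f' b = h b * h' b) :
    (l.map f).prod * (l.map f').prod = (l.map h).prod * (l.map h').prod := by
  rw [← list_prod_map_mul, ← list_prod_map_mul, List.map_congr_left H]

theorem ofFn_orderEmb_mem_orderings {n : ℕ} (T : Finset (Fin n)) :
    List.ofFn (T.orderEmbOfFin rfl) ∈ orderings T := by
  rw [mem_orderings', List.nodup_ofFn]
  refine ⟨(T.orderEmbOfFin rfl).injective, fun a => ?_⟩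
  rw [List.mem_ofFn, ← Set.mem_range, Finset.range_orderEmbOfFin, Finset.mem_coe]

theorem pairwise_ofFn_orderEmb {n : ℕ} (T : Finset (Fin n)) :
    (List.ofFn (T.orderEmbOfFin rfl)).Pairwise (· < ·) :=
  List.pairwise_ofFn.2 fun _ _ h => (T.orderEmbOfFin rfl).strictMono h

variable {R : Type*} [Ring R] [Algebra k R] {M : Type*} [AddCommGroup M] [Module k M]
  (θ : R →ₗ[k] M) (U : R)

/-- The sum, with Koszul signs, over the rearrangements of a word. -/
def symWord {n : ℕ} (p : Fin n → ZMod 2) (X : Fin n → R) : M :=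
  ∑ σ : Equiv.Perm (Fin n), (∏ q : Fin n × Fin n,
    if q.1 < q.2 ∧ σ q.2 < σ q.1 then ksign k (p (σ q.1) * p (σ q.2)) else 1) •
      θ (homotopyWord U (List.ofFn (X ∘ σ)))

theorem symWord_zero (p : Fin 0 → ZMod 2) (X : Fin 0 → R) : symWord θ U p X = 0 := by
  simp [symWord, homotopyWord]

/-- The order on the labels gives every arrangement an absolute sign, and the Koszul sign of a
permutation is the ratio of two such signs. The sum then depends on the enumeration only through one
overall sign, so sums over different subsets can be compared. -/
theorem symWord_comp {α : Type*} [LinearOrder α] {n : ℕ} (p : α → ZMod 2) (X : α → R)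
    {e : Fin n → α} (he : Function.Injective e) {S : Finset α} (hS : ∀ a, a ∈ S ↔ ∃ i, e i = a) :
    symWord θ U (p ∘ e) (X ∘ e) = listSign k p (List.ofFn e) •
      ∑ l ∈ orderings S, listSign k p l • θ (homotopyWord U (l.map X)) := by
  rw [← sum_perm_ofFn he hS, Finset.smul_sum, symWord]
  refine Finset.sum_congr rfl fun σ _ => ?_
  rw [smul_smul, List.map_ofFn, mul_comm, ← prod_perm_eq_listSign p he σ]
  rfl

theorem symWord_eq {n : ℕ} (p : Fin n → ZMod 2) (X : Fin n → R) :
    symWord θ U p X =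
      ∑ l ∈ orderings Finset.univ, listSign k p l • θ (homotopyWord U (l.map X)) := by
  have h := symWord_comp θ U p X (e := id) Function.injective_id (S := Finset.univ) (by simp)
  have h2 : (List.ofFn (id : Fin n → Fin n)).Pairwise (· < ·) :=
    List.pairwise_ofFn.2 fun _ _ h => h
  rwa [listSign_of_sorted p h2, one_smul] at h

theorem symWord_perm {n : ℕ} (p : Fin n → ZMod 2) (X : Fin n → R) (σ : Equiv.Perm (Fin n)) :
    symWord θ U (p ∘ σ) (X ∘ σ) = (∏ q : Fin n × Fin n,
      if q.1 < q.2 ∧ σ q.2 < σ q.1 then ksign k (p (σ q.1) * p (σ q.2)) else 1) •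
        symWord θ U p X := by
  have h := prod_perm_eq_listSign (k := k) p (e := id) Function.injective_id σ
  have h2 : (List.ofFn (id : Fin n → Fin n)).Pairwise (· < ·) :=
    List.pairwise_ofFn.2 fun _ _ h => h
  rw [listSign_of_sorted p h2, mul_one] at h
  simp only [id_eq] at h
  rw [h, symWord_eq θ U p X, symWord_comp θ U p X σ.injective (S := Finset.univ)]
  · rfl
  · intro a; simpa using ⟨σ.symm a, by simp⟩

theorem symWord_sub {n : ℕ} (p : Fin n → ZMod 2) (X : Fin n → R) (S : Finset (Fin n)) :
    symWord θ U (fun a => p (S.orderEmbOfFin rfl a)) (fun a => X (S.orderEmbOfFin rfl a)) =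
      ∑ l ∈ orderings S, listSign k p l • θ (homotopyWord U (l.map X)) := by
  have h := symWord_comp θ U p X (S.orderEmbOfFin rfl).injective (S := S) fun a => by
    rw [← Set.mem_range, Finset.range_orderEmbOfFin, Finset.mem_coe]
  rwa [listSign_of_sorted p (pairwise_ofFn_orderEmb S), one_smul] at h

/-- The new letter `Y` is placed at the free label `i`, with parity and value updated there. Against
a letter that ends up on its right its sign cancels; against one on its left the two pair signs
multiply to the full Koszul sign. -/
theorem symWord_cons_sub {n : ℕ} (p : Fin n → ZMod 2) (X : Fin n → R) {T : Finset (Fin n)}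
    {i : Fin n} (hi : i ∉ T) (r : ZMod 2) (Y : R) :
    symWord θ U (Fin.cons r fun a => p (T.orderEmbOfFin rfl a) : Fin (T.card + 1) → ZMod 2)
        (Fin.cons Y fun a => X (T.orderEmbOfFin rfl a) : Fin (T.card + 1) → R) =
      ∑ q ∈ splittings T, ((q.1.map fun b => ksign k (r * p b)).prod *
        listSign k p (q.1 ++ q.2)) • θ (homotopyWord U (q.1.map X ++ Y :: q.2.map X)) := by
  have hT : ∀ a, T.orderEmbOfFin rfl a ≠ i := fun a h => hi (h ▸ Finset.orderEmbOfFin_mem T rfl a)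
  let e : Fin (T.card + 1) → Fin n := Fin.cons i (T.orderEmbOfFin rfl)
  have he : Function.Injective e := by
    rw [Fin.cons_injective_iff]
    exact ⟨fun ⟨a, ha⟩ => hT a ha, (T.orderEmbOfFin rfl).injective⟩
  have hS : ∀ a, a ∈ insert i T ↔ ∃ j, e j = a := by
    intro a
    rw [Finset.mem_insert, Fin.exists_fin_succ, ← Finset.mem_coe,
      ← Finset.range_orderEmbOfFin T rfl]
    simp only [e, Fin.cons_zero, Fin.cons_succ, Set.mem_range, eq_comm (a := a) (b := i)]
  have h1 : (Fin.cons r fun a => p (T.orderEmbOfFin rfl a) : Fin (T.card + 1) → ZMod 2) =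
      Function.update p i r ∘ e := by
    funext j
    refine Fin.cases ?_ (fun a => ?_) j
    · simp [e]
    · simp [e, Function.update_of_ne (hT a)]
  have h2 : (Fin.cons Y fun a => X (T.orderEmbOfFin rfl a) : Fin (T.card + 1) → R) =
      Function.update X i Y ∘ e := by
    funext j
    refine Fin.cases ?_ (fun a => ?_) j
    · simp [e]
    · simp [e, Function.update_of_ne (hT a)]
  rw [h1, h2, symWord_comp θ U _ _ he hS, sum_orderings_insert hi, Finset.smul_sum]
  refine Finset.sum_congr rfl fun q hq => ?_
  have hq' := mem_splittings.1 hq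
  have hne : ∀ b ∈ q.1 ++ q.2, b ≠ i := by
    rintro b hb rfl
    exact hi (((mem_orderings'.1 hq').2 b).1 hb)
  have hne₁ : ∀ b ∈ q.1, b ≠ i := fun b hb => hne b (List.mem_append_left _ hb)
  have hne₂ : ∀ b ∈ q.2, b ≠ i := fun b hb => hne b (List.mem_append_right _ hb)
  have e1 : ∀ l : List (Fin n), (∀ b ∈ l, b ≠ i) → l.map (Function.update X i Y) = l.map X :=
    fun l hl => List.map_congr_left fun b hb => Function.update_of_ne (hl b hb) _ _
  have e2 : List.ofFn e = i :: List.ofFn (T.orderEmbOfFin rfl) := by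
    rw [List.ofFn_succ]; simp [e]
  have e3 : listSign k (Function.update p i r) (List.ofFn e) =
      ((q.1 ++ q.2).map (pairSign k (Function.update p i r) i)).prod := by
    rw [e2, listSign, listSign_of_sorted _ (pairwise_ofFn_orderEmb T), mul_one,
      ← prod_eq_of_mem_orderings (ofFn_orderEmb_mem_orderings T), prod_eq_of_mem_orderings hq']
  have e4 : listSign k (Function.update p i r) (q.1 ++ q.2) = listSign k p (q.1 ++ q.2) :=
    listSign_congr fun b hb => Function.update_of_ne (hne b hb) _ _
  rw [List.map_append, List.map_cons, e1 _ hne₁, e1 _ hne₂, Function.update_self, smul_smul, e3,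
    listSign_append_cons, e4, List.map_append, List.prod_append]
  congr 1
  have e5 : (q.1.map (pairSign k (Function.update p i r) i)).prod *
      (q.1.map (pairSign k (Function.update p i r) · i)).prod =
      (q.1.map fun b => ksign k (r * p b)).prod := by
    rw [← list_prod_map_mul]
    congr 1
    refine List.map_congr_left fun b hb => ?_
    rw [pairSign_mul_swap _ (hne₁ b hb).symm, Function.update_self,
      Function.update_of_ne (hne₁ b hb)]
  have e6 : (q.2.map (pairSign k (Function.update p i r) i)).prod *
      (q.2.map (pairSign k (Function.update p i r) i)).prod = 1 := by
    rw [← list_prod_map_mul]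
    refine List.prod_eq_one fun x hx => ?_
    obtain ⟨b, _, rfl⟩ := List.mem_map.1 hx
    exact pairSign_mul_self _ _ _
  rw [← e5]
  linear_combination (exp := 1) ((q.1.map (pairSign k (Function.update p i r) i)).prod *
      (q.1.map (pairSign k (Function.update p i r) · i)).prod * listSign k p (q.1 ++ q.2)) * e6

end SymmetrizedWord

/-! ### The `L∞`-relation for symmetrised words -/

section SymmetrizedRelation

variable {k : Type*} [Field k]

theorem ksign_sum {ι : Type*} (s : Finset ι) (f : ι → ZMod 2) :
    ksign k (∑ i ∈ s, f i) = ∏ i ∈ s, ksign k (f i) := by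
  classical
  induction s using Finset.induction_on with
  | empty => simp [ksign]
  | insert a s ha ih => rw [Finset.sum_insert ha, Finset.prod_insert ha, ksign_add, ih]

theorem parityProd_of_mem_orderings {α : Type*} [DecidableEq α] {S : Finset α} {l : List α}
    (h : l ∈ orderings S) (p : α → ZMod 2) : parityProd k p l = ksign k (∑ a ∈ S, p a) := by
  rw [ksign_sum, prod_eq_of_mem_orderings h, parityProd]

variable {n : ℕ}

variable (k) in
/-- The Koszul sign of moving the elements of `S` to the front. -/
def frontSign (p : Fin n → ZMod 2) (S : Finset (Fin n)) : k :=
  ∏ q : Fin n × Fin n, if q.1 < q.2 ∧ q.1 ∉ S ∧ q.2 ∈ S then ksign k (p q.1 * p q.2) else 1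

theorem frontSign_eq (p : Fin n → ZMod 2) (S : Finset (Fin n)) :
    frontSign k p S = ∏ a ∈ S, ∏ b ∈ Sᶜ, pairSign k p a b := by
  rw [← Finset.prod_product', frontSign, ← (Equiv.prodComm (Fin n) (Fin n)).prod_comp,
    ← Finset.univ_inter (S ×ˢ Sᶜ), ← Finset.prod_ite_mem]
  refine Finset.prod_congr rfl fun q _ => ?_
  simp only [Equiv.prodComm_apply, Prod.fst_swap, Prod.snd_swap, Finset.mem_product,
    Finset.mem_compl, pairSign]
  by_cases h1 : q.2 < q.1 <;> by_cases h2 : q.1 ∈ S <;> by_cases h3 : q.2 ∈ S <;>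
    simp [h1, h2, h3, mul_comm]

theorem frontSign_singleton (p : Fin n → ZMod 2) (i : Fin n) :
    frontSign k p {i} = ∏ b ∈ ({i}ᶜ : Finset (Fin n)), pairSign k p i b := by
  rw [frontSign_eq, Finset.prod_singleton]

theorem frontSign_pair (p : Fin n → ZMod 2) {i j : Fin n} (h : i ≠ j) :
    frontSign k p {i, j} =
      ∏ b ∈ ({i, j}ᶜ : Finset (Fin n)), (pairSign k p i b * pairSign k p j b) := by
  rw [frontSign_eq, Finset.prod_pair h, Finset.prod_mul_distrib]

theorem frontSign_mul_listSign (p : Fin n → ZMod 2) {S : Finset (Fin n)} {l₁ l₂ : List (Fin n)}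
    (h₁ : l₁ ∈ orderings S) (h₂ : l₂ ∈ orderings Sᶜ) :
    listSign k p (l₁ ++ l₂) = frontSign k p S * (listSign k p l₁ * listSign k p l₂) := by
  rw [listSign_append, frontSign_eq, prod_eq_of_mem_orderings h₁]
  simp only [prod_eq_of_mem_orderings h₂]

theorem frontSign_mul_compl (p : Fin n → ZMod 2) (S : Finset (Fin n)) :
    frontSign k p S * frontSign k p Sᶜ = ksign k ((∑ a ∈ S, p a) * ∑ a ∈ Sᶜ, p a) := by
  rw [frontSign_eq, frontSign_eq p Sᶜ, compl_compl,
    Finset.prod_comm (s := Sᶜ), ← Finset.prod_mul_distrib, Finset.sum_mul_sum, ksign_sum]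
  refine Finset.prod_congr rfl fun a ha => ?_
  rw [← Finset.prod_mul_distrib, ksign_sum]
  refine Finset.prod_congr rfl fun b hb => pairSign_mul_swap p ?_
  rintro rfl
  exact (Finset.mem_compl.1 hb) ha

theorem frontSign_compl (p : Fin n → ZMod 2) (S : Finset (Fin n)) :
    frontSign k p Sᶜ * ksign k ((∑ a ∈ S, p a) * ∑ a ∈ Sᶜ, p a) = frontSign k p S := by
  have h : frontSign k p Sᶜ * frontSign k p Sᶜ = 1 := by
    rw [frontSign_eq]
    simp only [← Finset.prod_mul_distrib, pairSign_mul_self, Finset.prod_const_one]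
  rw [← frontSign_mul_compl]
  linear_combination frontSign k p S * h

/-- The sign of a front element of parity `r` moving into its place in an arrangement. -/
theorem front_prod_mul (p : Fin n → ZMod 2) {T : Finset (Fin n)} (c c' : Fin n → k) (r : ZMod 2)
    (h : ∀ b ∈ T, c b * ksign k (r * p b) = ksign k (p b) * c' b)
    {q : List (Fin n) × List (Fin n)} (hq : q ∈ splittings T) :
    (∏ b ∈ T, c b) * (q.1.map fun b => ksign k (r * p b)).prod =
      parityProd k p q.1 * (q.1.map c').prod * (q.2.map c).prod := by
  have hq' := mem_splittings.1 hq
  rw [prod_eq_of_mem_orderings hq', List.map_append, List.prod_append, parityProd,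
    mul_right_comm, list_prod_mul_prod_of_eq (h := fun b => ksign k (p b)) (h' := c')]
  exact fun b hb => h b (((mem_orderings'.1 hq').2 b).1 (List.mem_append_left _ hb))

theorem pairSign_swap_eq (p : Fin n → ZMod 2) {i b : Fin n} (h : b ≠ i) :
    pairSign k p b i = pairSign k p i b * ksign k (p i * p b) := by
  rw [← pairSign_mul_swap p h.symm, ← mul_assoc, pairSign_mul_self, one_mul]

variable {R : Type*} [Ring R] [Algebra k R] {R' : Type*} [Ring R'] [Algebra k R']
  (θ : R →ₗ[k] R') {d Φ U : R} {d' : R'}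

/-- The differentiated letter has parity `p i + 1`. The part `p i` turns the front sign into the
sign of the arrangement with `i` in place, and the extra `1` yields the sign for moving `d` past the
prefix. -/
theorem symWord_relation_differential (p : Fin n → ZMod 2) (X : Fin n → R) (i : Fin n) :
    frontSign k p {i} • symWord θ U
        (Fin.cons (p i + 1) fun a => p (({i}ᶜ : Finset (Fin n)).orderEmbOfFin rfl a) :
          Fin (({i}ᶜ : Finset (Fin n)).card + 1) → ZMod 2)
        (Fin.cons (d * X i + ksign k (p i) • (X i * d))
          fun a => X (({i}ᶜ : Finset (Fin n)).orderEmbOfFin rfl a) :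
          Fin (({i}ᶜ : Finset (Fin n)).card + 1) → R) =
      ∑ q ∈ splittings (Finset.univ.erase i),
        (listSign k p (q.1 ++ i :: q.2) * parityProd k p q.1) •
        θ (homotopyWord U (q.1.map X ++
          (d * X i + ksign k (p i) • (X i * d)) :: q.2.map X)) := by
  have hi : i ∉ ({i}ᶜ : Finset (Fin n)) := by simp
  have hT : Finset.univ.erase i = ({i}ᶜ : Finset (Fin n)) := by ext; simp
  rw [symWord_cons_sub θ U p X hi, Finset.smul_sum, hT]
  refine Finset.sum_congr rfl fun q hq => ?_
  rw [smul_smul, frontSign_singleton, listSign_append_cons]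
  have h := front_prod_mul p (pairSign k p i) (pairSign k p · i) (p i + 1) (fun b hb => by
    have hne : b ≠ i := by rintro rfl; simp at hb
    rw [pairSign_swap_eq p hne, add_mul, one_mul, ksign_add]; ring) hq
  congr 1
  linear_combination listSign k p (q.1 ++ q.2) * h

/-- The two terms of the bracket correspond to the two orders of the neighbours `i` and `j`, and the
relative sign in the bracket is exactly their pair sign. -/
theorem symWord_relation_bracket (p : Fin n → ZMod 2) (X : Fin n → R) {i j : Fin n} (hij : i < j) :
    frontSign k p {i, j} • symWord θ U
        (Fin.cons (p i + p j + 1) fun a => p (({i, j}ᶜ : Finset (Fin n)).orderEmbOfFin rfl a) :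
          Fin (({i, j}ᶜ : Finset (Fin n)).card + 1) → ZMod 2)
        (Fin.cons (ksign k (p i) • (X i * X j) +
            ksign k (p i * p j) • ksign k (p j) • (X j * X i))
          fun a => X (({i, j}ᶜ : Finset (Fin n)).orderEmbOfFin rfl a) :
          Fin (({i, j}ᶜ : Finset (Fin n)).card + 1) → R) =
      (∑ q ∈ splittings ((Finset.univ.erase i).erase j),
        (listSign k p (q.1 ++ i :: j :: q.2) * parityProd k p q.1) •
          θ (homotopyWord U (q.1.map X ++ (ksign k (p i) • (X i * X j)) :: q.2.map X))) +
      ∑ q ∈ splittings ((Finset.univ.erase j).erase i),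
        (listSign k p (q.1 ++ j :: i :: q.2) * parityProd k p q.1) •
          θ (homotopyWord U (q.1.map X ++ (ksign k (p j) • (X j * X i)) :: q.2.map X)) := by
  have hi : i ∉ ({i, j}ᶜ : Finset (Fin n)) := by simp
  have hT : (Finset.univ.erase i).erase j = ({i, j}ᶜ : Finset (Fin n)) := by
    ext; simp [and_comm]
  have hT' : (Finset.univ.erase j).erase i = ({i, j}ᶜ : Finset (Fin n)) := by
    ext; simp
  rw [symWord_cons_sub θ U p X hi, Finset.smul_sum, hT, hT', ← Finset.sum_add_distrib]
  refine Finset.sum_congr rfl fun q hq => ?_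
  have h := front_prod_mul p (fun b => pairSign k p i b * pairSign k p j b)
    (fun b => pairSign k p b i * pairSign k p b j) (p i + p j + 1) (fun b hb => by
      simp only [Finset.mem_compl, Finset.mem_insert, Finset.mem_singleton, not_or] at hb
      rw [pairSign_swap_eq p hb.1, pairSign_swap_eq p hb.2, add_mul, add_mul, one_mul, ksign_add,
        ksign_add]; ring) hq
  simp only [list_prod_map_mul] at h
  have e1 : pairSign k p i j = 1 := by rw [pairSign, if_neg hij.not_gt]
  have e2 : pairSign k p j i = ksign k (p i * p j) := by rw [pairSign, if_pos hij, mul_comm]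
  have e3 : ∀ (a b : Fin n), listSign k p (q.1 ++ a :: b :: q.2) = pairSign k p a b *
      ((q.1.map (pairSign k p · a)).prod * (q.1.map (pairSign k p · b)).prod *
        ((q.2.map (pairSign k p a)).prod * (q.2.map (pairSign k p b)).prod)) *
      listSign k p (q.1 ++ q.2) := by
    intro a b
    rw [listSign_append_cons, listSign_append_cons, List.map_cons, List.prod_cons]
    ring
  rw [smul_smul, frontSign_pair p hij.ne, homotopyWord_append_add, map_add,
    homotopyWord_append_smul U _ _ (ksign k (p i * p j)), map_smul, smul_add, smul_smul, e3, e3, e1,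
    e2]
  congr 2
  · linear_combination listSign k p (q.1 ++ q.2) * h
  · linear_combination listSign k p (q.1 ++ q.2) * ksign k (p i * p j) * h

theorem sum_lt_add_swap (f : Fin n → Fin n → R') :
    ∑ q : Fin n × Fin n with q.1 < q.2, (f q.1 q.2 + f q.2 q.1) =
      ∑ a : Fin n, ∑ b ∈ Finset.univ.erase a, f a b := by
  have h1 : ∑ a : Fin n, ∑ b ∈ Finset.univ.erase a, f a b =
      ∑ q : Fin n × Fin n with q.1 ≠ q.2, f q.1 q.2 := by
    rw [Finset.sum_filter, Fintype.sum_prod_type]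
    refine Finset.sum_congr rfl fun a _ => ?_
    rw [← Finset.sum_filter]
    refine Finset.sum_congr ?_ fun _ _ => rfl
    ext b; simp [eq_comm]
  have h2 : ∑ q : Fin n × Fin n with q.1 < q.2, f q.2 q.1 =
      ∑ q : Fin n × Fin n with q.2 < q.1, f q.1 q.2 := by
    refine Finset.sum_bij' (fun q _ => q.swap) (fun q _ => q.swap) ?_ ?_ ?_ ?_ ?_ <;> simp
  have h3 : (Finset.univ.filter fun q : Fin n × Fin n => q.1 ≠ q.2) =
      (Finset.univ.filter fun q : Fin n × Fin n => q.1 < q.2) ∪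
        Finset.univ.filter fun q : Fin n × Fin n => q.2 < q.1 := by
    ext q; simp
  rw [Finset.sum_add_distrib, h2, h1, h3, Finset.sum_union]
  exact Finset.disjoint_filter.2 fun q _ h h' => lt_asymm h h'

/-- The `L∞`-relation for the symmetrised words. -/
theorem symWord_relation (h2 : (2 : k) ≠ 0) (hΦ : 1 - Φ = d * U + U * d)
    (hθ : ∀ Y Y', θ Y * θ Y' = θ (Y * Φ * Y')) (hd : ∀ Y, d' * θ Y = θ (d * Y))
    (hd' : ∀ Y, θ Y * d' = θ (Y * d)) (p : Fin n → ZMod 2) (X : Fin n → R)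
    (s : Finset (Fin n) → R')
    (hs : ∀ S, s S =
      symWord θ U (fun a => p (S.orderEmbOfFin rfl a)) (fun a => X (S.orderEmbOfFin rfl a))) :
    d' * symWord θ U p X + ksign k (∑ i, p i) • (symWord θ U p X * d') +
      (1 / 2 : k) • ∑ S : Finset (Fin n), frontSign k p S •
        (ksign k (∑ i ∈ S, p i) • (s S * s Sᶜ) +
          ksign k ((∑ i ∈ S, p i) * ∑ i ∈ Sᶜ, p i) • ksign k (∑ i ∈ Sᶜ, p i) • (s Sᶜ * s S)) =
    (∑ i, frontSign k p {i} • symWord θ U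
        (Fin.cons (p i + 1) fun a => p (({i}ᶜ : Finset (Fin n)).orderEmbOfFin rfl a) :
          Fin (({i}ᶜ : Finset (Fin n)).card + 1) → ZMod 2)
        (Fin.cons (d * X i + ksign k (p i) • (X i * d))
          fun a => X (({i}ᶜ : Finset (Fin n)).orderEmbOfFin rfl a) :
          Fin (({i}ᶜ : Finset (Fin n)).card + 1) → R)) +
    ∑ q : Fin n × Fin n with q.1 < q.2, frontSign k p {q.1, q.2} • symWord θ U
        (Fin.cons (p q.1 + p q.2 + 1)
          fun a => p (({q.1, q.2}ᶜ : Finset (Fin n)).orderEmbOfFin rfl a) :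
          Fin (({q.1, q.2}ᶜ : Finset (Fin n)).card + 1) → ZMod 2)
        (Fin.cons (ksign k (p q.1) • (X q.1 * X q.2) +
            ksign k (p q.1 * p q.2) • ksign k (p q.2) • (X q.2 * X q.1))
          fun a => X (({q.1, q.2}ᶜ : Finset (Fin n)).orderEmbOfFin rfl a) :
          Fin (({q.1, q.2}ᶜ : Finset (Fin n)).card + 1) → R) := by
  have hb : ∀ q ∈ (Finset.univ.filter fun q : Fin n × Fin n => q.1 < q.2), _ = _ :=
    fun q hq => symWord_relation_bracket θ (U := U) p X (Finset.mem_filter.1 hq).2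
  rw [Finset.sum_congr rfl fun i _ => symWord_relation_differential θ p X i,
    Finset.sum_congr rfl hb,
    sum_lt_add_swap fun i j => ∑ q ∈ splittings ((Finset.univ.erase i).erase j),
      (listSign k p (q.1 ++ i :: j :: q.2) * parityProd k p q.1) •
        θ (homotopyWord U (q.1.map X ++ (ksign k (p i) • (X i * X j)) :: q.2.map X)),
    ← sum_orderings_cuts₁ Finset.univ fun q : List (Fin n) × Fin n × List (Fin n) =>
      (listSign k p (q.1 ++ q.2.1 :: q.2.2) * parityProd k p q.1) •
        θ (homotopyWord U (q.1.map X ++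
          (d * X q.2.1 + ksign k (p q.2.1) • (X q.2.1 * d)) :: q.2.2.map X)),
    ← sum_orderings_cuts₂ Finset.univ fun q : List (Fin n) × Fin n × Fin n × List (Fin n) =>
      (listSign k p (q.1 ++ q.2.1 :: q.2.2.1 :: q.2.2.2) * parityProd k p q.1) •
        θ (homotopyWord U (q.1.map X ++
          (ksign k (p q.2.1) • (X q.2.1 * X q.2.2.1)) :: q.2.2.2.map X))]
  -- Replacing `S` by its complement exchanges the two terms of the bracket, which cancels the
  -- factor `1 / 2`.
  have hhalf : (1 / 2 : k) • ∑ S : Finset (Fin n), frontSign k p S •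
        (ksign k (∑ i ∈ S, p i) • (s S * s Sᶜ) +
          ksign k ((∑ i ∈ S, p i) * ∑ i ∈ Sᶜ, p i) • ksign k (∑ i ∈ Sᶜ, p i) • (s Sᶜ * s S)) =
      ∑ S : Finset (Fin n), frontSign k p S • ksign k (∑ i ∈ S, p i) • (s S * s Sᶜ) := by
    simp only [smul_add, Finset.sum_add_distrib]
    have h3 : ∑ S : Finset (Fin n), frontSign k p S •
        ksign k ((∑ i ∈ S, p i) * ∑ i ∈ Sᶜ, p i) • ksign k (∑ i ∈ Sᶜ, p i) • (s Sᶜ * s S) =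
        ∑ S : Finset (Fin n), frontSign k p S • ksign k (∑ i ∈ S, p i) • (s S * s Sᶜ) := by
      rw [← (Equiv.ofBijective (compl : Finset (Fin n) → _) compl_bijective).sum_comp]
      refine Finset.sum_congr rfl fun S _ => ?_
      rw [Equiv.ofBijective_apply, compl_compl, smul_smul, mul_comm (∑ i ∈ Sᶜ, p i),
        frontSign_compl]
    rw [h3, ← smul_add, ← two_smul k, smul_smul, one_div, inv_mul_cancel₀ h2, one_smul]
  -- A subset with an order on it and on its complement is the same as an order on everything
  -- together with a cut, and `θ Y θ Y' = θ (Y Φ Y')` glues the two words at the cut.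
  have hcuts : ∑ S : Finset (Fin n), frontSign k p S • ksign k (∑ i ∈ S, p i) • (s S * s Sᶜ) =
      ∑ l ∈ orderings Finset.univ, ((cuts₀ l).map fun q => (listSign k p (q.1 ++ q.2) *
        parityProd k p q.1) •
          θ (homotopyWord U (q.1.map X) * Φ * homotopyWord U (q.2.map X))).sum := by
    rw [sum_orderings_cuts₀, sum_splittings_univ]
    refine Finset.sum_congr rfl fun S _ => ?_
    rw [hs, hs, symWord_sub, symWord_sub, Finset.sum_mul_sum]
    simp only [Finset.smul_sum]
    refine Finset.sum_congr rfl fun l₁ h₁ => Finset.sum_congr rfl fun l₂ h₂ => ?_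
    rw [smul_mul_smul_comm, hθ, frontSign_mul_listSign p h₁ h₂, parityProd_of_mem_orderings h₁,
      smul_smul, smul_smul]
    congr 1; ring
  rw [hhalf, hcuts, symWord_eq, Finset.mul_sum, Finset.sum_mul, Finset.smul_sum,
    ← Finset.sum_add_distrib, ← Finset.sum_add_distrib, ← Finset.sum_add_distrib]
  refine Finset.sum_congr rfl fun l hl => ?_
  have hsum : ∀ {ι : Type} (L : List ι) (c : ι → k) (Z : ι → R),
      (L.map fun q => (listSign k p l * c q) • θ (Z q)).sum =
        listSign k p l • θ (L.map fun q => c q • Z q).sum := by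
    intro ι L c Z
    induction L with
    | nil => simp
    | cons a L ih =>
      rw [List.map_cons, List.sum_cons, ih, List.map_cons, List.sum_cons, map_add, smul_add,
        map_smul, smul_smul]
  -- All terms are now sums over the same orderings, and the identity holds for each ordering
  -- separately.
  have key := congrArg (fun x => listSign k p l • θ x)
    (homotopyWord_differential (k := k) p X hΦ l)
  have e₀ : ((cuts₀ l).map fun q => (listSign k p (q.1 ++ q.2) * parityProd k p q.1) •
      θ (homotopyWord U (q.1.map X) * Φ * homotopyWord U (q.2.map X))) =
      (cuts₀ l).map fun q => (listSign k p l * parityProd k p q.1) •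
      θ (homotopyWord U (q.1.map X) * Φ * homotopyWord U (q.2.map X)) :=
    List.map_congr_left fun q hq => by rw [← mem_cuts₀.1 hq]
  have e₁ : ((cuts₁ l).map fun q => (listSign k p (q.1 ++ q.2.1 :: q.2.2) *
      parityProd k p q.1) • θ (homotopyWord U (q.1.map X ++
          (d * X q.2.1 + ksign k (p q.2.1) • (X q.2.1 * d)) :: q.2.2.map X))) =
      (cuts₁ l).map fun q => (listSign k p l * parityProd k p q.1) •
      θ (homotopyWord U (q.1.map X ++
          (d * X q.2.1 + ksign k (p q.2.1) • (X q.2.1 * d)) :: q.2.2.map X)) :=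
    List.map_congr_left fun q hq => by rw [← mem_cuts₁.1 hq]
  have e₂ : ((cuts₂ l).map fun q => (listSign k p (q.1 ++ q.2.1 :: q.2.2.1 :: q.2.2.2) *
      parityProd k p q.1) • θ (homotopyWord U (q.1.map X ++
          (ksign k (p q.2.1) • (X q.2.1 * X q.2.2.1)) :: q.2.2.2.map X))) =
      (cuts₂ l).map fun q => (listSign k p l * parityProd k p q.1) •
      θ (homotopyWord U (q.1.map X ++
          (ksign k (p q.2.1) • (X q.2.1 * X q.2.2.1)) :: q.2.2.2.map X)) :=
    List.map_congr_left fun q hq => by rw [← mem_cuts₂.1 hq]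
  rw [e₀, e₁, e₂, hsum, hsum, hsum, ← smul_add, ← map_add, ← key, mul_smul_comm, hd,
    smul_mul_assoc, hd', smul_comm (ksign k _), ← parityProd_of_mem_orderings hl]
  simp only [map_add, smul_add, map_smul]

end SymmetrizedRelation

/-! ### The transferred `L∞`-morphism -/

theorem SignGrading.par_suspended_sum {Γ : Type*} [AddCommGroup Γ] (g : SignGrading Γ) {ι : Type*}
    (s : Finset ι) (a : ι → Γ) :
    g.par (g.e + ∑ i ∈ s, (a i - g.e)) = 1 + ∑ i ∈ s, (g.par (a i) + 1) := by
  rw [map_add, map_sum, g.par_e]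
  congr 1
  refine Finset.sum_congr rfl fun i _ => ?_
  rw [map_sub, g.par_e]
  exact CharTwo.sub_eq_add _ _

/-- In the suspended parities `a + 1` and `b + 1` the graded commutator becomes graded symmetric,
which is the form in which words are symmetrised. -/
theorem smul_bracket_eq {k R : Type*} [Field k] [Ring R] [Algebra k R] (a b : ZMod 2) (x y : R) :
    ksign k (a + 1) • (x * y - ksign k (a * b) • (y * x)) =
      ksign k (a + 1) • (x * y) +
        ksign k ((a + 1) * (b + 1)) • ksign k (b + 1) • (y * x) := by
  rcases zmod2_cases a with rfl | rfl <;> rcases zmod2_cases b with rfl | rfl <;>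
    simp [ksign_zero, ksign_one, zmod2_one_add_one, sub_eq_add_neg]

theorem sub_smul_eq_suspended {k R : Type*} [Field k] [Ring R] [Algebra k R] (a : ZMod 2)
    (x y : R) : x - ksign k (1 * a) • y = x + ksign k (a + 1) • y := by
  rcases zmod2_cases a with rfl | rfl <;>
    simp [ksign_zero, ksign_one, zmod2_one_add_one, sub_eq_add_neg]

section TransferMorphism

variable {k : Type*} [Field k] {Γ : Type*} [AddCommGroup Γ] [DecidableEq Γ] {g : SignGrading Γ}
  {A : Type*} [AddCommGroup A] [Module k A] {𝒜 : Γ → Submodule k A} [DirectSum.Decomposition 𝒜]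
  {B : Type*} [AddCommGroup B] [Module k B] {ℬ : Γ → Submodule k B}

/-- The map `Y ↦ F̄ Y F`. -/
def sandwich (F : TensorAlgebra k B →ₗ[k] TensorAlgebra k A)
    (F' : TensorAlgebra k A →ₗ[k] TensorAlgebra k B) :
    Module.End k (TensorAlgebra k A) →ₗ[k] Module.End k (TensorAlgebra k B) where
  toFun Y := F' ∘ₗ Y ∘ₗ F
  map_add' Y Y' := by rw [LinearMap.add_comp, LinearMap.comp_add]
  map_smul' c Y := by rw [LinearMap.smul_comp, LinearMap.comp_smul]; rfl

variable (F : TensorAlgebra k B →ₗ[k] TensorAlgebra k A)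
  (F' : TensorAlgebra k A →ₗ[k] TensorAlgebra k B) (U : Module.End k (TensorAlgebra k A))

/-- The map `(f₀, …, fₙ) ↦ F̄ f₀ U f₁ ⋯ U fₙ F`. -/
def transferMultilinear (n : ℕ) : MultilinearMap k
    (fun _ : Fin (n + 1) => Module.End k (TensorAlgebra k A)) (Module.End k (TensorAlgebra k B)) :=
  (sandwich F F').compMultilinearMap
    ((MultilinearMap.mkPiAlgebraFin k (n + 1) (Module.End k (TensorAlgebra k A))).compLinearMap
      fun i => LinearMap.mulRight k (if i = Fin.last n then 1 else U))

theorem transferMultilinear_apply {n : ℕ} (f : Fin (n + 1) → Module.End k (TensorAlgebra k A)) :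
    transferMultilinear F F' U n f = transferWord F F' U f := by
  have h : (List.ofFn fun i => f i * if i = Fin.last n then 1 else U).prod =
      (List.ofFn fun i : Fin n => f i.castSucc * U).prod * f (Fin.last n) := by
    rw [List.ofFn_succ', List.concat_eq_append, List.prod_append]
    simp [Fin.castSucc_ne_last]
  exact congrArg (sandwich F F') h

theorem transferWord_eq_sandwich {n : ℕ} (f : Fin (n + 1) → Module.End k (TensorAlgebra k A)) :
    (-1 : k) ^ n • transferWord F F' U f = sandwich F F' (homotopyWord U (List.ofFn f)) := by
  rw [homotopyWord_ofFn (k := k), map_smul]; rfl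

theorem symWord_sandwich {n : ℕ} (p : Fin (n + 1) → ZMod 2)
    (f : Fin (n + 1) → Module.End k (TensorAlgebra k A)) :
    symWord (sandwich F F') U p f = (-1 : k) ^ n • ∑ σ : Equiv.Perm (Fin (n + 1)),
      (∏ q : Fin (n + 1) × Fin (n + 1), if q.1 < q.2 ∧ σ q.2 < σ q.1 then
        ksign k (p (σ q.1) * p (σ q.2)) else 1) • transferWord F F' U (f ∘ σ) := by
  rw [symWord, Finset.smul_sum]
  refine Finset.sum_congr rfl fun σ _ => ?_
  rw [← transferWord_eq_sandwich, smul_comm]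

variable {F F' U} [DirectSum.Decomposition ℬ]

/-- The components of the transferred `L∞`-morphism. -/
def transferComp (h : IsSpecialRetraction 𝒜 ℬ g F F' U) : ∀ (n : ℕ) (a : Fin n → Γ),
    MultilinearMap k (fun i => Coder 𝒜 g (a i)) (Coder ℬ g (g.e + ∑ i, (a i - g.e)))
  | 0, _ => 0
  | n + 1, a => (((-1 : k) ^ n • ∑ σ : Equiv.Perm (Fin (n + 1)),
      (∏ q : Fin (n + 1) × Fin (n + 1), if q.1 < q.2 ∧ σ q.2 < σ q.1 then
        ksign k ((g.par (a (σ q.1)) + 1) * (g.par (a (σ q.2)) + 1)) else 1) •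
          (transferMultilinear F F' U n).domDomCongr σ).compLinearMap
            fun i => (Coder 𝒜 g (a i)).subtype).codRestrict _ fun v => by
    simp only [MultilinearMap.compLinearMap_apply, smul_apply,
      sum_apply, MultilinearMap.domDomCongr_apply, transferMultilinear_apply]
    refine Submodule.smul_mem _ _ (Submodule.sum_mem _ fun σ _ => Submodule.smul_mem _ _ ?_)
    -- The degree of the target does not depend on the order of the arguments, so it may be written
    -- for the permuted arguments.
    rw [← Equiv.sum_comp σ]
    exact h.transferWord_mem fun i => (v (σ i)).2

theorem transferComp_coe (h : IsSpecialRetraction 𝒜 ℬ g F F' U) (n : ℕ) (a : Fin n → Γ)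
    (v : ∀ i, Coder 𝒜 g (a i)) :
    (transferComp h n a v : Module.End k (TensorAlgebra k B)) =
      symWord (sandwich F F') U (fun i => g.par (a i) + 1) fun i => (v i).1 := by
  cases n with
  | zero => rw [symWord_zero]; rfl
  | succ n =>
    rw [symWord_sandwich, transferComp, MultilinearMap.codRestrict_apply_coe]
    simp only [MultilinearMap.compLinearMap_apply, smul_apply,
      sum_apply, MultilinearMap.domDomCongr_apply, transferMultilinear_apply]
    rfl

theorem transferComp_relation (h2 : (2 : k) ≠ 0) {X : AInftyAlgebra 𝒜 g} {Y : AInftyAlgebra ℬ g}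
    (h : IsSpecialRetraction 𝒜 ℬ g F F' U) (hr : IsDeformationRetraction Y X F F' U)
    (n : ℕ) (x : Fin n → X.coder.Hom) :
    let L : ∀ {m : ℕ}, (Fin m → X.coder.Hom) → Y.coder.Hom := fun {m} y =>
      ⟨_, transferComp h m (fun i => (y i).1) (fun i => (y i).2)⟩
    ((Y.coder.Q₁ (L x)).2 : Module.End k (TensorAlgebra k B))
        + (1 / 2 : k) • ∑ S : Finset (Fin n) with S.Nonempty ∧ Sᶜ.Nonempty,
            koszulFront S x • ((Y.coder.Q₂ (L (sub S x)) (L (sub Sᶜ x))).2 : Module.End k _) =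
      (∑ i : Fin n, koszulFront {i} x •
          ((L (Fin.cons (X.coder.Q₁ (x i)) (sub {i}ᶜ x) :
            Fin (_ + 1) → X.coder.Hom)).2 : Module.End k _))
        + ∑ q : Fin n × Fin n with q.1 < q.2, koszulFront {q.1, q.2} x •
            ((L (Fin.cons (X.coder.Q₂ (x q.1) (x q.2)) (sub {q.1, q.2}ᶜ x) :
              Fin (_ + 1) → X.coder.Hom)).2 : Module.End k _) := by
  intro L
  have hL : ∀ {m : ℕ} (y : Fin m → X.coder.Hom), ((L y).2 : Module.End k (TensorAlgebra k B)) =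
      symWord (sandwich F F') U (fun i => X.coder.spar (y i)) fun i => ((y i).2 : Module.End k _) :=
    fun y => transferComp_coe h _ _ _
  -- On the suspension the components preserve parity, which matches the signs in the target with
  -- those in `symWord_relation`.
  have hpar : ∀ {m : ℕ} (y : Fin m → X.coder.Hom),
      g.par (L y).1 + 1 = ∑ i, X.coder.spar (y i) := by
    intro m y
    have := g.par_suspended_sum Finset.univ fun i => (y i).1
    refine (congrArg (· + 1) this).trans ?_
    rw [add_right_comm, zmod2_one_add_one, zero_add]
    rfl
  have hsub : ∀ S : Finset (Fin n), ∑ i, X.coder.spar (sub S x i) =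
      ∑ i ∈ S, X.coder.spar (x i) := by
    intro S
    rw [← Finset.sum_coe_sort S, ← (S.orderIsoOfFin rfl).toEquiv.sum_comp]
    rfl
  have hQ₁ : ∀ y : X.coder.Hom, ((X.coder.Q₁ y).2 : Module.End k (TensorAlgebra k A)) =
      X.diff * (y.2 : Module.End k (TensorAlgebra k A)) +
        ksign k (X.coder.spar y) • ((y.2 : Module.End k (TensorAlgebra k A)) * X.diff) :=
      fun y => by
    refine Eq.trans ?_ (sub_smul_eq_suspended (g.par y.1) _ _)
    rw [← g.par_e]; rfl
  have hQ₂ : ∀ y z : X.coder.Hom,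
      ((X.coder.Q₂ y z).2 : Module.End k (TensorAlgebra k A)) =
      ksign k (X.coder.spar y) • ((y.2 : Module.End k _) * (z.2 : Module.End k _)) +
        ksign k (X.coder.spar y * X.coder.spar z) • ksign k (X.coder.spar z) •
          ((z.2 : Module.End k _) * (y.2 : Module.End k _)) := fun y z => by
    exact smul_bracket_eq (g.par y.1) (g.par z.1) _ _
  have hQ₁' : ∀ y : Y.coder.Hom, ((Y.coder.Q₁ y).2 : Module.End k (TensorAlgebra k B)) =
      Y.diff * (y.2 : Module.End k (TensorAlgebra k B)) +
        ksign k (g.par y.1 + 1) • ((y.2 : Module.End k (TensorAlgebra k B)) * Y.diff) := fun y => by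
    refine Eq.trans ?_ (sub_smul_eq_suspended (g.par y.1) _ _)
    rw [← g.par_e]; rfl
  have hQ₂' : ∀ y z : Y.coder.Hom,
      ((Y.coder.Q₂ y z).2 : Module.End k (TensorAlgebra k B)) =
      ksign k (g.par y.1 + 1) • ((y.2 : Module.End k _) * (z.2 : Module.End k _)) +
        ksign k ((g.par y.1 + 1) * (g.par z.1 + 1)) • ksign k (g.par z.1 + 1) •
          ((z.2 : Module.End k _) * (y.2 : Module.End k _)) := fun y z => by
    exact smul_bracket_eq (g.par y.1) (g.par z.1) _ _
  have key := symWord_relation (sandwich F F') (d := X.diff) (Φ := F ∘ₗ F') (U := U)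
    (d' := Y.diff) h2 hr.homotopy (fun _ _ => rfl)
    (fun Z => by
      change Y.diff ∘ₗ F' ∘ₗ Z ∘ₗ F = F' ∘ₗ (X.diff ∘ₗ Z) ∘ₗ F
      rw [← LinearMap.comp_assoc, ← hr.F'_comm]; rfl)
    (fun Z => by
      change (F' ∘ₗ Z ∘ₗ F) ∘ₗ Y.diff = F' ∘ₗ (Z ∘ₗ X.diff) ∘ₗ F
      rw [LinearMap.comp_assoc, LinearMap.comp_assoc, hr.F_comm]; rfl)
    (fun i => X.coder.spar (x i)) (fun i => ((x i).2 : Module.End k _))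
    (fun S => ((L (sub S x)).2 : Module.End k _)) fun S => hL (sub S x)
  have hcons : ∀ {m : ℕ} (y : X.coder.Hom) (z : Fin m → X.coder.Hom),
      ((L (Fin.cons y z : Fin (m + 1) → X.coder.Hom)).2 : Module.End k (TensorAlgebra k B)) =
      symWord (sandwich F F') U
        (Fin.cons (X.coder.spar y) fun i => X.coder.spar (z i) : Fin (m + 1) → ZMod 2)
        (Fin.cons (y.2 : Module.End k _) fun i => ((z i).2 : Module.End k _) :
          Fin (m + 1) → Module.End k _) := by
    intro m y z
    rw [hL]
    congr 1 <;> funext i <;> refine Fin.cases rfl (fun _ => rfl) i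
  have hspar₁ : ∀ y : X.coder.Hom, X.coder.spar (X.coder.Q₁ y) = X.coder.spar y + 1 := fun y => by
    change g.par (g.e + y.1) + 1 = g.par y.1 + 1 + 1
    rw [map_add, g.par_e, add_comm 1]
  have hspar₂ : ∀ y z : X.coder.Hom,
      X.coder.spar (X.coder.Q₂ y z) = X.coder.spar y + X.coder.spar z + 1 := fun y z => by
    change g.par (y.1 + z.1) + 1 = g.par y.1 + 1 + (g.par z.1 + 1) + 1
    rw [map_add]
    linear_combination -zmod2_one_add_one
  simp only [hcons, hspar₁, hspar₂, hQ₁, hQ₂]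
  refine Eq.trans ?_ key
  rw [hQ₁', hpar, hL]
  congr 2
  -- The relation of an `L∞`-morphism omits `S = ∅` and its complement, whereas the relation for
  -- words sums over all `S`. The additional terms vanish because the component without arguments is
  -- zero.
  rw [Finset.sum_filter]
  refine Finset.sum_congr rfl fun S _ => ?_
  have hempty : ∀ S : Finset (Fin n), ¬ S.Nonempty →
      ((L (sub S x)).2 : Module.End k (TensorAlgebra k B)) = 0 := by
    intro S hS
    rw [Finset.not_nonempty_iff_eq_empty.1 hS, hL]
    exact symWord_zero _ _ _ _
  split_ifs with hS
  · rw [hQ₂', hpar, hpar, hsub, hsub]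
    rfl
  · rcases not_and_or.1 hS with hS | hS <;> rw [hempty _ hS] <;> simp

theorem transferComp_symm {X : AInftyAlgebra 𝒜 g} (h : IsSpecialRetraction 𝒜 ℬ g F F' U) (n : ℕ)
    (x : Fin n → X.coder.Hom) (σ : Equiv.Perm (Fin n)) :
    (transferComp h n (fun i => (x (σ i)).1) (fun i => (x (σ i)).2) :
      Module.End k (TensorAlgebra k B)) = koszul σ x •
        (transferComp h n (fun i => (x i).1) (fun i => (x i).2) :
          Module.End k (TensorAlgebra k B)) := by
  have h₁ := transferComp_coe h n (fun i => (x (σ i)).1) fun i => (x (σ i)).2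
  have h₂ := transferComp_coe h n (fun i => (x i).1) fun i => (x i).2
  have h₃ := symWord_perm (sandwich F F') U (fun i => g.par (x i).1 + 1)
    (fun i => ((x i).2 : Module.End k (TensorAlgebra k A))) σ
  exact h₁.trans (h₃.trans (congrArg (fun z => koszul σ x • z) h₂.symm))

/-- The `L∞`-morphism between the DG Lie algebras of coderivations that is induced by a special
deformation retraction. -/
def transferMorphism (h2 : (2 : k) ≠ 0) {X : AInftyAlgebra 𝒜 g} {Y : AInftyAlgebra ℬ g}
    (h : IsSpecialRetraction 𝒜 ℬ g F F' U) (hr : IsDeformationRetraction Y X F F' U) :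
    LInftyMorphism X.coder Y.coder where
  comp := transferComp h
  comp_zero _ := rfl
  symm := transferComp_symm h
  relation := transferComp_relation h2 h hr

theorem transferMorphism_app (h2 : (2 : k) ≠ 0) {X : AInftyAlgebra 𝒜 g} {Y : AInftyAlgebra ℬ g}
    (h : IsSpecialRetraction 𝒜 ℬ g F F' U) (hr : IsDeformationRetraction Y X F F' U) (n : ℕ)
    (x : Fin (n + 1) → X.coder.Hom) :
    (transferMorphism h2 h hr).app x = (-1 : k) ^ n • ∑ σ : Equiv.Perm (Fin (n + 1)),
      koszul σ x • transferWord F F' U (fun i => ((x (σ i)).2 : Module.End k _)) :=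
  (transferComp_coe h (n + 1) _ _).trans (symWord_sandwich F F' U _ _)

end TransferMorphism

/-! ### Transfer of Maurer–Cartan elements -/

section WordSeries

variable {R : Type*} [Ring R] (U : R) (x : ℕ → R)

/-- The coefficients of the series of words of length `n + 1` in a formal power series. -/
def wordCoeff (n m : ℕ) : R :=
  ∑ i ∈ Finset.Nat.antidiagonalTuple (n + 1) m, homotopyWord U (List.ofFn fun j => x (i j))

theorem wordCoeff_zero (m : ℕ) : wordCoeff U x 0 m = x m := by
  simp [wordCoeff, Finset.Nat.antidiagonalTuple_one, homotopyWord]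

theorem wordCoeff_succ (n m : ℕ) : wordCoeff U x (n + 1) m =
    -∑ q ∈ Finset.HasAntidiagonal.antidiagonal m, x q.1 * U * wordCoeff U x n q.2 := by
  have h : ∀ f : (Fin (n + 2) → ℕ) → R, ∑ i ∈ Finset.Nat.antidiagonalTuple (n + 2) m, f i =
      ∑ q ∈ Finset.HasAntidiagonal.antidiagonal m,
        ∑ i ∈ Finset.Nat.antidiagonalTuple (n + 1) q.2, f (Fin.cons q.1 i) := by
    intro f
    rw [Finset.sum_sigma']
    refine Finset.sum_bij' (fun i _ => ⟨(i 0, ∑ j : Fin (n + 1), i j.succ), Fin.tail i⟩)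
      (fun y _ => Fin.cons y.1.1 y.2) ?_ ?_ ?_ ?_ ?_
    · intro i hi
      rw [Finset.Nat.mem_antidiagonalTuple, Fin.sum_univ_succ] at hi
      simp only [Finset.mem_sigma, Finset.HasAntidiagonal.mem_antidiagonal,
        Finset.Nat.mem_antidiagonalTuple]
      exact ⟨hi, rfl⟩
    · rintro ⟨⟨a, b⟩, i⟩ hi
      simp only [Finset.mem_sigma, Finset.HasAntidiagonal.mem_antidiagonal,
        Finset.Nat.mem_antidiagonalTuple] at hi
      rw [Finset.Nat.mem_antidiagonalTuple, Fin.sum_univ_succ]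
      simp only [Fin.cons_zero, Fin.cons_succ, hi.2, hi.1]
    · intro i _; exact Fin.cons_self_tail i
    · rintro ⟨⟨a, b⟩, i⟩ hi
      simp only [Finset.mem_sigma, Finset.HasAntidiagonal.mem_antidiagonal,
        Finset.Nat.mem_antidiagonalTuple] at hi
      obtain ⟨-, rfl⟩ := hi
      simp
    · intro i _; simp
  rw [wordCoeff, h, ← Finset.sum_neg_distrib]
  refine Finset.sum_congr rfl fun q _ => ?_
  rw [wordCoeff, Finset.mul_sum, ← Finset.sum_neg_distrib]
  refine Finset.sum_congr rfl fun i _ => ?_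
  rw [List.ofFn_succ, homotopyWord_cons_of_ne_nil U _ (by simp)]
  simp

/-- Each of the `n + 1` letters has order at least `1` in `t`. Therefore only finitely many words
contribute to a coefficient, and the cutoff in `wordSeries` loses nothing. -/
theorem wordCoeff_eq_zero (hx : x 0 = 0) {n m : ℕ} (h : m ≤ n) : wordCoeff U x n m = 0 := by
  induction n generalizing m with
  | zero => rw [wordCoeff_zero, Nat.le_zero.1 h, hx]
  | succ n ih =>
    rw [wordCoeff_succ, neg_eq_zero]
    refine Finset.sum_eq_zero fun q hq => ?_
    rcases Nat.eq_zero_or_pos q.1 with h0 | h0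
    · rw [h0, hx, zero_mul, zero_mul]
    · have := Finset.HasAntidiagonal.mem_antidiagonal.1 hq
      rw [ih (by omega), mul_zero]

/-- The coefficients of `∑ₙ (-1)^n (x U)^n x`, for a formal power series `x`. -/
def wordSeries (m : ℕ) : R := ∑ n ∈ Finset.range m, wordCoeff U x n m

theorem wordSeries_eq_sum_range (hx : x 0 = 0) {m N : ℕ} (h : m ≤ N) :
    wordSeries U x m = ∑ n ∈ Finset.range N, wordCoeff U x n m :=
  Finset.sum_subset (Finset.range_mono h) fun n _ hn =>
    wordCoeff_eq_zero U x hx (by simpa using hn)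

/-- The geometric series satisfies `D = δ - δ U D`; this equation replaces the explicit sum in the
proof of the Maurer–Cartan equation. -/
theorem mk_wordSeries (hx : x 0 = 0) : PowerSeries.mk (wordSeries U x) =
    PowerSeries.mk x - PowerSeries.mk x * PowerSeries.C U * PowerSeries.mk (wordSeries U x) := by
  ext m
  rw [map_sub, PowerSeries.coeff_mk, PowerSeries.coeff_mk, PowerSeries.coeff_mul,
    wordSeries_eq_sum_range U x hx m.le_succ, Finset.sum_range_succ', wordCoeff_zero, add_comm,
    sub_eq_add_neg]
  congr 1
  simp only [wordCoeff_succ]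
  rw [Finset.sum_neg_distrib, Finset.sum_comm]
  congr 1
  refine Finset.sum_congr rfl fun q hq => ?_
  have := Finset.HasAntidiagonal.mem_antidiagonal.1 hq
  rw [PowerSeries.coeff_mk, PowerSeries.coeff_mul_C, PowerSeries.coeff_mk,
    wordSeries_eq_sum_range U x hx (show q.2 ≤ m by omega), Finset.mul_sum]

/-- The Maurer–Cartan equation for the series of words in a Maurer–Cartan element. -/
theorem wordSeries_maurerCartan (hx : x 0 = 0) {d Φ : R} (hΦ : 1 - Φ = d * U + U * d)
    (hmc : ∀ m, d * x m + x m * d +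
      ∑ q ∈ Finset.HasAntidiagonal.antidiagonal m, x q.1 * x q.2 = 0) (m : ℕ) :
    d * wordSeries U x m + wordSeries U x m * d + ∑ q ∈ Finset.HasAntidiagonal.antidiagonal m,
      wordSeries U x q.1 * Φ * wordSeries U x q.2 = 0 := by
  set D : PowerSeries R := PowerSeries.mk (wordSeries U x) with hD
  set δ : PowerSeries R := PowerSeries.mk x with hδ
  set u : PowerSeries R := PowerSeries.C U
  set b : PowerSeries R := PowerSeries.C d
  have hD' : D = δ - δ * u * D := mk_wordSeries U x hx
  have hφ : (PowerSeries.C Φ : PowerSeries R) = 1 - (b * u + u * b) := by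
    rw [← map_mul, ← map_mul, ← map_add, ← hΦ, map_sub, map_one, sub_sub_cancel]
  have hδ' : b * δ + δ * b + δ * δ = 0 := by
    ext m
    simp only [b, hδ, map_add, map_zero, PowerSeries.coeff_C_mul, PowerSeries.coeff_mul_C]
    simpa only [PowerSeries.coeff_mul, PowerSeries.coeff_mk] using hmc m
  set K : PowerSeries R := b * D + D * b + D * PowerSeries.C Φ * D with hK
  have hcoeff : PowerSeries.coeff m K = d * wordSeries U x m + wordSeries U x m * d +
      ∑ q ∈ Finset.HasAntidiagonal.antidiagonal m,
        wordSeries U x q.1 * Φ * wordSeries U x q.2 := by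
    simp only [hK, b, hD, map_add, PowerSeries.coeff_C_mul, PowerSeries.coeff_mul_C,
      PowerSeries.coeff_mul m (_ * _), PowerSeries.coeff_mk]
  rw [← hcoeff]
  -- In each summand of `K` that begins with `D`, this factor is replaced by `δ - δ u D`; in `b * D`
  -- the same is done and `b δ` is eliminated by the Maurer–Cartan equation for `δ`. After inserting
  -- the formula for `Φ` everything cancels except `-δ u K`.
  have hrec : K = -(δ * u * K) := by
    have e1 : b * D = -(δ * b) - δ * δ + (δ * b + δ * δ) * (u * D) := by
      have : b * δ = -(δ * b) - δ * δ := by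
        rw [← sub_eq_zero, ← hδ']; abel
      calc b * D = b * δ - b * δ * (u * D) := by
            conv_lhs => rw [hD']
            noncomm_ring
        _ = _ := by rw [this]; noncomm_ring
    have e2 : D * b = δ * b - δ * u * (D * b) := by
      conv_lhs => rw [hD']
      noncomm_ring
    have e3 : D * PowerSeries.C Φ * D = δ * D - δ * b * u * D - δ * u * (b * D) -
        δ * u * (D * PowerSeries.C Φ * D) := by
      calc D * PowerSeries.C Φ * D = δ * PowerSeries.C Φ * D -
            δ * u * (D * PowerSeries.C Φ * D) := by
            conv_lhs => rw [hD']
            rw [sub_mul, sub_mul]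
            conv_lhs => rw [← hD']
            noncomm_ring
        _ = _ := by
            congr 1
            rw [hφ]; noncomm_ring
    have e4 : δ * D = δ * δ - δ * δ * (u * D) := by
      conv_lhs => rw [hD']
      noncomm_ring
    rw [hK]
    linear_combination (norm := noncomm_ring) e1 + e2 + e3 + e4
  clear_value K
  clear hcoeff
  induction m using Nat.strong_induction_on with
  | _ m ih =>
    rw [hrec, map_neg, neg_eq_zero, PowerSeries.coeff_mul]
    refine Finset.sum_eq_zero fun q hq => ?_
    have := Finset.HasAntidiagonal.mem_antidiagonal.1 hq
    rw [PowerSeries.coeff_mul_C, PowerSeries.coeff_mk]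
    rcases Nat.eq_zero_or_pos q.1 with h0 | h0
    · rw [h0, hx, zero_mul, zero_mul]
    · rw [ih q.2 (by omega), mul_zero]

end WordSeries

/-! ### Coderivations of degree `e` -/

section MaurerCartan

/-- Elements of degree `e` are even after suspension, so they are permuted without signs. -/
theorem koszul_odd {k : Type*} [Field k] {Γ : Type*} [AddCommGroup Γ] {g : SignGrading Γ}
    {E : Type*} [AddCommGroup E] [Module k E] (V : DGLie k g E) {n : ℕ}
    (σ : Equiv.Perm (Fin n)) (y : Fin n → V.gr g.e) :
    koszul σ (fun j => (⟨g.e, y j⟩ : V.Hom)) = 1 := by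
  refine Finset.prod_eq_one fun q _ => ?_
  simp [DGLie.spar, g.par_e, zmod2_one_add_one, ksign_zero]

variable {k : Type*} [Field k] {Γ : Type*} [AddCommGroup Γ] [DecidableEq Γ] {g : SignGrading Γ}
  {A : Type*} [AddCommGroup A] [Module k A] {𝒜 : Γ → Submodule k A} [DirectSum.Decomposition 𝒜]

/-- The graded commutator of odd elements is the anticommutator. Summed over the symmetric set of
pairs it gives every product twice, which cancels `1 / 2`. -/
theorem coder_maurerCartan_coe (h2 : (2 : k) ≠ 0) (X : AInftyAlgebra 𝒜 g)
    (δ : ℕ → Coder 𝒜 g g.e) (m : ℕ) :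
    ((coderBracket g.e g.e ⟨X.diff, X.diff_mem⟩ (δ m) +
      (1 / 2 : k) • ∑ q ∈ Finset.HasAntidiagonal.antidiagonal m,
        coderBracket g.e g.e (δ q.1) (δ q.2) : Coder 𝒜 g (g.e + g.e)) :
        Module.End k (TensorAlgebra k A)) =
      X.diff * (δ m).1 + (δ m).1 * X.diff +
        ∑ q ∈ Finset.HasAntidiagonal.antidiagonal m, (δ q.1).1 * (δ q.2).1 := by
  have hbr : ∀ x y : Coder 𝒜 g g.e,
      (coderBracket g.e g.e x y : Module.End k (TensorAlgebra k A)) =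
        x.1 * y.1 + y.1 * x.1 := fun x y => by
    rw [coderBracket_coe, g.par_e, mul_one, ksign_one]
    refine LinearMap.ext fun z => ?_
    simp [sub_eq_add_neg]
  have hsum : ((∑ q ∈ Finset.HasAntidiagonal.antidiagonal m,
      coderBracket g.e g.e (δ q.1) (δ q.2) : Coder 𝒜 g (g.e + g.e)) :
        Module.End k (TensorAlgebra k A)) =
      (2 : k) • ∑ q ∈ Finset.HasAntidiagonal.antidiagonal m, (δ q.1).1 * (δ q.2).1 := by
    rw [AddSubmonoidClass.coe_finsetSum, two_smul]
    have hs : ∑ q ∈ Finset.HasAntidiagonal.antidiagonal m, (δ q.1).1 * (δ q.2).1 =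
        ∑ q ∈ Finset.HasAntidiagonal.antidiagonal m, (δ q.2).1 * (δ q.1).1 :=
      (Finset.sum_equiv (Equiv.prodComm ℕ ℕ) (by simp [add_comm]) fun _ _ => rfl)
    nth_rw 2 [hs]
    rw [← Finset.sum_add_distrib]
    exact Finset.sum_congr rfl fun q _ => hbr _ _
  rw [Submodule.coe_add, Submodule.coe_smul, hbr, hsum, smul_smul, one_div, inv_mul_cancel₀ h2,
    one_smul]

theorem isFormalMC_coder_iff (h2 : (2 : k) ≠ 0) (X : AInftyAlgebra 𝒜 g)
    (δ : ℕ → X.coder.gr g.e) : X.coder.IsFormalMC δ ↔ δ 0 = 0 ∧ ∀ m,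
      X.diff * (δ m : Module.End k (TensorAlgebra k A)) +
        (δ m : Module.End k (TensorAlgebra k A)) * X.diff +
        ∑ q ∈ Finset.HasAntidiagonal.antidiagonal m,
          (δ q.1 : Module.End k (TensorAlgebra k A)) * (δ q.2 : Module.End k _) = 0 := by
  refine and_congr_right fun _ => forall_congr' fun m => ?_
  rw [← coder_maurerCartan_coe h2 X δ m]
  exact Subtype.ext_iff

end MaurerCartan

/-! ### Values on elements of degree `e` and the transferred series -/

section TransferMaurerCartan

variable {k : Type*} [Field k] {Γ : Type*} [AddCommGroup Γ] [DecidableEq Γ]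
  {g : SignGrading Γ}
  {A : Type*} [AddCommGroup A] [Module k A] {𝒜 : Γ → Submodule k A} [DirectSum.Decomposition 𝒜]
  {B : Type*} [AddCommGroup B] [Module k B] {ℬ : Γ → Submodule k B} [DirectSum.Decomposition ℬ]
  {X : AInftyAlgebra 𝒜 g} {Y : AInftyAlgebra ℬ g}
  {F : TensorAlgebra k B →ₗ[k] TensorAlgebra k A} {F' : TensorAlgebra k A →ₗ[k] TensorAlgebra k B}
  {U : Module.End k (TensorAlgebra k A)}

theorem transferMorphism_app_odd [CharZero k] (h : IsSpecialRetraction 𝒜 ℬ g F F' U)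
    (hr : IsDeformationRetraction Y X F F' U) {n : ℕ} (y : Fin (n + 1) → X.coder.gr g.e) :
    (transferMorphism two_ne_zero h hr).app (fun j => (⟨g.e, y j⟩ : X.coder.Hom)) =
      (-1 : k) ^ n • ∑ σ : Equiv.Perm (Fin (n + 1)),
        transferWord F F' U (fun j => (y (σ j) : Module.End k (TensorAlgebra k A))) := by
  rw [transferMorphism_app]
  congr 1
  refine Finset.sum_congr rfl fun σ _ => ?_
  rw [koszul_odd, one_smul]

theorem transferWord_const (f : Module.End k (TensorAlgebra k A)) (n : ℕ) :
    transferWord F F' U (fun _ : Fin (n + 1) => f) =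
      F' ∘ₗ ((f * U) ^ n * f : Module.End k (TensorAlgebra k A)) ∘ₗ F := by
  rw [transferWord, List.ofFn_const, List.prod_replicate]

theorem transferMorphism_app_const [CharZero k] (h : IsSpecialRetraction 𝒜 ℬ g F F' U)
    (hr : IsDeformationRetraction Y X F F' U) (n : ℕ) (δ : X.coder.gr g.e) :
    (1 / (n + 1).factorial : k) •
      (transferMorphism two_ne_zero h hr).app (fun _ : Fin (n + 1) => ⟨g.e, δ⟩) =
        (-1 : k) ^ n • F' ∘ₗ ((δ.1 * U) ^ n * δ.1 : Module.End k (TensorAlgebra k A)) ∘ₗ F := by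
  have hf : ((n + 1).factorial : k) ≠ 0 := Nat.cast_ne_zero.2 (Nat.factorial_ne_zero _)
  rw [transferMorphism_app_odd h hr fun _ => δ, transferWord_const, Finset.sum_const,
    Finset.card_univ, Fintype.card_perm, Fintype.card_fin, smul_comm, ← Nat.cast_smul_eq_nsmul k,
    smul_smul, smul_smul, one_div, mul_assoc, inv_mul_cancel₀ hf,
    mul_one]

/-- A permutation of the letters permutes the compositions of `m`. All `(n + 1)!` inner sums
therefore agree and cancel the factorial. -/
theorem transferMorphism_app_series [CharZero k] (h : IsSpecialRetraction 𝒜 ℬ g F F' U)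
    (hr : IsDeformationRetraction Y X F F' U) (n m : ℕ) (δ : ℕ → X.coder.gr g.e) :
    (1 / (n + 1).factorial : k) • ∑ i ∈ Finset.Nat.antidiagonalTuple (n + 1) m,
      (transferMorphism two_ne_zero h hr).app (fun j => ⟨g.e, δ (i j)⟩) =
    (-1 : k) ^ n • ∑ i ∈ Finset.Nat.antidiagonalTuple (n + 1) m,
      transferWord F F' U (fun j => (δ (i j) : Module.End k (TensorAlgebra k A))) := by
  have hf : ((n + 1).factorial : k) ≠ 0 := Nat.cast_ne_zero.2 (Nat.factorial_ne_zero _)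
  have hperm : ∀ σ : Equiv.Perm (Fin (n + 1)), ∑ i ∈ Finset.Nat.antidiagonalTuple (n + 1) m,
      transferWord F F' U (fun j => (δ (i (σ j)) : Module.End k (TensorAlgebra k A))) =
      ∑ i ∈ Finset.Nat.antidiagonalTuple (n + 1) m,
        transferWord F F' U (fun j => (δ (i j) : Module.End k (TensorAlgebra k A))) := by
    intro σ
    refine Finset.sum_equiv (σ.symm.arrowCongr (Equiv.refl ℕ)) (fun i => ?_) fun i _ => rfl
    rw [Finset.Nat.mem_antidiagonalTuple, Finset.Nat.mem_antidiagonalTuple]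
    simp only [Equiv.arrowCongr_apply, Equiv.symm_symm, Equiv.coe_refl, Function.comp_apply, id_eq]
    rw [Equiv.sum_comp σ i]
  rw [Finset.sum_congr rfl fun i _ => transferMorphism_app_odd h hr fun j => δ (i j),
    ← Finset.smul_sum, Finset.sum_comm, Finset.sum_congr rfl fun σ _ => hperm σ,
    Finset.sum_const, Finset.card_univ, Fintype.card_perm, Fintype.card_fin, smul_comm,
    ← Nat.cast_smul_eq_nsmul k, smul_smul, smul_smul, one_div, mul_assoc, inv_mul_cancel₀ hf,
    mul_one]

theorem sandwich_wordSeries (x : ℕ → Module.End k (TensorAlgebra k A)) (m : ℕ) :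
    sandwich F F' (wordSeries U x m) = ∑ n ∈ Finset.range m, (-1 : k) ^ n •
      ∑ i ∈ Finset.Nat.antidiagonalTuple (n + 1) m, transferWord F F' U (fun j => x (i j)) := by
  rw [wordSeries, map_sum]
  refine Finset.sum_congr rfl fun n _ => ?_
  rw [wordCoeff, map_sum, Finset.smul_sum]
  exact Finset.sum_congr rfl fun i _ => (transferWord_eq_sandwich F F' U _).symm

theorem IsSpecialRetraction.sandwich_wordSeries_mem (h : IsSpecialRetraction 𝒜 ℬ g F F' U)
    (δ : ℕ → Coder 𝒜 g g.e) (m : ℕ) :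
    sandwich F F' (wordSeries U (fun j => (δ j).1) m) ∈ Coder ℬ g g.e := by
  rw [sandwich_wordSeries]
  refine Submodule.sum_mem _ fun n _ => Submodule.smul_mem _ _ (Submodule.sum_mem _ fun i _ => ?_)
  have := h.transferWord_mem fun j => (δ (i j)).2
  rwa [Finset.sum_eq_zero fun _ _ => sub_self g.e, add_zero] at this

/-- The transfer of formal solutions of the Maurer–Cartan equation. -/
theorem transfer_maurerCartan [CharZero k] (h : IsSpecialRetraction 𝒜 ℬ g F F' U)
    (hr : IsDeformationRetraction Y X F F' U) (δ : ℕ → X.coder.gr g.e)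
    (hδ : X.coder.IsFormalMC δ) :
    ∃ δ' : ℕ → Y.coder.gr g.e, Y.coder.IsFormalMC δ' ∧ ∀ m,
      (δ' m : Module.End k (TensorAlgebra k B)) =
        ∑ n ∈ Finset.range m, (1 / (n + 1).factorial : k) •
          ∑ i ∈ Finset.Nat.antidiagonalTuple (n + 1) m,
            (transferMorphism two_ne_zero h hr).app (fun j => ⟨g.e, δ (i j)⟩) ∧
      (δ' m : Module.End k (TensorAlgebra k B)) =
        ∑ n ∈ Finset.range m, (-1 : k) ^ n •
          ∑ i ∈ Finset.Nat.antidiagonalTuple (n + 1) m,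
            transferWord F F' U (fun j => (δ (i j) : Module.End k _)) := by
  obtain ⟨h0, hmc⟩ := (isFormalMC_coder_iff two_ne_zero X δ).1 hδ
  let x : ℕ → Module.End k (TensorAlgebra k A) := fun m => δ m
  have hx : x 0 = 0 := congrArg Subtype.val h0
  refine ⟨fun m => ⟨sandwich F F' (wordSeries U x m), h.sandwich_wordSeries_mem δ m⟩,
    (isFormalMC_coder_iff two_ne_zero Y _).2 ⟨Subtype.ext ?_, fun m => ?_⟩, fun m => ⟨?_, ?_⟩⟩
  · change sandwich F F' (wordSeries U x 0) = 0
    rw [wordSeries, Finset.sum_range_zero, map_zero]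
  -- The inner `Φ = F F'` splits `F' D Φ D F` into the product of two transferred series, and the
  -- chain map properties of `F` and `F'` turn `d` into the differential of the target.
  · have key := congrArg (sandwich F F') (wordSeries_maurerCartan U x hx hr.homotopy hmc m)
    rw [map_zero, map_add, map_add, map_sum] at key
    rw [← key]
    congr 2
    · change Y.diff ∘ₗ F' ∘ₗ (wordSeries U x m) ∘ₗ F = F' ∘ₗ (X.diff ∘ₗ wordSeries U x m) ∘ₗ F
      rw [← LinearMap.comp_assoc, ← hr.F'_comm]; rfl
    · change (F' ∘ₗ (wordSeries U x m) ∘ₗ F) ∘ₗ Y.diff = F' ∘ₗ (wordSeries U x m ∘ₗ X.diff) ∘ₗ F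
      rw [LinearMap.comp_assoc, LinearMap.comp_assoc, hr.F_comm]; rfl
  · simp only [transferMorphism_app_series]
    exact sandwich_wordSeries x m
  · exact sandwich_wordSeries x m

end TransferMaurerCartan

end AInf

end

/-! ### The main theorem -/

theorem theorem2 {k : Type*} [Field k] [CharZero k]
    {Γ : Type*} [AddCommGroup Γ] [DecidableEq Γ] (g : SignGrading Γ)
    {A : Type*} [AddCommGroup A] [Module k A]
    (𝒜 : Γ → Submodule k A) [DirectSum.Decomposition 𝒜]
    {H : Type*} [AddCommGroup H] [Module k H]
    (ℋ : Γ → Submodule k H) [DirectSum.Decomposition ℋ]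
    (X : AInftyAlgebra 𝒜 g) (Y : AInftyAlgebra ℋ g) (hY : Y.IsMinimal)
    (F : TensorAlgebra k H →ₗ[k] TensorAlgebra k A) (hF : IsAInftyQuasiIso Y X F) :
    (∃ (π : A →ₗ[k] H) (G : A →ₗ[k] A), IsPropagator 𝒜 ℋ g (lin₁ X.diff) (lin₁ F) π G) ∧
    ∀ (π : A →ₗ[k] H) (G : A →ₗ[k] A), IsPropagator 𝒜 ℋ g (lin₁ X.diff) (lin₁ F) π G →
      (∃! P : (TensorAlgebra k A →ₗ[k] TensorAlgebra k H) × Module.End k (TensorAlgebra k A),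
        IsRecursiveRetraction X F π G P.1 P.2) ∧
      ∀ (F' : TensorAlgebra k A →ₗ[k] TensorAlgebra k H) (U : Module.End k (TensorAlgebra k A)),
        IsRecursiveRetraction X F π G F' U →
        IsDeformationRetraction Y X F F' U ∧
        ∃ L : LInftyMorphism X.coder Y.coder,
          (∀ (n : ℕ) (x : Fin (n + 1) → X.coder.Hom),
            L.app x = (-1 : k) ^ n • ∑ σ : Equiv.Perm (Fin (n + 1)),
              koszul σ x • transferWord F F' U (fun i => ((x (σ i)).2 : Module.End k _))) ∧
          (∀ (n : ℕ) (δ : X.coder.gr g.e),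
            (1 / (n + 1).factorial : k) • L.app (fun _ : Fin (n + 1) => ⟨g.e, δ⟩) =
              (-1 : k) ^ n •
                F' ∘ₗ ((δ.1 * U) ^ n * δ.1 : Module.End k (TensorAlgebra k A)) ∘ₗ F) ∧
          (∀ δ : ℕ → X.coder.gr g.e, X.coder.IsFormalMC δ →
            ∃ δ' : ℕ → Y.coder.gr g.e, Y.coder.IsFormalMC δ' ∧ ∀ m,
              (δ' m : Module.End k (TensorAlgebra k H)) =
                ∑ n ∈ Finset.range m, (1 / (n + 1).factorial : k) •
                  ∑ i ∈ Finset.Nat.antidiagonalTuple (n + 1) m,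
                    L.app (fun j => ⟨g.e, δ (i j)⟩) ∧
              (δ' m : Module.End k (TensorAlgebra k H)) =
                ∑ n ∈ Finset.range m, (-1 : k) ^ n •
                  ∑ i ∈ Finset.Nat.antidiagonalTuple (n + 1) m,
                    transferWord F F' U (fun j => (δ (i j) : Module.End k _))) := by
  refine ⟨hF.exists_isPropagator hY, fun π G hp => ⟨?_, fun F' U h => ?_⟩⟩
  · obtain ⟨F', U, h⟩ := exists_isRecursiveRetraction X hF.toIsCoalgMorphism π G
    refine ⟨(F', U), h, fun P hP => ?_⟩
    obtain ⟨h1, h2⟩ := IsRecursiveRetraction.unique hP h hF.map_one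
    exact Prod.ext h1 h2
  · have hr := h.isDeformationRetraction hF.toIsAInftyMorphism hY hp
    have hs := h.isSpecialRetraction hF.toIsCoalgMorphism hp
    exact ⟨hr, transferMorphism two_ne_zero hs hr, transferMorphism_app two_ne_zero hs hr,
      transferMorphism_app_const hs hr, transfer_maurerCartan hs hr⟩
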